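/- Let $\lambda\in\{1,-1\}$, let $m,n\ge 1$ be integers, and let $g_0,g_1,g_2:[0,\infty)\to\mathbb R$ satisfy, for $j=0,1,2$, $$g_j\in C^{[\frac{m+5-j}{3}]}([0,\infty)),\qquad (1+t)^n g_j^{(i)}(t)\in L^1([0,\infty)),\quad i=0,1,\dots,\Big[\tfrac{m+5-j}{3}\Big],$$ where $[x]$ denotes the integer part of $x$. Let $D_\pm=\{k\in\mathbb C:\operatorname{Im} k\neq 0,\ \pm\operatorname{Im} k^3>0\}$, let $\bar D_\pm$ be their closures in $\mathbb C$, and let $\Gamma=\mathbb R\cup e^{i\pi/3}\mathbb R\cup e^{2i\pi/3}\mathbb R$. Put $\sigma_3=\operatorname{diag}(1,-1)$, $e^{s\hat\sigma_3}M=e^{s\sigma_3}Me^{-s\sigma_3}$ and $$\mathsf V(t,k)=\begin{pmatrix}-2i\lambda kg_0^2 & -4k^2g_0+2ikg_1-2\lambda g_0^3+g_2\\ -4\lambda k^2g_0-2i\lambda kg_1-2g_0^3+\lambda g_2 & 2i\lambda kg_0^2\end{pmatrix},\qquad g_j=g_j(t).$$ Consider the Volterra equation $$T(t,k)=I+\int_\infty^t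 e^{4ik^3(t'-t)\hat\sigma_3}\,\mathsf V(t',k)T(t',k)\,dt',\qquad t\ge 0,$$ for a $2\times2$ matrix $T(t,k)$ whose first column is considered for $k\in\bar D_-$ and whose second column is considered for $k\in\bar D_+$ (the equation decouples into the two columns); a solution is required to be continuous in $t\ge 0$ and to make the integral absolutely convergent. This equation has a unique solution $T$. Let $S(k)=T(0,k)$ and, for $k\in\bar D_+$, let $A(k)=S(k)_{22}$ and $B(k)=S(k)_{12}$. Then $S(k)_{11}=\overline{A(\bar k)}$ and $S(k)_{21}=\lambda\overline{B(\bar k)}$ for $k\in\bar D_-$, and the spectral functions $A$ and $B$ have the following properties. (a) $A$ and $B$ are continuous on $\bar D_+$ and analytic in $D_+$. (b) There exist complex constants $\{A_l,B_l\}_{l=1}^m$ such that $$A(k)=1+\frac{A_1}{k}+\cdots+\frac{A_m}{k^m}+O\Big(\frac1{k^{m+1}}\Big),\qquad B(k)=\frac{B_1}{k}+\cdots+\frac{B_m}{k^m}+O\Big(\frac1{k^{m+1}}\Big)$$ uniformly as $k\to\infty$ with $k\in\bar D_+$. (c) For $j=1,\dots,n$, the derivatives $A^{(j)}$ and $B^{(j)}$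 (taken in $D_+$) have continuous extensions to $\bar D_+$ and, with the same constants as in (b), $$A^{(j)}(k)=\frac{d^j}{dk^j}\Big(1+\frac{A_1}{k}+\cdots+\frac{A_m}{k^m}\Big)+O\Big(\frac1{k^{m+1-2j}}\Big),\qquad B^{(j)}(k)=\frac{d^j}{dk^j}\Big(\frac{B_1}{k}+\cdots+\frac{B_m}{k^m}\Big)+O\Big(\frac1{k^{m+1-2j}}\Big)$$ uniformly as $k\to\infty$ with $k\in\bar D_+$. (d) $A(k)=\overline{A(-\bar k)}$ and $B(k)=\overline{B(-\bar k)}$ for $k\in\bar D_+$. (e) $A(k)\overline{A(\bar k)}-\lambda B(k)\overline{B(\bar k)}=1$ for $k\in\Gamma$. -/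

import Mathlib

open Set Filter Asymptotics MeasureTheory
open scoped ComplexConjugate

noncomputable section

namespace MKdV

/-- The four open sectors of the complex `k`-plane. -/
def D₁ : Set ℂ := {k | k.im < 0 ∧ 0 < (k ^ 3).im}

def D₂ : Set ℂ := {k | k.im < 0 ∧ (k ^ 3).im < 0}

def D₃ : Set ℂ := {k | 0 < k.im ∧ 0 < (k ^ 3).im}

def D₄ : Set ℂ := {k | 0 < k.im ∧ (k ^ 3).im < 0}

def Dplus : Set ℂ := D₁ ∪ D₃

def Dminus : Set ℂ := D₂ ∪ D₄

/-- The contour `ℝ ∪ e^{iπ/3} ℝ ∪ e^{2iπ/3} ℝ` (as a set). -/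
def Γ : Set ℂ :=
  {k | ∃ r : ℝ, k = r ∨ k = Complex.exp (Complex.I * Real.pi / 3) * r ∨
    k = Complex.exp (2 * Complex.I * Real.pi / 3) * r}

/-- Regularity and decay of the boundary values: for `j = 0, 1, 2`, `g_j` is of class `C^p` on
`[0, ∞)` and `(1 + t)^n g_j^{(i)}` is integrable there for `i = 0, …, p`, where
`p = ⌊(m + 5 - j) / 3⌋`. -/
def BoundaryData (m n : ℕ) (g : Fin 3 → ℝ → ℝ) : Prop :=
  ∀ j : Fin 3,
    ContDiffOn ℝ (((m + 5 - (j : ℕ)) / 3 : ℕ) : WithTop ℕ∞) (g j) (Ici 0) ∧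
    ∀ i ≤ (m + 5 - (j : ℕ)) / 3,
      IntegrableOn (fun t : ℝ => (1 + t) ^ n * iteratedDerivWithin i (g j) (Ici 0) t) (Ici 0)

/-- The matrix `𝖵(t, k)` of the `t`-part of the Lax pair. -/
def V (lam : ℝ) (g : Fin 3 → ℝ → ℝ) (t : ℝ) (k : ℂ) : Matrix (Fin 2) (Fin 2) ℂ :=
  !![-2 * Complex.I * lam * k * g 0 t ^ 2,
      -4 * k ^ 2 * g 0 t + 2 * Complex.I * k * g 1 t - 2 * lam * g 0 t ^ 3 + g 2 t;
     -4 * lam * k ^ 2 * g 0 t - 2 * Complex.I * lam * k * g 1 t - 2 * g 0 t ^ 3 + lam * g 2 t,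
      2 * Complex.I * lam * k * g 0 t ^ 2]

/-- `e^{s σ̂₃} M = e^{s σ₃} M e^{-s σ₃}`, where `σ₃ = diag(1, -1)`. -/
def expHatσ₃ (s : ℂ) (M : Matrix (Fin 2) (Fin 2) ℂ) : Matrix (Fin 2) (Fin 2) ℂ :=
  Matrix.diagonal ![Complex.exp s, Complex.exp (-s)] * M *
    Matrix.diagonal ![Complex.exp (-s), Complex.exp s]

/-- The domain `k ∈ (D̄₋, D̄₊)`: the first column is considered on `D̄₋`, the second on `D̄₊`. -/
def columnDomain : Fin 2 → Set ℂ := ![closure Dminus, closure Dplus]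

/-- `T` solves the Volterra equation
`T(t,k) = I + ∫_∞^t e^{4ik³(t'-t)σ̂₃} (𝖵T)(t',k) dt'` for `t ≥ 0` and `k ∈ (D̄₋, D̄₊)`.
Column `i` of the integrand involves only column `i` of `T`, so the equation is imposed column by
column, each for the `k` in its own domain. -/
def IsVolterraSolution (lam : ℝ) (g : Fin 3 → ℝ → ℝ)
    (T : ℝ → ℂ → Matrix (Fin 2) (Fin 2) ℂ) : Prop :=
  ∀ i : Fin 2, ∀ k ∈ columnDomain i, ∀ a : Fin 2,
    ContinuousOn (fun t => T t k a i) (Ici 0) ∧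
    ∀ t : ℝ, 0 ≤ t →
      IntegrableOn (fun s : ℝ =>
        expHatσ₃ (4 * Complex.I * k ^ 3 * (s - t)) (V lam g s k * T s k) a i) (Ioi t) ∧
      T t k a i = (1 : Matrix (Fin 2) (Fin 2) ℂ) a i -
        ∫ s in Ioi t, expHatσ₃ (4 * Complex.I * k ^ 3 * (s - t)) (V lam g s k * T s k) a i

/-- The eigenfunction `T(t, k)` normalized at `t = ∞`: the solution of the Volterra equation
(which is unique for `t ≥ 0` and `k ∈ (D̄₋, D̄₊)`; elsewhere the values mean nothing). -/
def T (lam : ℝ) (g : Fin 3 → ℝ → ℝ) : ℝ → ℂ → Matrix (Fin 2) (Fin 2) ℂ :=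
  Classical.epsilon (IsVolterraSolution lam g)

/-- `S(k) = T(0, k)`. -/
def S (lam : ℝ) (g : Fin 3 → ℝ → ℝ) (k : ℂ) : Matrix (Fin 2) (Fin 2) ℂ := T lam g 0 k

/-- The spectral function `A(k)`, `k ∈ D̄₊`: the (2,2) entry of `S(k)`. -/
def A (lam : ℝ) (g : Fin 3 → ℝ → ℝ) (k : ℂ) : ℂ := S lam g k 1 1

/-- The spectral function `B(k)`, `k ∈ D̄₊`: the (1,2) entry of `S(k)`. -/
def B (lam : ℝ) (g : Fin 3 → ℝ → ℝ) (k : ℂ) : ℂ := S lam g k 0 1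

/-- `c₀ + c₁ / k + ⋯ + c_m / k^m`. -/
def expansion (c₀ : ℂ) (c : ℕ → ℂ) (m : ℕ) (k : ℂ) : ℂ :=
  c₀ + ∑ l ∈ Finset.Icc 1 m, c l / k ^ l

/-- The filter of neighborhoods of `∞` in `D̄₊`: "uniformly as `k → ∞` with `k ∈ D̄₊`". -/
def atInfty : Filter ℂ := Bornology.cobounded ℂ ⊓ 𝓟 (closure Dplus)

/-- The `j`-th derivative of `f`, taken in the open set `D₊`, extends continuously to a function
on `D̄₊` that equals the `j`-th derivative of `P` up to an error `O(k^{-(m+1-2j)})`, uniformly as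
`k → ∞` with `k ∈ D̄₊`. -/
def DerivExpansion (f P : ℂ → ℂ) (m j : ℕ) : Prop :=
  ∃ F : ℂ → ℂ, ContinuousOn F (closure Dplus) ∧
    (∀ k ∈ Dplus, F k = iteratedDeriv j f k) ∧
    (fun k => F k - iteratedDeriv j P k) =O[atInfty]
      fun k => k ^ (-((m : ℤ) + 1 - 2 * (j : ℤ)))

end MKdV

end

noncomputable section

namespace MKdV

open scoped NNReal BoundedContinuousFunction Topology

/-! ### Volterra operators on bounded continuous functions -/

/-! The second column of the Volterra equation reads `x + K(k) x = (0, 1)` for pairs of bounded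
continuous functions on `[0, ∞)`, where `K(k)` is a matrix of Volterra operators with kernels
`e^{8ik³(s-t)}` and `1` acting on the entries of `V`. For `k ∈ D̄₊` these kernels are bounded by 1,
so conjugation with an exponential of a tail integral makes `K(k)` a contraction, and `1 + K(k)` is
invertible (`isUnit_one_add_volterra`). The `n` moments of the data make the operator with kernel
`e^{izτ}` a `C^n` function of `z` in the closed upper half-plane, in operator norm
(`contDiffOn_oscOp`). Composing with `z = 8k³` and inverting gives a column that is `C^n` up to the
boundary of `D₊` (`contDiffOn_column`): this is (a) and the continuous extension in (c). Symmetries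
of `V` and uniqueness give the first column and (d); (e) holds because `V` has trace zero, so that
the determinant is constant in `t`.

For the expansion, the differential equation has a formal solution `∑ k^{-l} (o_l, d_l)`. The `o_l`
are found algebraically and the `d_l` by integration from infinity; three steps in `l` cost one
derivative, which is what the hypotheses supply. The truncated sum leaves a residual of order
`k^{-m-1}` (`hasDerivWithinAt_formal`). Since `V` grows like `k²`, the difference `y` of the true
and formal columns cannot be estimated directly from the Volterra equation. Instead `y` is paired by
determinants with the two columns of the formal matrix, the first being the reflection of the
second. The derivatives of these determinants involve `V` only through its trace, so only residuals
remain. As the determinants equal `y` up to `O(1/k) y`, integration yields `y = r + R(k) y` with `r`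
of order `k^{-m-1}` and `R` of order `1/k` (`remainder_eq`).

Derivatives in `k` are handled by the class `IsSymbol n a`, where the `j`-th derivative is
`O(k^{2j-a})`; the loss of `k²` per derivative is that of `e^{8ik³τ}`. The class is stable under
products, and `IsSymbol.of_fixedPoint` transfers the order of `r` to `y`. Evaluation at `t = 0`
gives (b) and (c), with `A_l = d_l(0)` and `B_l = o_l(0)`. -/

/-- Continuous functions on `[0, ∞)` that are integrable with the weight `(1 + t) ^ n`. -/
def WeightedL1 (n : ℕ) (q : ℝ → ℂ) : Prop :=
  ContinuousOn q (Ici 0) ∧ IntegrableOn (fun s : ℝ => (1 + s) ^ n * ‖q s‖) (Ioi 0)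

/-- Continuous convolution kernels that grow at most like `(1 + τ) ^ n`. -/
def IsKernel (n : ℕ) (κ : ℝ → ℂ) : Prop :=
  Continuous κ ∧ ∃ C : ℝ, ∀ τ : ℝ, 0 ≤ τ → ‖κ τ‖ ≤ C * (1 + τ) ^ n

lemma WeightedL1.mono {n n' : ℕ} (h : n' ≤ n) {q : ℝ → ℂ} (hq : WeightedL1 n q) :
    WeightedL1 n' q := by
  refine ⟨hq.1, Integrable.mono' hq.2 ?_ ?_⟩
  · refine ContinuousOn.aestronglyMeasurable ?_ measurableSet_Ioi
    have := hq.1.mono Ioi_subset_Ici_self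
    fun_prop
  · refine (ae_restrict_iff' measurableSet_Ioi).2 (ae_of_all _ fun s hs => ?_)
    have hs : 0 < s := hs
    rw [Real.norm_of_nonneg (by positivity)]
    gcongr
    linarith

lemma WeightedL1.integrableOn {n : ℕ} {q : ℝ → ℂ} (hq : WeightedL1 n q) :
    IntegrableOn q (Ioi 0) := by
  have h := (hq.mono (Nat.zero_le n)).2
  simp only [pow_zero, one_mul] at h
  exact (integrable_norm_iff ((hq.1.mono Ioi_subset_Ici_self).aestronglyMeasurable
    measurableSet_Ioi)).1 h

lemma weightedL1_iff_norm {n : ℕ} {q : ℝ → ℂ} (hq : ContinuousOn q (Ici 0)) {p : ℝ → ℝ}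
    (hp : IntegrableOn p (Ioi 0)) (h : ∀ s, 0 < s → (1 + s) ^ n * ‖q s‖ ≤ p s) :
    WeightedL1 n q := by
  refine ⟨hq, Integrable.mono' hp ?_ ?_⟩
  · refine ContinuousOn.aestronglyMeasurable ?_ measurableSet_Ioi
    have := hq.mono Ioi_subset_Ici_self
    fun_prop
  · refine (ae_restrict_iff' measurableSet_Ioi).2 (ae_of_all _ fun s hs => ?_)
    have hs' : 0 < s := hs
    rw [Real.norm_of_nonneg (by positivity)]
    exact h s hs

lemma weightedL1_zero (n : ℕ) : WeightedL1 n (fun _ => 0) :=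
  weightedL1_iff_norm continuousOn_const (integrable_zero _ _ _) (by simp)

lemma WeightedL1.congr {n : ℕ} {q q' : ℝ → ℂ} (hq : WeightedL1 n q) (h : EqOn q' q (Ici 0)) :
    WeightedL1 n q' := by
  refine weightedL1_iff_norm (hq.1.congr h) hq.2 fun s hs => ?_
  rw [h (mem_Ici.2 hs.le)]

lemma WeightedL1.add {n : ℕ} {q q' : ℝ → ℂ} (hq : WeightedL1 n q) (hq' : WeightedL1 n q') :
    WeightedL1 n (fun s => q s + q' s) := by
  refine weightedL1_iff_norm (hq.1.add hq'.1) (hq.2.add hq'.2) fun s hs => ?_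
  simp only [Pi.add_apply, ← mul_add]
  gcongr
  exact norm_add_le _ _

lemma WeightedL1.bdd_mul {n : ℕ} {f q : ℝ → ℂ} (hf : ContinuousOn f (Ici 0)) {C : ℝ}
    (hC : ∀ t, 0 ≤ t → ‖f t‖ ≤ C) (hq : WeightedL1 n q) :
    WeightedL1 n (fun s => f s * q s) := by
  refine weightedL1_iff_norm (hf.mul hq.1) (hq.2.const_mul C) fun s hs => ?_
  rw [norm_mul]
  have := hC s hs.le
  calc (1 + s) ^ n * (‖f s‖ * ‖q s‖) = ‖f s‖ * ((1 + s) ^ n * ‖q s‖) := by ring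
    _ ≤ _ := by gcongr

lemma WeightedL1.const_mul {n : ℕ} {q : ℝ → ℂ} (c : ℂ) (hq : WeightedL1 n q) :
    WeightedL1 n (fun s => c * q s) :=
  hq.bdd_mul continuousOn_const (C := ‖c‖) (fun _ _ => le_rfl)

lemma WeightedL1.neg {n : ℕ} {q : ℝ → ℂ} (hq : WeightedL1 n q) :
    WeightedL1 n (fun s => - q s) :=
  (hq.const_mul (-1)).congr fun s _ => by simp

lemma WeightedL1.sub {n : ℕ} {q q' : ℝ → ℂ} (hq : WeightedL1 n q) (hq' : WeightedL1 n q') :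
    WeightedL1 n (fun s => q s - q' s) :=
  (hq.add hq'.neg).congr fun s _ => by simp [sub_eq_add_neg]

lemma WeightedL1.conj {n : ℕ} {q : ℝ → ℂ} (hq : WeightedL1 n q) :
    WeightedL1 n (fun s => conj (q s)) := by
  refine weightedL1_iff_norm (Complex.continuous_conj.comp_continuousOn hq.1) hq.2 fun s hs => ?_
  simp

/-! #### Tails of integrals -/

lemma hasDerivAt_tail {E : Type*} [NormedAddCommGroup E] [NormedSpace ℝ E] [CompleteSpace E]
    {f : ℝ → E} (hf : ContinuousOn f (Ici 0)) (hi : IntegrableOn f (Ioi 0)) {t : ℝ} (ht : 0 ≤ t) :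
    HasDerivWithinAt (fun t => ∫ s in Ioi t, f s) (-f t) (Ici 0) t := by
  have h1 : EqOn (fun t => ∫ s in Ioi t, f s) (fun t => (∫ s in Ioi 0, f s) - ∫ s in (0:ℝ)..t, f s)
      (Ici 0) := fun t ht => by
    simp only
    rw [← intervalIntegral.integral_Ioi_sub_Ioi hi ht]
    abel
  have h2 : HasDerivWithinAt (fun t => ∫ s in (0:ℝ)..t, f s) (f t) (Ici 0) t := by
    -- Freezing `f` at `f 0` to the left of the origin gives a function continuous on the whole
    -- line, so the fundamental theorem of calculus applies at `t = 0` as well.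
    have hcont : ContinuousOn (fun s => f (max s 0)) univ := by
      refine hf.comp (by fun_prop) fun s _ => by simp
    have hc : Continuous (fun s => f (max s 0)) := continuousOn_univ.1 hcont
    have h3 := (hc.integral_hasStrictDerivAt 0 t).hasDerivAt.hasDerivWithinAt (s := Ici 0)
    rw [max_eq_left ht] at h3
    refine h3.congr (fun x hx => ?_) ?_
    · refine intervalIntegral.integral_congr fun s hs => ?_
      rw [uIcc_of_le hx] at hs
      simp [max_eq_left hs.1]
    · refine intervalIntegral.integral_congr fun s hs => ?_
      rw [uIcc_of_le ht] at hs
      simp [max_eq_left hs.1]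
  have h3 := (h2.const_sub (∫ s in Ioi 0, f s))
  exact h3.congr h1 (h1 ht)

lemma tendsto_tail {E : Type*} [NormedAddCommGroup E] [NormedSpace ℝ E]
    (f : ℝ → E) : Tendsto (fun t : ℝ => ∫ s in Ioi t, f s) atTop (𝓝 0) :=
  tendsto_integral_Ioi_zero tendsto_id

lemma IntegrableOn.tail {E : Type*} [NormedAddCommGroup E] {f : ℝ → E}
    (hi : IntegrableOn f (Ioi 0)) {t : ℝ} (ht : 0 ≤ t) : IntegrableOn f (Ioi t) :=
  hi.mono_set (Ioi_subset_Ioi ht)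

/-- The exponential weight `e^{M ∫_t^∞ p}` reduces the tail integral by the factor `M`. -/
lemma integral_mul_exp_tail {p : ℝ → ℝ} (hp : ContinuousOn p (Ici 0)) (hi : IntegrableOn p (Ioi 0))
    (h0 : ∀ t, 0 ≤ t → 0 ≤ p t) {M : ℝ} (hM : 0 < M) {t : ℝ} (ht : 0 ≤ t) :
    IntegrableOn (fun s => p s * Real.exp (M * ∫ r in Ioi s, p r)) (Ioi t) ∧
    ∫ s in Ioi t, p s * Real.exp (M * ∫ r in Ioi s, p r) ≤
      Real.exp (M * ∫ r in Ioi t, p r) / M := by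
  have hd : ∀ s, 0 ≤ s → HasDerivWithinAt (fun s => Real.exp (M * ∫ r in Ioi s, p r))
      (Real.exp (M * ∫ r in Ioi s, p r) * (M * -p s)) (Ici 0) s := fun s hs =>
    ((hasDerivAt_tail hp hi hs).const_mul M).exp
  have hlim : Tendsto (fun s => Real.exp (M * ∫ r in Ioi s, p r)) atTop (𝓝 1) := by
    have h := ((tendsto_tail p).const_mul M)
    rw [mul_zero] at h
    have h2 := (Real.continuous_exp.tendsto 0).comp h
    rwa [Real.exp_zero] at h2
  have hcont : ContinuousOn (fun s => Real.exp (M * ∫ r in Ioi s, p r)) (Ici 0) := fun s hs =>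
    (hd s hs).continuousWithinAt
  have hI : IntegrableOn (fun s => p s * Real.exp (M * ∫ r in Ioi s, p r)) (Ioi 0) := by
    refine Integrable.mono' (hi.mul_const (Real.exp (M * ∫ r in Ioi 0, p r))) ?_ ?_
    · exact ((hp.mul hcont).mono Ioi_subset_Ici_self).aestronglyMeasurable measurableSet_Ioi
    · refine (ae_restrict_iff' measurableSet_Ioi).2 (ae_of_all _ fun s hs => ?_)
      have hs' : 0 < s := hs
      have := h0 s hs'.le
      rw [Real.norm_of_nonneg (by positivity)]
      gcongr p s * Real.exp (M * ?_)
      refine setIntegral_mono_set hi ?_ (Ioi_subset_Ioi hs'.le).eventuallyLE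
      exact (ae_restrict_iff' measurableSet_Ioi).2 (ae_of_all _ fun r hr => h0 r (le_of_lt hr))
  refine ⟨IntegrableOn.tail hI ht, ?_⟩
  have hF := integral_Ioi_of_hasDerivAt_of_tendsto (a := t)
    (((hcont t ht).mono (Ici_subset_Ici.2 ht)))
    (fun s hs => (hd s (ht.trans (le_of_lt hs))).hasDerivAt (Ici_mem_nhds (lt_of_le_of_lt ht hs)))
    ?_ hlim
  · have h2 : ∫ s in Ioi t, Real.exp (M * ∫ r in Ioi s, p r) * (M * -p s) =
        -M * ∫ s in Ioi t, p s * Real.exp (M * ∫ r in Ioi s, p r) := by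
      rw [← integral_const_mul]
      congr 1 with s
      ring
    rw [h2] at hF
    rw [le_div_iff₀ hM]
    linarith
  · refine ((IntegrableOn.tail hI ht).const_mul (-M)).congr (ae_of_all _ fun s => ?_)
    simp only
    ring

/-- Backward Grönwall inequality on `[a, ∞)`. -/
lemma gronwall_tail {p φ : ℝ → ℝ} (hp : ContinuousOn p (Ici 0)) (hi : IntegrableOn p (Ioi 0))
    (h0 : ∀ t, 0 ≤ t → 0 ≤ p t) {a H C : ℝ} (ha : 0 ≤ a)
    (hφ0 : ∀ t, a ≤ t → 0 ≤ φ t)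
    (hC : ∀ t, a ≤ t → φ t ≤ C) (h : ∀ t, a ≤ t → φ t ≤ H + ∫ s in Ioi t, p s * φ s) (hH : 0 ≤ H) :
    φ a ≤ 2 * H * Real.exp (2 * ∫ s in Ioi 0, p s) := by
  set E : ℝ → ℝ := fun t => Real.exp (2 * ∫ s in Ioi t, p s) with hE
  have hmono : ∀ t, 0 ≤ t → E t ≤ E 0 := fun t ht => by
    simp only [hE]
    refine Real.exp_le_exp.2 (mul_le_mul_of_nonneg_left ?_ zero_le_two)
    refine setIntegral_mono_set hi ?_ (Ioi_subset_Ioi ht).eventuallyLE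
    exact (ae_restrict_iff' measurableSet_Ioi).2 (ae_of_all _ fun r hr => h0 r (le_of_lt hr))
  have hE1 : ∀ t, 0 ≤ t → 1 ≤ E t := fun t ht => by
    refine Real.one_le_exp (mul_nonneg zero_le_two ?_)
    exact setIntegral_nonneg measurableSet_Ioi fun r hr => h0 r (ht.trans (le_of_lt hr))
  -- In the norm weighted by `E` the tail operator has norm at most `1/2`, so the best constant
  -- satisfies `N ≤ H + N / 2`. The bound `C` only makes the supremum finite and does not enter the
  -- result.
  set N : ℝ := ⨆ t : Ici a, φ t / E t with hN
  have hbdd : BddAbove (range fun t : Ici a => φ t / E t) := by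
    refine ⟨C, ?_⟩
    rintro _ ⟨t, rfl⟩
    have ht : a ≤ (t : ℝ) := t.2
    exact (div_le_self (hφ0 t ht) (hE1 t (ha.trans ht))).trans (hC t ht)
  have hNle : ∀ t, a ≤ t → φ t ≤ N * E t := fun t ht => by
    rw [← div_le_iff₀ (Real.exp_pos _)]
    exact le_ciSup hbdd (⟨t, ht⟩ : Ici a)
  have hN0 : 0 ≤ N := by
    have := hNle a le_rfl
    have h1 := hφ0 a le_rfl
    have h2 := Real.exp_pos (2 * ∫ s in Ioi a, p s)
    by_contra hneg
    push Not at hneg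
    have : N * E a < 0 := mul_neg_of_neg_of_pos hneg h2
    linarith
  have key : ∀ t, a ≤ t → φ t ≤ H + N / 2 * E t := fun t ht => by
    have ht0 := ha.trans ht
    obtain ⟨hint, hle⟩ := integral_mul_exp_tail hp hi h0 (zero_lt_two) ht0
    refine (h t ht).trans ?_
    have : ∫ s in Ioi t, p s * φ s ≤ ∫ s in Ioi t, N * (p s * E s) := by
      refine integral_mono_of_nonneg ?_ (hint.const_mul N) ?_
      · refine (ae_restrict_iff' measurableSet_Ioi).2 (ae_of_all _ fun s hs => ?_)
        have hs' : t < s := hs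
        exact mul_nonneg (h0 s (by linarith)) (hφ0 s (by linarith))
      · refine (ae_restrict_iff' measurableSet_Ioi).2 (ae_of_all _ fun s hs => ?_)
        have hs' : t < s := hs
        have h1 := hNle s (by linarith)
        have h2 := h0 s (by linarith)
        calc p s * φ s ≤ p s * (N * E s) := by gcongr
          _ = _ := by ring
    rw [integral_const_mul] at this
    have h3 : N * ∫ s in Ioi t, p s * E s ≤ N * (E t / 2) := by gcongr
    linarith
  have hN2 : N ≤ H + N / 2 := by
    have : Nonempty (Ici a) := ⟨⟨a, mem_Ici.2 le_rfl⟩⟩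
    refine ciSup_le fun t => ?_
    have ht : a ≤ (t : ℝ) := t.2
    rw [div_le_iff₀ (Real.exp_pos _)]
    have h1 := key t ht
    have h2 := hE1 t (ha.trans ht)
    calc φ t ≤ H + N / 2 * E t := h1
      _ ≤ H * E t + N / 2 * E t := by nlinarith
      _ = _ := by ring
  have hNH : N ≤ 2 * H := by linarith
  calc φ a ≤ N * E a := hNle a le_rfl
    _ ≤ 2 * H * E 0 := by
      have := hmono a ha
      have := hE1 a ha
      gcongr

/-! ### Volterra operators with a convolution kernel -/

lemma IsKernel.sub {n : ℕ} {κ κ' : ℝ → ℂ} (h : IsKernel n κ) (h' : IsKernel n κ') :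
    IsKernel n (fun τ => κ τ - κ' τ) := by
  obtain ⟨hc, C, hC⟩ := h
  obtain ⟨hc', C', hC'⟩ := h'
  refine ⟨hc.sub hc', C + C', fun τ hτ => (norm_sub_le _ _).trans ?_⟩
  have := hC τ hτ
  have := hC' τ hτ
  linarith

lemma IsKernel.const_mul {n : ℕ} {κ : ℝ → ℂ} (h : IsKernel n κ) (c : ℂ) :
    IsKernel n (fun τ => c * κ τ) := by
  obtain ⟨hc, C, hC⟩ := h
  refine ⟨continuous_const.mul hc, ‖c‖ * C, fun τ hτ => ?_⟩
  rw [norm_mul, mul_assoc]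
  exact mul_le_mul_of_nonneg_left (hC τ hτ) (norm_nonneg _)

lemma continuousOn_volterra_integrand {κ q : ℝ → ℂ} (hκ : Continuous κ)
    (hq : ContinuousOn q (Ici 0)) (w : ℝ≥0 →ᵇ ℂ) (t : ℝ) :
    ContinuousOn (fun s : ℝ => κ (s - t) * (q s * w s.toNNReal)) (Ici 0) := by
  have h1 : Continuous fun s : ℝ => κ (s - t) := by fun_prop
  have h2 : Continuous fun s : ℝ => w s.toNNReal := w.continuous.comp continuous_real_toNNReal
  exact h1.continuousOn.mul (hq.mul h2.continuousOn)

lemma norm_volterra_integrand_le {n : ℕ} {κ q : ℝ → ℂ} {C : ℝ}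
    (hC : ∀ τ : ℝ, 0 ≤ τ → ‖κ τ‖ ≤ C * (1 + τ) ^ n) (w : ℝ≥0 →ᵇ ℂ) {s t : ℝ} (ht : 0 ≤ t)
    (hs : t ≤ s) : ‖κ (s - t) * (q s * w s.toNNReal)‖ ≤ C * ‖w‖ * ((1 + s) ^ n * ‖q s‖) := by
  have h1 := hC (s - t) (by linarith)
  have hC0 : 0 ≤ C := by
    have := (norm_nonneg _).trans (hC 0 le_rfl)
    simpa using this
  have h2 : (1 + (s - t)) ^ n ≤ (1 + s) ^ n := by
    gcongr
    linarith
  have h3 := w.norm_coe_le_norm s.toNNReal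
  rw [norm_mul, norm_mul]
  calc ‖κ (s - t)‖ * (‖q s‖ * ‖w s.toNNReal‖) ≤ (C * (1 + s) ^ n) * (‖q s‖ * ‖w‖) := by
        have h4 : C * (1 + (s - t)) ^ n ≤ C * (1 + s) ^ n := by gcongr
        have := h1.trans h4
        have : 0 ≤ C * (1 + s) ^ n := (norm_nonneg _).trans this
        gcongr
    _ = _ := by ring

lemma integrableOn_volterra_integrand {n : ℕ} {κ q : ℝ → ℂ} (hκ : IsKernel n κ)
    (hq : WeightedL1 n q) (w : ℝ≥0 →ᵇ ℂ) {t : ℝ} (ht : 0 ≤ t) :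
    IntegrableOn (fun s : ℝ => κ (s - t) * (q s * w s.toNNReal)) (Ioi t) := by
  obtain ⟨hc, C, hC⟩ := hκ
  refine Integrable.mono' ((IntegrableOn.tail hq.2 ht).const_mul (C * ‖w‖)) ?_ ?_
  · exact ((continuousOn_volterra_integrand hc hq.1 w t).mono
      ((Ioi_subset_Ioi ht).trans Ioi_subset_Ici_self)).aestronglyMeasurable measurableSet_Ioi
  · exact (ae_restrict_iff' measurableSet_Ioi).2 (ae_of_all _ fun s hs =>
      norm_volterra_integrand_le hC w ht (le_of_lt hs))

/-- Dominated convergence, with the lower limit moved into the integrand as an indicator; the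
integrand is continuous in `t` at `t₀` except for `s = t₀`, a null set. -/
lemma continuous_volterra {n : ℕ} {κ q : ℝ → ℂ} (hκ : IsKernel n κ)
    (hq : WeightedL1 n q) (w : ℝ≥0 →ᵇ ℂ) :
    Continuous (fun t : ℝ≥0 => ∫ s in Ioi (t : ℝ), κ (s - t) * (q s * w s.toNNReal)) := by
  have hrw : ∀ t : ℝ≥0, ∫ s in Ioi (t : ℝ), κ (s - t) * (q s * w s.toNNReal) =
      ∫ s in Ioi (0 : ℝ), (Ioi (t : ℝ)).indicator
        (fun s => κ (s - t) * (q s * w s.toNNReal)) s := fun t => by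
    rw [setIntegral_indicator measurableSet_Ioi, Ioi_inter_Ioi, max_eq_right t.coe_nonneg]
  simp_rw [hrw]
  obtain ⟨C, hC⟩ := hκ.2
  refine continuous_iff_continuousAt.2 fun t₀ => continuousAt_of_dominated
    (bound := fun s => C * ‖w‖ * ((1 + s) ^ n * ‖q s‖)) ?_ ?_ (hq.2.const_mul _) ?_
  · refine Eventually.of_forall fun t => AEStronglyMeasurable.indicator ?_ measurableSet_Ioi
    exact ((continuousOn_volterra_integrand hκ.1 hq.1 w t).mono
      Ioi_subset_Ici_self).aestronglyMeasurable measurableSet_Ioi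
  · refine Eventually.of_forall fun t => (ae_restrict_iff' measurableSet_Ioi).2
      (ae_of_all _ fun s hs => ?_)
    have hs' : 0 < s := hs
    by_cases h : (t : ℝ) < s
    · rw [indicator_of_mem (mem_Ioi.2 h)]
      exact norm_volterra_integrand_le hC w t.coe_nonneg h.le
    · rw [indicator_of_notMem (by simpa using h), norm_zero]
      have hC0 : 0 ≤ C := by
        have := (norm_nonneg _).trans (hC 0 le_rfl)
        simpa using this
      positivity
  · have hne : ∀ᵐ s : ℝ ∂(volume.restrict (Ioi 0)), s ≠ t₀ :=
      ae_restrict_of_ae (Measure.ae_ne volume _)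
    filter_upwards [hne] with s hs
    have hcoe : ContinuousAt (fun t : ℝ≥0 => (t : ℝ)) t₀ := NNReal.continuous_coe.continuousAt
    rcases lt_or_gt_of_ne hs with h | h
    · have : (fun t : ℝ≥0 => (Ioi (t : ℝ)).indicator
          (fun s => κ (s - t) * (q s * w s.toNNReal)) s) =ᶠ[𝓝 t₀] fun _ => 0 := by
        filter_upwards [hcoe.eventually_mem (Ioi_mem_nhds h)] with t ht
        exact indicator_of_notMem (by simpa using le_of_lt ht) _
      exact continuousAt_const.congr this.symm
    · have : (fun t : ℝ≥0 => (Ioi (t : ℝ)).indicator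
          (fun s => κ (s - t) * (q s * w s.toNNReal)) s) =ᶠ[𝓝 t₀]
          fun t => κ (s - t) * (q s * w s.toNNReal) := by
        filter_upwards [hcoe.eventually_mem (Iio_mem_nhds h)] with t ht
        exact indicator_of_mem (mem_Ioi.2 ht) _
      refine ContinuousAt.congr ?_ this.symm
      have := hκ.1
      exact Continuous.continuousAt (by fun_prop)

/-- Bound of a Volterra integral by a nondecreasing majorant of the kernel. -/
lemma norm_volterra_integral_le {κ q : ℝ → ℂ} {b : ℝ → ℝ} (hb : MonotoneOn b (Ici 0))
    (hκ : ∀ τ, 0 ≤ τ → ‖κ τ‖ ≤ b τ) (hi : IntegrableOn (fun s => b s * ‖q s‖) (Ioi 0))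
    (w : ℝ≥0 →ᵇ ℂ) {t : ℝ} (ht : 0 ≤ t) :
    ‖∫ s in Ioi t, κ (s - t) * (q s * w s.toNNReal)‖ ≤
      (∫ s in Ioi 0, b s * ‖q s‖) * ‖w‖ := by
  have hb0 : ∀ s, 0 ≤ s → 0 ≤ b s := fun s hs => (norm_nonneg _).trans (hκ s hs)
  calc ‖∫ s in Ioi t, κ (s - t) * (q s * w s.toNNReal)‖
      ≤ ∫ s in Ioi t, b s * ‖q s‖ * ‖w‖ := by
        refine norm_integral_le_of_norm_le ((IntegrableOn.tail hi ht).mul_const _) ?_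
        refine (ae_restrict_iff' measurableSet_Ioi).2 (ae_of_all _ fun s hs => ?_)
        have hs' : t < s := hs
        have h1 := hκ (s - t) (by linarith)
        have h2 : b (s - t) ≤ b s := hb (mem_Ici.2 (by linarith)) (mem_Ici.2 (by linarith))
          (by linarith)
        have h3 := w.norm_coe_le_norm s.toNNReal
        have h4 := h1.trans h2
        have : 0 ≤ b s := (norm_nonneg _).trans h4
        rw [norm_mul, norm_mul, mul_assoc]
        gcongr
    _ = (∫ s in Ioi t, b s * ‖q s‖) * ‖w‖ := integral_mul_const _ _
    _ ≤ _ := by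
        refine mul_le_mul_of_nonneg_right ?_ (norm_nonneg _)
        refine setIntegral_mono_set hi ?_ (Ioi_subset_Ioi ht).eventuallyLE
        refine (ae_restrict_iff' measurableSet_Ioi).2 (ae_of_all _ fun s hs => ?_)
        exact mul_nonneg (hb0 s (le_of_lt hs)) (norm_nonneg _)

lemma exists_volterra_bound {n : ℕ} {κ q : ℝ → ℂ} (hκ : IsKernel n κ) (hq : WeightedL1 n q) :
    ∃ C, ∀ (w : ℝ≥0 →ᵇ ℂ) (t : ℝ≥0),
      ‖∫ s in Ioi (t : ℝ), κ (s - t) * (q s * w s.toNNReal)‖ ≤ C * ‖w‖ := by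
  obtain ⟨C, hC⟩ := hκ.2
  have hC0 : 0 ≤ C := by
    have := (norm_nonneg _).trans (hC 0 le_rfl)
    simpa using this
  refine ⟨_, fun w t => norm_volterra_integral_le (b := fun s => C * (1 + s) ^ n) ?_ hC ?_ w
    t.coe_nonneg⟩
  · intro x hx y hy hxy
    have hx : 0 ≤ x := hx
    simp only
    gcongr
  · simp_rw [mul_assoc]
    exact hq.2.const_mul C

open Classical in
/-- The Volterra operator `(𝒱 w)(t) = ∫_t^∞ κ(s - t) q(s) w(s) ds`. -/
def volterra (n : ℕ) (κ q : ℝ → ℂ) : (ℝ≥0 →ᵇ ℂ) →L[ℂ] (ℝ≥0 →ᵇ ℂ) :=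
  if h : IsKernel n κ ∧ WeightedL1 n q then
    LinearMap.mkContinuousOfExistsBound
      { toFun := fun w => BoundedContinuousFunction.ofNormedAddCommGroup
          (fun t : ℝ≥0 => ∫ s in Ioi (t : ℝ), κ (s - t) * (q s * w s.toNNReal))
          (continuous_volterra h.1 h.2 w) ((exists_volterra_bound h.1 h.2).choose * ‖w‖)
          ((exists_volterra_bound h.1 h.2).choose_spec w)
        map_add' := fun w w' => by
          ext t
          simp only [BoundedContinuousFunction.coe_ofNormedAddCommGroup,
            BoundedContinuousFunction.coe_add, Pi.add_apply]
          rw [← integral_add (integrableOn_volterra_integrand h.1 h.2 w t.coe_nonneg)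
            (integrableOn_volterra_integrand h.1 h.2 w' t.coe_nonneg)]
          congr 1 with s
          ring
        map_smul' := fun c w => by
          ext t
          simp only [BoundedContinuousFunction.coe_ofNormedAddCommGroup,
            BoundedContinuousFunction.coe_smul, smul_eq_mul, RingHom.id_apply]
          rw [← integral_const_mul]
          congr 1 with s
          ring }
      ⟨max (exists_volterra_bound h.1 h.2).choose 0, fun w =>
        BoundedContinuousFunction.norm_ofNormedAddCommGroup_le _ (by positivity) fun t =>
          ((exists_volterra_bound h.1 h.2).choose_spec w t).trans
            (by gcongr; exact le_max_left _ _)⟩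
  else 0

lemma volterra_apply {n : ℕ} {κ q : ℝ → ℂ} (hκ : IsKernel n κ) (hq : WeightedL1 n q)
    (w : ℝ≥0 →ᵇ ℂ) (t : ℝ≥0) :
    volterra n κ q w t = ∫ s in Ioi (t : ℝ), κ (s - t) * (q s * w s.toNNReal) := by
  rw [volterra, dif_pos ⟨hκ, hq⟩]
  rfl

/-- The majorant `b` is free apart from monotonicity, so a difference of two kernels can be measured
by a majorant that tends to zero. -/
lemma norm_volterra_le {n : ℕ} {κ q : ℝ → ℂ} (hκ : IsKernel n κ) (hq : WeightedL1 n q)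
    {b : ℝ → ℝ} (hb : MonotoneOn b (Ici 0)) (hκb : ∀ τ, 0 ≤ τ → ‖κ τ‖ ≤ b τ)
    (hi : IntegrableOn (fun s => b s * ‖q s‖) (Ioi 0)) :
    ‖volterra n κ q‖ ≤ ∫ s in Ioi 0, b s * ‖q s‖ := by
  have h0 : 0 ≤ ∫ s in Ioi 0, b s * ‖q s‖ :=
    setIntegral_nonneg measurableSet_Ioi fun s hs =>
      mul_nonneg ((norm_nonneg _).trans (hκb s (le_of_lt hs))) (norm_nonneg _)
  refine ContinuousLinearMap.opNorm_le_bound _ h0 fun w => ?_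
  refine (BoundedContinuousFunction.norm_le (by positivity)).2 fun t => ?_
  rw [volterra_apply hκ hq]
  exact norm_volterra_integral_le hb hκb hi w t.coe_nonneg

lemma volterra_kernel_sub {n : ℕ} {κ κ' q : ℝ → ℂ} (hκ : IsKernel n κ) (hκ' : IsKernel n κ')
    (hq : WeightedL1 n q) :
    volterra n κ q - volterra n κ' q = volterra n (fun τ => κ τ - κ' τ) q := by
  ext w t
  simp only [sub_apply, BoundedContinuousFunction.coe_sub, Pi.sub_apply]
  rw [volterra_apply hκ hq, volterra_apply hκ' hq, volterra_apply (hκ.sub hκ') hq,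
    ← integral_sub (integrableOn_volterra_integrand hκ hq w t.coe_nonneg)
      (integrableOn_volterra_integrand hκ' hq w t.coe_nonneg)]
  congr 1 with s
  ring

lemma volterra_kernel_smul {n : ℕ} {κ q : ℝ → ℂ} (hκ : IsKernel n κ)
    (hq : WeightedL1 n q) (c : ℂ) :
    c • volterra n κ q = volterra n (fun τ => c * κ τ) q := by
  ext w t
  simp only [smul_apply, BoundedContinuousFunction.coe_smul, smul_eq_mul]
  rw [volterra_apply hκ hq, volterra_apply (hκ.const_mul c) hq, ← integral_const_mul]
  congr 1 with s
  ring

/-! ### Oscillatory kernels -/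

/-- The closed upper half-plane. -/
def upperHalf : Set ℂ := {z | 0 ≤ z.im}

/-- The `j`-th derivative in `z` of the kernel `e^{izτ}`. -/
def oscKernel (j : ℕ) (z : ℂ) (τ : ℝ) : ℂ :=
  (Complex.I * τ) ^ j * Complex.exp (Complex.I * z * τ)

lemma norm_exp_le_one {z : ℂ} (hz : z ∈ upperHalf) {τ : ℝ} (hτ : 0 ≤ τ) :
    ‖Complex.exp (Complex.I * z * τ)‖ ≤ 1 := by
  have hz : 0 ≤ z.im := hz
  rw [Complex.norm_exp, Real.exp_le_one_iff]
  simp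
  positivity

lemma norm_oscKernel_le {z : ℂ} (hz : z ∈ upperHalf) (j : ℕ) {τ : ℝ} (hτ : 0 ≤ τ) :
    ‖oscKernel j z τ‖ ≤ (1 + τ) ^ j := by
  rw [oscKernel, norm_mul, norm_pow, norm_mul, Complex.norm_I, one_mul, Complex.norm_real,
    Real.norm_of_nonneg hτ]
  calc τ ^ j * ‖Complex.exp (Complex.I * z * τ)‖ ≤ (1 + τ) ^ j * 1 := by
        gcongr
        · linarith
        · exact norm_exp_le_one hz hτ
    _ = _ := mul_one _

lemma isKernel_oscKernel {n j : ℕ} (hj : j ≤ n) {z : ℂ} (hz : z ∈ upperHalf) :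
    IsKernel n (oscKernel j z) := by
  refine ⟨by unfold oscKernel; fun_prop, 1, fun τ hτ => (norm_oscKernel_le hz j hτ).trans ?_⟩
  rw [one_mul]
  exact pow_le_pow_right₀ (by linarith) hj

lemma convex_upperHalf : Convex ℝ upperHalf := convex_halfSpace_im_ge 0

/-- The linear bound alone would cost one more moment of the density. The minimum with 2 keeps the
weight at `(1 + s) ^ n` and leaves smallness to dominated convergence. -/
lemma norm_exp_sub_exp_le {z z' : ℂ} (hz : z ∈ upperHalf) (hz' : z' ∈ upperHalf) {τ : ℝ}
    (hτ : 0 ≤ τ) :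
    ‖Complex.exp (Complex.I * z' * τ) - Complex.exp (Complex.I * z * τ)‖ ≤
      min 2 (τ * ‖z' - z‖) := by
  refine le_min ?_ ?_
  · refine (norm_sub_le _ _).trans ?_
    have := norm_exp_le_one hz hτ
    have := norm_exp_le_one hz' hτ
    linarith
  · refine convex_upperHalf.norm_image_sub_le_of_norm_hasDerivWithin_le
      (f := fun z => Complex.exp (Complex.I * z * τ))
      (f' := fun z => Complex.exp (Complex.I * z * τ) * (Complex.I * τ)) (fun w _ => ?_)
      (fun w hw => ?_) hz hz'
    · have h : HasDerivAt (fun z : ℂ => Complex.I * z * τ) (Complex.I * 1 * τ) w :=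
        ((hasDerivAt_id w).const_mul Complex.I).mul_const (τ : ℂ)
      rw [mul_one] at h
      exact h.cexp.hasDerivWithinAt
    · rw [norm_mul, norm_mul, Complex.norm_I, one_mul, Complex.norm_real, Real.norm_of_nonneg hτ]
      have := norm_exp_le_one hw hτ
      nlinarith

/-- Mean value inequality along the segment for the exponential minus its tangent: the derivative is
`iτ` times a difference of exponentials, so only one power of `τ` is spent and the factor `min`
still tends to zero. -/
lemma norm_exp_taylor_le {z z' : ℂ} (hz : z ∈ upperHalf) (hz' : z' ∈ upperHalf) {τ : ℝ}
    (hτ : 0 ≤ τ) :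
    ‖Complex.exp (Complex.I * z' * τ) - Complex.exp (Complex.I * z * τ) -
      (z' - z) * (Complex.I * τ * Complex.exp (Complex.I * z * τ))‖ ≤
      τ * min 2 (τ * ‖z' - z‖) * ‖z' - z‖ := by
  have hconv : Convex ℝ (segment ℝ z z') := convex_segment z z'
  have key := hconv.norm_image_sub_le_of_norm_hasDerivWithin_le
      (f := fun w => Complex.exp (Complex.I * w * τ) -
        (w - z) * (Complex.I * τ * Complex.exp (Complex.I * z * τ)))
      (f' := fun w => Complex.exp (Complex.I * w * τ) * (Complex.I * τ) -
        1 * (Complex.I * τ * Complex.exp (Complex.I * z * τ)))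
      (C := τ * min 2 (τ * ‖z' - z‖)) (fun w _ => ?_)
      (fun w hw => ?_) (left_mem_segment ℝ z z') (right_mem_segment ℝ z z')
  · refine le_trans (le_of_eq ?_) key
    congr 1
    ring
  · have h : HasDerivAt (fun z : ℂ => Complex.I * z * τ) (Complex.I * 1 * τ) w :=
      ((hasDerivAt_id w).const_mul Complex.I).mul_const (τ : ℂ)
    rw [mul_one] at h
    exact (h.cexp.sub (((hasDerivAt_id w).sub_const z).mul_const _)).hasDerivWithinAt
  · have hw' : w ∈ upperHalf := convex_upperHalf.segment_subset hz hz' hw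
    have h1 : Complex.exp (Complex.I * w * τ) * (Complex.I * τ) -
        1 * (Complex.I * τ * Complex.exp (Complex.I * z * τ)) = (Complex.I * τ) *
        (Complex.exp (Complex.I * w * τ) - Complex.exp (Complex.I * z * τ)) := by ring
    rw [h1, norm_mul, norm_mul, Complex.norm_I, one_mul, Complex.norm_real, Real.norm_of_nonneg hτ]
    refine mul_le_mul_of_nonneg_left ((norm_exp_sub_exp_le hz hw' hτ).trans ?_) hτ
    have : ‖w - z‖ ≤ ‖z' - z‖ := norm_sub_le_of_mem_segment hw
    gcongr

/-- The operator with kernel `oscKernel j z`. -/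
def oscOp (n j : ℕ) (q : ℝ → ℂ) (z : ℂ) : (ℝ≥0 →ᵇ ℂ) →L[ℂ] (ℝ≥0 →ᵇ ℂ) :=
  volterra n (oscKernel j z) q

lemma monotoneOn_min_mul_pow (n : ℕ) {h : ℝ} (hh : 0 ≤ h) :
    MonotoneOn (fun s : ℝ => min 2 (s * h) * (1 + s) ^ n) (Ici 0) := by
  intro x hx y hy hxy
  have hx : 0 ≤ x := hx
  have : 0 ≤ min 2 (y * h) := le_min zero_le_two (mul_nonneg (hx.trans hxy) hh)
  have h1 : min 2 (x * h) ≤ min 2 (y * h) := by gcongr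
  have h2 : (1 + x) ^ n ≤ (1 + y) ^ n := by gcongr
  exact mul_le_mul h1 h2 (by positivity) this

/-- Modulus of continuity of the oscillatory operators. -/
def oscModulus (n : ℕ) (q : ℝ → ℂ) (h : ℝ) : ℝ :=
  ∫ s in Ioi (0:ℝ), min 2 (s * h) * (1 + s) ^ n * ‖q s‖

lemma integrableOn_oscModulus {n : ℕ} {q : ℝ → ℂ} (hq : WeightedL1 n q) {h : ℝ} (hh : 0 ≤ h) :
    IntegrableOn (fun s => min 2 (s * h) * (1 + s) ^ n * ‖q s‖) (Ioi 0) := by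
  refine Integrable.mono' (hq.2.const_mul 2) ?_ ?_
  · refine ContinuousOn.aestronglyMeasurable ?_ measurableSet_Ioi
    have := hq.1.mono Ioi_subset_Ici_self
    fun_prop
  · refine (ae_restrict_iff' measurableSet_Ioi).2 (ae_of_all _ fun s hs => ?_)
    have hs' : 0 < s := hs
    have : 0 ≤ min 2 (s * h) := le_min zero_le_two (by positivity)
    rw [Real.norm_of_nonneg (by positivity), mul_assoc]
    gcongr
    exact min_le_left _ _

lemma tendsto_oscModulus {n : ℕ} {q : ℝ → ℂ} (hq : WeightedL1 n q) :
    Tendsto (oscModulus n q) (𝓝[≥] 0) (𝓝 0) := by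
  have h0 : oscModulus n q 0 = 0 := by simp [oscModulus]
  have : ContinuousWithinAt (oscModulus n q) (Ici 0) 0 := by
    refine continuousWithinAt_of_dominated (bound := fun s => 2 * ((1 + s) ^ n * ‖q s‖)) ?_ ?_
      (hq.2.const_mul 2) ?_
    · filter_upwards [self_mem_nhdsWithin] with h hh
      exact (integrableOn_oscModulus hq hh).aestronglyMeasurable
    · filter_upwards [self_mem_nhdsWithin] with h hh
      refine (ae_restrict_iff' measurableSet_Ioi).2 (ae_of_all _ fun s hs => ?_)
      have hs' : 0 < s := hs
      have hh' : 0 ≤ h := hh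
      have : 0 ≤ min 2 (s * h) := le_min zero_le_two (mul_nonneg hs'.le hh')
      rw [Real.norm_of_nonneg (by positivity), mul_assoc]
      gcongr
      exact min_le_left _ _
    · exact ae_of_all _ fun s => Continuous.continuousWithinAt (by fun_prop)
  have h1 := this.tendsto
  rwa [h0] at h1

lemma norm_oscOp_sub_le {n j : ℕ} (hj : j ≤ n) {q : ℝ → ℂ} (hq : WeightedL1 n q) {z z' : ℂ}
    (hz : z ∈ upperHalf) (hz' : z' ∈ upperHalf) :
    ‖oscOp n j q z' - oscOp n j q z‖ ≤ oscModulus n q ‖z' - z‖ := by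
  rw [oscOp, oscOp, volterra_kernel_sub (isKernel_oscKernel hj hz') (isKernel_oscKernel hj hz) hq]
  refine norm_volterra_le ((isKernel_oscKernel hj hz').sub (isKernel_oscKernel hj hz)) hq
    (monotoneOn_min_mul_pow n (norm_nonneg _)) (fun τ hτ => ?_)
    (integrableOn_oscModulus hq (norm_nonneg _))
  rw [oscKernel, oscKernel, ← mul_sub, norm_mul, norm_pow, norm_mul, Complex.norm_I, one_mul,
    Complex.norm_real, Real.norm_of_nonneg hτ, mul_comm]
  have h1 := norm_exp_sub_exp_le hz hz' hτ
  have h2 : τ ^ j ≤ (1 + τ) ^ n :=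
    (pow_le_pow_left₀ hτ (by linarith) j).trans (pow_le_pow_right₀ (by linarith) hj)
  have : 0 ≤ min 2 (τ * ‖z' - z‖) := le_min zero_le_two (by positivity)
  gcongr

/-- The tangent estimate costs one factor `τ` beyond `τ ^ j`, and `j + 1 ≤ n` lets the weight pay
for it. -/
lemma norm_oscOp_taylor_le {n j : ℕ} (hj : j < n) {q : ℝ → ℂ} (hq : WeightedL1 n q) {z z' : ℂ}
    (hz : z ∈ upperHalf) (hz' : z' ∈ upperHalf) :
    ‖oscOp n j q z' - oscOp n j q z - (z' - z) • oscOp n (j + 1) q z‖ ≤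
      oscModulus n q ‖z' - z‖ * ‖z' - z‖ := by
  have k1 := isKernel_oscKernel hj.le hz'
  have k2 := isKernel_oscKernel hj.le hz
  have k3 := isKernel_oscKernel (Nat.succ_le_of_lt hj) hz
  rw [oscOp, oscOp, oscOp, volterra_kernel_sub k1 k2 hq, volterra_kernel_smul k3 hq,
    volterra_kernel_sub (k1.sub k2) (k3.const_mul _) hq]
  have hrw : (fun s => min 2 (s * ‖z' - z‖) * (1 + s) ^ n * ‖z' - z‖ * ‖q s‖) =
      fun s => min 2 (s * ‖z' - z‖) * (1 + s) ^ n * ‖q s‖ * ‖z' - z‖ := by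
    ext s
    ring
  have key := norm_volterra_le ((k1.sub k2).sub (k3.const_mul (z' - z))) hq
    (b := fun s => min 2 (s * ‖z' - z‖) * (1 + s) ^ n * ‖z' - z‖) ?_ (fun τ hτ => ?_) ?_
  · rw [hrw, integral_mul_const] at key
    exact key
  · exact fun x hx y hy hxy => mul_le_mul_of_nonneg_right
      (monotoneOn_min_mul_pow n (norm_nonneg _) hx hy hxy) (norm_nonneg _)
  · have h1 := norm_exp_taylor_le hz hz' hτ
    have h2 : τ ^ (j + 1) ≤ (1 + τ) ^ n :=
      (pow_le_pow_left₀ hτ (by linarith) _).trans (pow_le_pow_right₀ (by linarith) hj)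
    have h3 : 0 ≤ min 2 (τ * ‖z' - z‖) := le_min zero_le_two (by positivity)
    have h4 : oscKernel j z' τ - oscKernel j z τ - (z' - z) * oscKernel (j + 1) z τ =
        (Complex.I * τ) ^ j * (Complex.exp (Complex.I * z' * τ) - Complex.exp (Complex.I * z * τ) -
      (z' - z) * (Complex.I * τ * Complex.exp (Complex.I * z * τ))) := by
      simp only [oscKernel]
      ring
    rw [h4, norm_mul, norm_pow, norm_mul, Complex.norm_I, one_mul,
      Complex.norm_real, Real.norm_of_nonneg hτ]
    calc _ ≤ τ ^ j * (τ * min 2 (τ * ‖z' - z‖) * ‖z' - z‖) := by gcongr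
      _ = min 2 (τ * ‖z' - z‖) * τ ^ (j + 1) * ‖z' - z‖ := by ring
      _ ≤ _ := by gcongr
  · simp only [hrw]
    exact (integrableOn_oscModulus hq (norm_nonneg _)).mul_const _

lemma tendsto_norm_sub_nhdsWithin (z : ℂ) (s : Set ℂ) :
    Tendsto (fun z' => ‖z' - z‖) (𝓝[s] z) (𝓝[≥] 0) := by
  refine tendsto_nhdsWithin_iff.2 ⟨?_, Eventually.of_forall fun _ => norm_nonneg _⟩
  have : Continuous fun z' => ‖z' - z‖ := by fun_prop
  have h := this.tendsto z
  simp only [sub_self, norm_zero] at h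
  exact h.mono_left nhdsWithin_le_nhds

lemma continuousOn_oscOp {n j : ℕ} (hj : j ≤ n) {q : ℝ → ℂ} (hq : WeightedL1 n q) :
    ContinuousOn (oscOp n j q) upperHalf := by
  intro z hz
  refine tendsto_iff_norm_sub_tendsto_zero.2 (squeeze_zero' (Eventually.of_forall fun _ =>
    norm_nonneg _) ?_ ((tendsto_oscModulus hq).comp (tendsto_norm_sub_nhdsWithin z upperHalf)))
  filter_upwards [self_mem_nhdsWithin] with z' hz'
  exact norm_oscOp_sub_le hj hq hz hz'

lemma hasDerivWithinAt_oscOp {n j : ℕ} (hj : j < n) {q : ℝ → ℂ} (hq : WeightedL1 n q) {z : ℂ}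
    (hz : z ∈ upperHalf) :
    HasDerivWithinAt (oscOp n j q) (oscOp n (j + 1) q z) upperHalf z := by
  refine HasDerivWithinAt.of_isLittleO (𝕜 := ℂ)
    (F := (ℝ≥0 →ᵇ ℂ) →L[ℂ] (ℝ≥0 →ᵇ ℂ)) ?_
  refine isLittleO_iff.2 fun c hc => ?_
  have h := ((tendsto_oscModulus hq).comp (tendsto_norm_sub_nhdsWithin z upperHalf)).eventually
    (eventually_lt_nhds hc)
  filter_upwards [h, self_mem_nhdsWithin] with z' h1 hz'
  refine (norm_oscOp_taylor_le hj hq hz hz').trans ?_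
  gcongr
  exact le_of_lt h1

/-- In one complex dimension unique differentiability at a point only requires that it be an
accumulation point. This covers the origin, where the sectors of `D̄₊` meet and no convexity is
available. -/
lemma uniqueDiffOn_of_subset_closure_interior {s : Set ℂ} (h : s ⊆ closure (interior s)) :
    UniqueDiffOn ℂ s := by
  intro x hx
  rw [uniqueDiffWithinAt_iff_accPt]
  have h1 : AccPt x (𝓟 (interior s)) := by
    by_cases hxi : x ∈ interior s
    · rw [accPt_principal_iff_nhdsWithin, sdiff_eq, inter_comm,
        nhdsWithin_inter_of_mem' (mem_nhdsWithin_of_mem_nhds (isOpen_interior.mem_nhds hxi))]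
      infer_instance
    · rw [accPt_principal_iff_nhdsWithin, sdiff_singleton_eq_self hxi]
      exact mem_closure_iff_nhdsWithin_neBot.1 (h hx)
  exact h1.mono (principal_mono.2 interior_subset)

lemma uniqueDiffOn_upperHalf : UniqueDiffOn ℂ upperHalf := by
  refine uniqueDiffOn_of_subset_closure_interior ?_
  have h1 : upperHalf = {z | (0:ℝ) ≤ z.im} := rfl
  have h2 : {z : ℂ | 0 < z.im} ⊆ interior upperHalf :=
    interior_maximal (fun z (hz : 0 < z.im) => (le_of_lt hz : 0 ≤ z.im))
      (isOpen_lt continuous_const Complex.continuous_im)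
  refine Subset.trans ?_ (closure_mono h2)
  rw [Complex.closure_setOfPred_lt_im]
  exact h1.le

lemma iteratedDerivWithin_oscOp {n j : ℕ} (hj : j ≤ n) {q : ℝ → ℂ} (hq : WeightedL1 n q) :
    EqOn (iteratedDerivWithin j (oscOp n 0 q) upperHalf) (oscOp n j q) upperHalf := by
  induction j with
  | zero => intro z _; simp
  | succ j ih =>
    intro z hz
    rw [iteratedDerivWithin_succ, derivWithin_congr (ih (by omega)) (ih (by omega) hz)]
    exact (hasDerivWithinAt_oscOp hj hq hz).derivWithin (uniqueDiffOn_upperHalf z hz)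

lemma contDiffOn_oscOp {n : ℕ} {q : ℝ → ℂ} (hq : WeightedL1 n q) :
    ContDiffOn ℂ n (oscOp n 0 q) upperHalf := by
  refine contDiffOn_of_continuousOn_differentiableOn_deriv (n := (n : ℕ∞)) (fun j hj => ?_)
    fun j hj => ?_
  · have hj : j ≤ n := by exact_mod_cast hj
    exact (continuousOn_oscOp hj hq).congr (iteratedDerivWithin_oscOp hj hq)
  · have hj : j < n := by exact_mod_cast hj
    exact DifferentiableOn.congr
      (fun z hz => (hasDerivWithinAt_oscOp hj hq hz).differentiableWithinAt)
      (iteratedDerivWithin_oscOp hj.le hq)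

/-- The bound is the same for all `z` and all orders up to `n`; therefore, after composition with
`8k³`, all growth in `k` comes from the derivatives of the phase. -/
lemma norm_iteratedFDerivWithin_oscOp_le {n j : ℕ} (hj : j ≤ n) {q : ℝ → ℂ} (hq : WeightedL1 n q)
    {z : ℂ} (hz : z ∈ upperHalf) :
    ‖iteratedFDerivWithin ℂ j (oscOp n 0 q) upperHalf z‖ ≤ ∫ s in Ioi 0, (1 + s) ^ n * ‖q s‖ := by
  rw [norm_iteratedFDerivWithin_eq_norm_iteratedDerivWithin, iteratedDerivWithin_oscOp hj hq hz]
  refine norm_volterra_le (isKernel_oscKernel hj hz) hq (b := fun s => (1 + s) ^ n) ?_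
    (fun τ hτ => (norm_oscKernel_le hz j hτ).trans (pow_le_pow_right₀ (by linarith) hj)) hq.2
  intro x hx y hy hxy
  have hx : 0 ≤ x := hx
  simp only
  gcongr

/-! ### The closed domain `D̄₊` -/

/-- On the real axis `k³` is real, so `0 < Im k³` already excludes `Im k = 0`. -/
lemma Dplus_eq : Dplus = {k : ℂ | 0 < (k ^ 3).im} := by
  ext k
  simp only [Dplus, D₁, D₃, mem_union, mem_ofPred_eq]
  refine ⟨fun h => h.elim (·.2) (·.2), fun h => ?_⟩
  rcases lt_trichotomy k.im 0 with h0 | h0 | h0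
  · exact Or.inl ⟨h0, h⟩
  · have : (k ^ 3).im = 0 := by simp [pow_succ, h0]
    linarith
  · exact Or.inr ⟨h0, h⟩

lemma Dminus_eq : Dminus = {k : ℂ | (k ^ 3).im < 0} := by
  ext k
  simp only [Dminus, D₂, D₄, mem_union, mem_ofPred_eq]
  refine ⟨fun h => h.elim (·.2) (·.2), fun h => ?_⟩
  rcases lt_trichotomy k.im 0 with h0 | h0 | h0
  · exact Or.inl ⟨h0, h⟩
  · have : (k ^ 3).im = 0 := by simp [pow_succ, h0]
    linarith
  · exact Or.inr ⟨h0, h⟩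

lemma isOpen_Dplus : IsOpen Dplus := by
  rw [Dplus_eq]
  exact isOpen_lt continuous_const (by fun_prop)

/-- From the open mapping theorem. For an open continuous map closure commutes with preimage, which
identifies `D̄₊` and `D̄₋` by non-strict inequalities on `Im k³`. -/
lemma isOpenMap_cube : IsOpenMap (fun k : ℂ => k ^ 3) := by
  have h : AnalyticOnNhd ℂ (fun k : ℂ => k ^ 3) univ := fun k _ => by fun_prop
  rcases h.is_constant_or_isOpen isPreconnected_univ with ⟨w, hw⟩ | h
  · have h0 := hw 0 (mem_univ _)
    have h1 := hw 1 (mem_univ _)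
    norm_num [← h0] at h1
  · exact fun s hs => h s (subset_univ s) hs

lemma mem_closure_Dplus {k : ℂ} : k ∈ closure Dplus ↔ 0 ≤ (k ^ 3).im := by
  have h := isOpenMap_cube.preimage_closure_eq_closure_preimage (continuous_pow 3) {z | 0 < z.im}
  rw [Complex.closure_setOfPred_lt_im] at h
  rw [Dplus_eq]
  exact (Set.ext_iff.1 h k).symm

lemma mem_closure_Dminus {k : ℂ} : k ∈ closure Dminus ↔ (k ^ 3).im ≤ 0 := by
  have h := isOpenMap_cube.preimage_closure_eq_closure_preimage (continuous_pow 3) {z | z.im < 0}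
  rw [Complex.closure_setOfPred_im_lt] at h
  rw [Dminus_eq]
  exact (Set.ext_iff.1 h k).symm

lemma uniqueDiffOn_closure_Dplus : UniqueDiffOn ℂ (closure Dplus) :=
  uniqueDiffOn_of_subset_closure_interior
    (closure_mono (interior_maximal subset_closure isOpen_Dplus))

/-- The part of `D̄₊` outside the closed unit disc. -/
def farSector : Set ℂ := closure Dplus ∩ {k | 1 < ‖k‖}

lemma isOpen_one_lt_norm : IsOpen {k : ℂ | 1 < ‖k‖} := isOpen_lt continuous_const continuous_norm

lemma uniqueDiffOn_farSector : UniqueDiffOn ℂ farSector :=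
  uniqueDiffOn_closure_Dplus.inter isOpen_one_lt_norm

lemma eventually_norm_ge (R : ℝ) : ∀ᶠ k in atInfty, R ≤ ‖k‖ := by
  refine Filter.Eventually.filter_mono inf_le_left ?_
  exact tendsto_norm_cobounded_atTop.eventually (eventually_ge_atTop R)

lemma eventually_mem_farSector : ∀ᶠ k in atInfty, k ∈ farSector := by
  have h1 : ∀ᶠ k in atInfty, k ∈ closure Dplus := mem_inf_of_right (mem_principal_self _)
  filter_upwards [h1, eventually_norm_ge 2] with k h1 h2
  exact ⟨h1, show 1 < ‖k‖ by linarith⟩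

lemma ne_zero_of_mem_farSector {k : ℂ} (hk : k ∈ farSector) : k ≠ 0 := by
  have : 1 < ‖k‖ := hk.2
  exact norm_pos_iff.1 (by linarith)

lemma isBigO_zpow_atInfty {a b : ℤ} (h : a ≤ b) :
    (fun k : ℂ => k ^ a) =O[atInfty] fun k : ℂ => k ^ b := by
  refine IsBigO.of_bound 1 ?_
  filter_upwards [eventually_norm_ge 1] with k hk
  rw [one_mul, norm_zpow, norm_zpow]
  exact zpow_le_zpow_right₀ hk h

/-! ### Symbols -/

section Symbols

variable {E F G : Type*} [NormedAddCommGroup E] [NormedSpace ℂ E] [NormedAddCommGroup F]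
  [NormedSpace ℂ F] [NormedAddCommGroup G] [NormedSpace ℂ G]

/-- Functions of class `C^n` whose `j`-th derivative is `O(k^{2j - a})` at infinity. -/
def IsSymbol (n : ℕ) (a : ℤ) (f : ℂ → E) : Prop :=
  ContDiffOn ℂ n f farSector ∧
    ∀ j ≤ n, (fun k => iteratedFDerivWithin ℂ j f farSector k) =O[atInfty]
      fun k => k ^ (2 * (j : ℤ) - a)

variable {n : ℕ} {a b : ℤ} {f f' : ℂ → E} {g : ℂ → F}

lemma IsSymbol.mono (hf : IsSymbol n a f) (h : b ≤ a) : IsSymbol n b f :=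
  ⟨hf.1, fun j hj => (hf.2 j hj).trans (isBigO_zpow_atInfty (by omega))⟩

lemma IsSymbol.congr (hf : IsSymbol n a f) (h : EqOn f' f farSector) : IsSymbol n a f' := by
  refine ⟨hf.1.congr h, fun j hj => (hf.2 j hj).congr' ?_ EventuallyEq.rfl⟩
  filter_upwards [eventually_mem_farSector] with k hk
  exact (iteratedFDerivWithin_congr h hk j).symm

lemma IsSymbol.add (hf : IsSymbol n a f) (hf' : IsSymbol n a f') :
    IsSymbol n a (fun k => f k + f' k) := by
  refine ⟨hf.1.add hf'.1, fun j hj => ?_⟩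
  refine ((hf.2 j hj).add (hf'.2 j hj)).congr' ?_ EventuallyEq.rfl
  filter_upwards [eventually_mem_farSector] with k hk
  have hj' : (j : WithTop ℕ∞) ≤ n := by exact_mod_cast hj
  exact (iteratedFDerivWithin_add_apply ((hf.1.of_le hj') k hk) ((hf'.1.of_le hj') k hk)
    uniqueDiffOn_farSector hk).symm

lemma isSymbol_const (c : E) : IsSymbol n 0 (fun _ => c) := by
  refine ⟨contDiffOn_const, fun j _ => ?_⟩
  rcases Nat.eq_zero_or_pos j with rfl | hj
  · simp only [Nat.cast_zero, mul_zero, sub_zero, zpow_zero]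
    refine IsBigO.of_bound ‖c‖ (Eventually.of_forall fun k => ?_)
    simp
  · refine (isBigO_zero _ _).congr' ?_ EventuallyEq.rfl
    filter_upwards [eventually_mem_farSector] with k hk
    rw [iteratedFDerivWithin_const_of_ne hj.ne']
    rfl

lemma isSymbol_zero : IsSymbol n a (fun _ => (0 : E)) := by
  refine ⟨contDiffOn_const, fun j _ => ?_⟩
  refine (isBigO_zero _ _).congr' ?_ EventuallyEq.rfl
  filter_upwards [eventually_mem_farSector] with k hk
  have : iteratedFDerivWithin ℂ j (0 : ℂ → E) farSector = 0 := iteratedFDerivWithin_fun_zero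
  exact (congrFun this k).symm

lemma IsSymbol.sum {ι : Type*} {s : Finset ι} {f : ι → ℂ → E}
    (hf : ∀ i ∈ s, IsSymbol n a (f i)) : IsSymbol n a (fun k => ∑ i ∈ s, f i k) := by
  classical
  induction s using Finset.induction_on with
  | empty => simpa using isSymbol_zero
  | insert i s hi ih =>
    simp_rw [Finset.sum_insert hi]
    exact (hf i (Finset.mem_insert_self _ _)).add
      (ih fun j hj => hf j (Finset.mem_insert_of_mem hj))

/-- In each Leibniz term the exponents `2i - a` and `2(j - i) - b` add up to `2j - (a + b)`,
whatever `i` is. -/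
lemma IsSymbol.bilinear (B : E →L[ℂ] F →L[ℂ] G) (hf : IsSymbol n a f) (hg : IsSymbol n b g) :
    IsSymbol n (a + b) (fun k => B (f k) (g k)) := by
  refine ⟨B.isBoundedBilinearMap.contDiff.comp₂_contDiffOn hf.1 hg.1, fun j hj => ?_⟩
  have h1 : (fun k => ‖B‖ * ∑ i ∈ Finset.range (j + 1), (j.choose i : ℝ) *
      ‖iteratedFDerivWithin ℂ i f farSector k‖ * ‖iteratedFDerivWithin ℂ (j - i) g farSector k‖)
      =O[atInfty] fun k : ℂ => k ^ (2 * (j : ℤ) - (a + b)) := by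
    refine IsBigO.const_mul_left (IsBigO.fun_sum fun i hi => ?_) _
    have hi : i ≤ j := Nat.lt_succ_iff.1 (Finset.mem_range.1 hi)
    have h2 := (((hf.2 i (hi.trans hj)).norm_left).const_mul_left (j.choose i : ℝ)).mul
      ((hg.2 (j - i) ((Nat.sub_le _ _).trans hj)).norm_left)
    refine h2.trans_eventuallyEq ?_
    filter_upwards [eventually_mem_farSector] with k hk
    rw [← zpow_add₀ (ne_zero_of_mem_farSector hk), Nat.cast_sub hi]
    congr 1
    ring
  refine IsBigO.trans (IsBigO.of_bound 1 ?_) h1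
  filter_upwards [eventually_mem_farSector] with k hk
  rw [one_mul]
  refine (B.norm_iteratedFDerivWithin_le_of_bilinear hf.1 hg.1 uniqueDiffOn_farSector hk
    (by exact_mod_cast hj)).trans (le_abs_self _)

lemma IsSymbol.clm (L : E →L[ℂ] F) (hf : IsSymbol n a f) : IsSymbol n a (fun k => L (f k)) := by
  have h := IsSymbol.bilinear (ContinuousLinearMap.apply ℂ F : E →L[ℂ] (E →L[ℂ] F) →L[ℂ] F) hf
    (isSymbol_const (n := n) L)
  simpa using h

lemma IsSymbol.neg (hf : IsSymbol n a f) : IsSymbol n a (fun k => - f k) := by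
  simpa using hf.clm (-ContinuousLinearMap.id ℂ E)

lemma IsSymbol.sub (hf : IsSymbol n a f) (hf' : IsSymbol n a f') :
    IsSymbol n a (fun k => f k - f' k) := by
  simpa [sub_eq_add_neg] using hf.add hf'.neg

lemma IsSymbol.smul {φ : ℂ → ℂ} (hφ : IsSymbol n a φ) (hg : IsSymbol n b g) :
    IsSymbol n (a + b) (fun k => φ k • g k) :=
  IsSymbol.bilinear (ContinuousLinearMap.lsmul ℂ ℂ) hφ hg

/-- The `j`-th derivative has size `k^{-1-j}`, which is smaller than the `k^{2j-1}` allowed. -/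
lemma isSymbol_inv : IsSymbol n 1 (fun k : ℂ => k⁻¹) := by
  have hc : ∀ k ∈ farSector, ∀ N : WithTop ℕ∞, ContDiffAt ℂ N (fun k : ℂ => k⁻¹) k := fun k hk N =>
    contDiffAt_inv ℂ (ne_zero_of_mem_farSector hk)
  refine ⟨fun k hk => (hc k hk n).contDiffWithinAt, fun j _ => ?_⟩
  have h1 : (fun k : ℂ => (∏ i ∈ Finset.range j, ((-1 : ℂ) - i)) * k ^ ((-1 : ℤ) - j))
      =O[atInfty] fun k : ℂ => k ^ (2 * (j : ℤ) - 1) :=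
    IsBigO.const_mul_left (isBigO_zpow_atInfty (by omega)) _
  refine IsBigO.trans (IsBigO.of_bound 1 ?_) h1
  filter_upwards [eventually_mem_farSector] with k hk
  rw [one_mul, norm_iteratedFDerivWithin_eq_norm_iteratedDerivWithin,
    iteratedDerivWithin_eq_iteratedDeriv uniqueDiffOn_farSector (hc k hk j) hk,
    iteratedDeriv_eq_iterate]
  have h2 := iter_deriv_zpow (𝕜 := ℂ) (-1) k j
  simp only [zpow_neg_one] at h2
  rw [h2]
  simp

lemma isSymbol_inv_pow (l : ℕ) : IsSymbol n l (fun k : ℂ => (k⁻¹) ^ l) := by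
  induction l with
  | zero => simpa using isSymbol_const (n := n) (1 : ℂ)
  | succ l ih =>
    have := ih.smul isSymbol_inv
    simpa [pow_succ] using this

/-- A solution of `y = r + P y` inherits the order of `r` if `P` decays. -/
lemma IsSymbol.of_fixedPoint {y r : ℂ → E} {P : ℂ → E →L[ℂ] E} (hr : IsSymbol n a r)
    (hP : IsSymbol n 1 P) (hy : ContDiffOn ℂ n y farSector)
    (h : ∀ k ∈ farSector, y k = r k + P k (y k)) : IsSymbol n a y := by
  refine ⟨hy, fun j => ?_⟩
  induction j using Nat.strong_induction_on with
  | _ j ih =>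
    intro hj
    have hjn : (j : WithTop ℕ∞) ≤ n := by exact_mod_cast hj
    set Dy : ℕ → ℂ → ℝ := fun i k => ‖iteratedFDerivWithin ℂ i y farSector k‖ with hDy
    set DP : ℕ → ℂ → ℝ := fun i k => ‖iteratedFDerivWithin ℂ i P farSector k‖ with hDP
    -- Everything in the Leibniz expansion except the term with all `j` derivatives on `y`. Each
    -- summand carries at least one derivative of `P` and, by induction, gains one order over `r`.
    set Q : ℂ → ℝ := fun k => ‖iteratedFDerivWithin ℂ j r farSector k‖ +
      ∑ i ∈ Finset.range j, (j.choose (i + 1) : ℝ) * DP (i + 1) k * Dy (j - (i + 1)) k with hQ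
    have hQO : Q =O[atInfty] fun k : ℂ => k ^ (2 * (j : ℤ) - a) := by
      refine (hr.2 j hj).norm_left.add (IsBigO.fun_sum fun i hi => ?_)
      have hi : i < j := Finset.mem_range.1 hi
      have h2 := (((hP.2 (i + 1) (by omega)).norm_left).const_mul_left
        (j.choose (i + 1) : ℝ)).mul ((ih (j - (i + 1)) (by omega) (by omega)).norm_left)
      refine (h2.trans_eventuallyEq ?_).trans
        (isBigO_zpow_atInfty (a := 2 * (j : ℤ) - a - 1) (by omega))
      filter_upwards [eventually_mem_farSector] with k hk
      rw [← zpow_add₀ (ne_zero_of_mem_farSector hk), Nat.cast_sub (by omega)]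
      congr 1
      push_cast
      ring
    -- Order one means `‖P k‖ ≤ C / |k|`. Once this is below `1/2`, the remaining term `P D^j y` is
    -- absorbed into the left-hand side; no a priori bound on `y` is needed, since its derivatives
    -- have finite norm at each point.
    have hP0 : ∀ᶠ k in atInfty, ‖P k‖ ≤ 1 / 2 := by
      have h0 := hP.2 0 (Nat.zero_le n)
      obtain ⟨C, hC⟩ := h0.bound
      filter_upwards [hC, eventually_norm_ge (max 1 (2 * C))] with k h1 h2
      have h3 : 1 ≤ ‖k‖ := (le_max_left _ _).trans h2
      have h4 : 2 * C ≤ ‖k‖ := (le_max_right _ _).trans h2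
      rw [norm_iteratedFDerivWithin_zero] at h1
      simp only [Nat.cast_zero, mul_zero, zero_sub, zpow_neg_one, norm_inv] at h1
      refine h1.trans ?_
      rw [← div_eq_mul_inv, div_le_iff₀ (by linarith)]
      linarith
    refine IsBigO.trans (IsBigO.of_bound 2 ?_) hQO
    filter_upwards [eventually_mem_farSector, hP0] with k hk hPk
    have hPy : ContDiffOn ℂ n (fun k => P k (y k)) farSector := hP.1.clm_apply hy
    have h1 : iteratedFDerivWithin ℂ j y farSector k = iteratedFDerivWithin ℂ j r farSector k +
        iteratedFDerivWithin ℂ j (fun k => P k (y k)) farSector k := by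
      rw [iteratedFDerivWithin_congr h hk j]
      exact iteratedFDerivWithin_add_apply ((hr.1.of_le hjn) k hk) ((hPy.of_le hjn) k hk)
        uniqueDiffOn_farSector hk
    have h2 := (ContinuousLinearMap.id ℂ (E →L[ℂ] E)).norm_iteratedFDerivWithin_le_of_bilinear
      hP.1 hy uniqueDiffOn_farSector hk hjn
    have h3 : ‖iteratedFDerivWithin ℂ j (fun k => P k (y k)) farSector k‖ ≤
        ∑ i ∈ Finset.range (j + 1), (j.choose i : ℝ) * DP i k * Dy (j - i) k := by
      refine h2.trans (mul_le_of_le_one_left ?_ ContinuousLinearMap.norm_id_le)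
      exact Finset.sum_nonneg fun i _ => by positivity
    rw [Finset.sum_range_succ'] at h3
    have h4 : DP 0 k * Dy j k ≤ 1 / 2 * Dy j k := by
      refine mul_le_mul_of_nonneg_right ?_ (norm_nonneg _)
      simpa [hDP] using hPk
    have h5 : Dy j k ≤ Q k + 1 / 2 * Dy j k := by
      have h6 := norm_add_le (iteratedFDerivWithin ℂ j r farSector k)
        (iteratedFDerivWithin ℂ j (fun k => P k (y k)) farSector k)
      rw [← h1] at h6
      simp only [Nat.choose_zero_right, Nat.cast_one, one_mul, Nat.sub_zero] at h3
      simp only [hQ]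
      calc Dy j k ≤ _ := h6
        _ ≤ _ := by linarith
    have h7 : Q k ≤ ‖Q k‖ := le_abs_self _
    change Dy j k ≤ 2 * ‖Q k‖
    linarith

end Symbols

/-! ### Oscillatory operators with phase `8k³` -/

lemma phase_mem_upperHalf {k : ℂ} (hk : k ∈ closure Dplus) : 8 * k ^ 3 ∈ upperHalf := by
  have h : 0 ≤ (k ^ 3).im := mem_closure_Dplus.1 hk
  change 0 ≤ (8 * k ^ 3).im
  rw [Complex.mul_im]
  norm_num
  exact h

/-- The derivatives are `24k²`, `48k`, `48` and then zero. The geometric form `D ^ i` is the one the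
bound for iterated derivatives of a composition asks for, and `48 ‖k‖²` serves every order because
`‖k‖ > 1`. -/
lemma norm_iteratedFDerivWithin_phase_le {k : ℂ} (hk : k ∈ farSector) {i : ℕ} (hi : 1 ≤ i) :
    ‖iteratedFDerivWithin ℂ i (fun k : ℂ => 8 * k ^ 3) farSector k‖ ≤ (48 * ‖k‖ ^ 2) ^ i := by
  have hk1 : 1 < ‖k‖ := hk.2
  have hc : ContDiff ℂ i (fun k : ℂ => k ^ 3) := by fun_prop
  have h1 : ‖iteratedFDerivWithin ℂ i (fun k : ℂ => 8 * k ^ 3) farSector k‖ =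
      ‖(8 : ℂ) * ((∏ j ∈ Finset.range i, ((3 : ℂ) - j)) * k ^ (3 - i))‖ := by
    rw [norm_iteratedFDerivWithin_eq_norm_iteratedDerivWithin,
      iteratedDerivWithin_eq_iteratedDeriv uniqueDiffOn_farSector
        (contDiff_const.mul hc).contDiffAt hk, iteratedDeriv_const_mul_field,
      iteratedDeriv_eq_iterate, iter_deriv_pow]
    norm_num
  rw [h1]
  have hk2 : (1 : ℝ) ≤ ‖k‖ ^ 2 := one_le_pow₀ hk1.le
  match i, hi with
  | 1, _ => norm_num; nlinarith
  | 2, _ =>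
    norm_num [Finset.prod_range_succ]
    nlinarith [sq_nonneg (‖k‖ ^ 2)]
  | 3, _ =>
    norm_num [Finset.prod_range_succ]
    have : (1:ℝ) ≤ (‖k‖ ^ 2) ^ 3 := one_le_pow₀ hk2
    nlinarith
  | i + 4, _ =>
    have : ∏ j ∈ Finset.range (i + 4), ((3 : ℂ) - j) = 0 :=
      Finset.prod_eq_zero (i := 3) (by simp) (by norm_num)
    rw [this]
    simp

/-- Each derivative in `k` brings at most a factor `k²` from the phase; this is the origin of the
exponent `2j` in `IsSymbol`. -/
lemma isSymbol_oscOp {n : ℕ} {q : ℝ → ℂ} (hq : WeightedL1 n q) :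
    IsSymbol n 0 (fun k => oscOp n 0 q (8 * k ^ 3)) := by
  have hf : ContDiffOn ℂ n (fun k : ℂ => 8 * k ^ 3) farSector := by fun_prop
  have hm : MapsTo (fun k : ℂ => 8 * k ^ 3) farSector upperHalf := fun k hk =>
    phase_mem_upperHalf hk.1
  refine ⟨(contDiffOn_oscOp hq).comp hf hm, fun j hj => ?_⟩
  set C := ∫ s in Ioi 0, (1 + s) ^ n * ‖q s‖
  have hjn : (j : WithTop ℕ∞) ≤ n := by exact_mod_cast hj
  refine IsBigO.of_bound (j.factorial * C * 48 ^ j) ?_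
  filter_upwards [eventually_mem_farSector] with k hk
  have key := norm_iteratedFDerivWithin_comp_le (contDiffOn_oscOp hq) hf hjn
    uniqueDiffOn_upperHalf uniqueDiffOn_farSector hm hk (C := C) (D := 48 * ‖k‖ ^ 2)
    (fun i hi => norm_iteratedFDerivWithin_oscOp_le (hi.trans hj) hq (hm hk))
    (fun i hi _ => norm_iteratedFDerivWithin_phase_le hk hi)
  refine key.trans (le_of_eq ?_)
  have : (2 * (j : ℤ) - 0) = ((2 * j : ℕ) : ℤ) := by push_cast; ring
  rw [this, zpow_natCast, norm_pow, mul_pow, ← pow_mul]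
  ring

/-! ### Bounded functions on `[0, ∞)` -/

/-- Bounded continuous functions on `[0, ∞)`. -/
def IsBdd (f : ℝ → ℂ) : Prop :=
  ContinuousOn f (Ici 0) ∧ ∃ C : ℝ, ∀ t, 0 ≤ t → ‖f t‖ ≤ C

open Classical in
/-- The bounded continuous function on `ℝ≥0` given by `f`. -/
def toBC (f : ℝ → ℂ) : ℝ≥0 →ᵇ ℂ :=
  if h : IsBdd f then
    BoundedContinuousFunction.ofNormedAddCommGroup (fun t : ℝ≥0 => f t)
      (h.1.comp_continuous NNReal.continuous_coe fun t => t.coe_nonneg) h.2.choose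
      fun t => h.2.choose_spec t t.coe_nonneg
  else 0

lemma toBC_apply {f : ℝ → ℂ} (h : IsBdd f) (t : ℝ≥0) : toBC f t = f t := by
  rw [toBC, dif_pos h]
  rfl

lemma isBdd_const (c : ℂ) : IsBdd (fun _ => c) := ⟨continuousOn_const, ‖c‖, fun _ _ => le_rfl⟩

lemma IsBdd.mul_weightedL1 {n : ℕ} {f q : ℝ → ℂ} (hf : IsBdd f) (hq : WeightedL1 n q) :
    WeightedL1 n (fun s => f s * q s) :=
  hq.bdd_mul hf.1 hf.2.choose_spec

lemma IsBdd.conj {f : ℝ → ℂ} (hf : IsBdd f) : IsBdd (fun s => conj (f s)) := by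
  obtain ⟨hc, C, hC⟩ := hf
  exact ⟨Complex.continuous_conj.comp_continuousOn hc, C, fun t ht => by simpa using hC t ht⟩

lemma IsBdd.mul {f g : ℝ → ℂ} (hf : IsBdd f) (hg : IsBdd g) : IsBdd (fun s => f s * g s) := by
  obtain ⟨hc, C, hC⟩ := hf
  obtain ⟨hc', C', hC'⟩ := hg
  refine ⟨hc.mul hc', C * C', fun t ht => ?_⟩
  rw [norm_mul]
  exact mul_le_mul (hC t ht) (hC' t ht) (norm_nonneg _) ((norm_nonneg _).trans (hC t ht))

lemma IsBdd.add {f g : ℝ → ℂ} (hf : IsBdd f) (hg : IsBdd g) : IsBdd (fun s => f s + g s) := by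
  obtain ⟨hc, C, hC⟩ := hf
  obtain ⟨hc', C', hC'⟩ := hg
  exact ⟨hc.add hc', C + C', fun t ht =>
    (norm_add_le _ _).trans (add_le_add (hC t ht) (hC' t ht))⟩

lemma isBdd_sum {ι : Type*} (s : Finset ι) {f : ι → ℝ → ℂ} (hf : ∀ i ∈ s, IsBdd (f i)) :
    IsBdd (fun t => ∑ i ∈ s, f i t) := by
  classical
  induction s using Finset.induction_on with
  | empty => simpa using isBdd_const 0
  | insert i s hi ih =>
    simp_rw [Finset.sum_insert hi]
    exact (hf i (Finset.mem_insert_self _ _)).add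
      (ih fun j hj => hf j (Finset.mem_insert_of_mem hj))

/-! ### Block operators on pairs -/

instance instNormedSpaceBC : NormedSpace ℂ (ℝ≥0 →ᵇ ℂ) := BoundedContinuousFunction.instNormedSpace

instance instNormedSpacePairBC : NormedSpace ℂ ((ℝ≥0 →ᵇ ℂ) × (ℝ≥0 →ᵇ ℂ)) := Prod.normedSpace

instance instNormedSpaceOpPairBC : NormedSpace ℂ
    ((ℝ≥0 →ᵇ ℂ) × (ℝ≥0 →ᵇ ℂ) →L[ℂ] (ℝ≥0 →ᵇ ℂ) × (ℝ≥0 →ᵇ ℂ)) :=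
  ContinuousLinearMap.toNormedSpace

/-- `a ↦ u a v`. -/
def sandwich (u : (ℝ≥0 →ᵇ ℂ) →L[ℂ] (ℝ≥0 →ᵇ ℂ) × (ℝ≥0 →ᵇ ℂ))
    (v : (ℝ≥0 →ᵇ ℂ) × (ℝ≥0 →ᵇ ℂ) →L[ℂ] (ℝ≥0 →ᵇ ℂ)) :
    ((ℝ≥0 →ᵇ ℂ) →L[ℂ] (ℝ≥0 →ᵇ ℂ)) →L[ℂ]
      ((ℝ≥0 →ᵇ ℂ) × (ℝ≥0 →ᵇ ℂ) →L[ℂ] (ℝ≥0 →ᵇ ℂ) × (ℝ≥0 →ᵇ ℂ)) :=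
  (ContinuousLinearMap.compL ℂ _ _ _ u) ∘L ((ContinuousLinearMap.compL ℂ _ _ _).flip v)

lemma sandwich_apply (u : (ℝ≥0 →ᵇ ℂ) →L[ℂ] (ℝ≥0 →ᵇ ℂ) × (ℝ≥0 →ᵇ ℂ))
    (v : (ℝ≥0 →ᵇ ℂ) × (ℝ≥0 →ᵇ ℂ) →L[ℂ] (ℝ≥0 →ᵇ ℂ)) (a : (ℝ≥0 →ᵇ ℂ) →L[ℂ] (ℝ≥0 →ᵇ ℂ))
    (w : (ℝ≥0 →ᵇ ℂ) × (ℝ≥0 →ᵇ ℂ)) : sandwich u v a w = u (a (v w)) := rfl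

attribute [irreducible] sandwich

/-- The operator with the matrix `(a, b; c, d)`. -/
def blockOp (a b c d : (ℝ≥0 →ᵇ ℂ) →L[ℂ] (ℝ≥0 →ᵇ ℂ)) :
    (ℝ≥0 →ᵇ ℂ) × (ℝ≥0 →ᵇ ℂ) →L[ℂ] (ℝ≥0 →ᵇ ℂ) × (ℝ≥0 →ᵇ ℂ) :=
  sandwich (.inl ℂ _ _) (.fst ℂ _ _) a + sandwich (.inl ℂ _ _) (.snd ℂ _ _) b +
    (sandwich (.inr ℂ _ _) (.fst ℂ _ _) c + sandwich (.inr ℂ _ _) (.snd ℂ _ _) d)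

lemma blockOp_apply (a b c d : (ℝ≥0 →ᵇ ℂ) →L[ℂ] (ℝ≥0 →ᵇ ℂ))
    (w : (ℝ≥0 →ᵇ ℂ) × (ℝ≥0 →ᵇ ℂ)) :
    blockOp a b c d w = (a w.1 + b w.2, c w.1 + d w.2) := by
  simp [blockOp, sandwich_apply]

section

variable {E F : Type*} [NormedAddCommGroup E] [NormedSpace ℂ E] [NormedAddCommGroup F]
  [NormedSpace ℂ F] {n : ℕ} {r : ℤ} {s : Set ℂ} {a b c d : ℂ → E}

lemma contDiffOn_four (L₁ L₂ L₃ L₄ : E →L[ℂ] F) (ha : ContDiffOn ℂ n a s)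
    (hb : ContDiffOn ℂ n b s) (hc : ContDiffOn ℂ n c s) (hd : ContDiffOn ℂ n d s) :
    ContDiffOn ℂ n (fun k => L₁ (a k) + L₂ (b k) + (L₃ (c k) + L₄ (d k))) s :=
  ((ha.continuousLinearMap_comp L₁).add (hb.continuousLinearMap_comp L₂)).add
    ((hc.continuousLinearMap_comp L₃).add (hd.continuousLinearMap_comp L₄))

lemma isSymbol_four (L₁ L₂ L₃ L₄ : E →L[ℂ] F) (ha : IsSymbol n r a)
    (hb : IsSymbol n r b) (hc : IsSymbol n r c) (hd : IsSymbol n r d) :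
    IsSymbol n r (fun k => L₁ (a k) + L₂ (b k) + (L₃ (c k) + L₄ (d k))) :=
  ((ha.clm L₁).add (hb.clm L₂)).add ((hc.clm L₃).add (hd.clm L₄))

end

lemma contDiffOn_blockOp {n : ℕ} {s : Set ℂ} {a b c d : ℂ → (ℝ≥0 →ᵇ ℂ) →L[ℂ] (ℝ≥0 →ᵇ ℂ)}
    (ha : ContDiffOn ℂ n a s) (hb : ContDiffOn ℂ n b s) (hc : ContDiffOn ℂ n c s)
    (hd : ContDiffOn ℂ n d s) : ContDiffOn ℂ n (fun k => blockOp (a k) (b k) (c k) (d k)) s :=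
  contDiffOn_four _ _ _ _ ha hb hc hd

lemma isSymbol_blockOp {n : ℕ} {r : ℤ} {a b c d : ℂ → (ℝ≥0 →ᵇ ℂ) →L[ℂ] (ℝ≥0 →ᵇ ℂ)}
    (ha : IsSymbol n r a) (hb : IsSymbol n r b) (hc : IsSymbol n r c) (hd : IsSymbol n r d) :
    IsSymbol n r (fun k => blockOp (a k) (b k) (c k) (d k)) :=
  isSymbol_four _ _ _ _ ha hb hc hd

/-! ### Invertibility -/

/-- A Volterra integral against the weight `e^{M ∫_t^∞ p}`. -/
lemma norm_weighted_volterra_le {n : ℕ} {κ q : ℝ → ℂ} (hκ : IsKernel n κ) (hq : WeightedL1 n q)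
    (h1 : ∀ τ, 0 ≤ τ → ‖κ τ‖ ≤ 1) {p : ℝ → ℝ} (hp : ContinuousOn p (Ici 0))
    (hi : IntegrableOn p (Ioi 0)) (hqp : ∀ t, 0 ≤ t → ‖q t‖ ≤ p t) {M : ℝ} (hM : 0 < M)
    {e e' : ℝ≥0 →ᵇ ℂ} (he : ∀ t : ℝ≥0, e t = Real.exp (M * ∫ r in Ioi (t : ℝ), p r))
    (hee : e' * e = 1) (w : ℝ≥0 →ᵇ ℂ) :
    ‖e' * volterra n κ q (e * w)‖ ≤ 1 / M * ‖w‖ := by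
  have h0 : ∀ t, 0 ≤ t → 0 ≤ p t := fun t ht => (norm_nonneg _).trans (hqp t ht)
  refine (BoundedContinuousFunction.norm_le (by positivity)).2 fun t => ?_
  obtain ⟨hint, hle⟩ := integral_mul_exp_tail hp hi h0 hM t.coe_nonneg
  have hcoe : e' t * e t = 1 := by
    have := congrArg (fun f : ℝ≥0 →ᵇ ℂ => f t) hee
    simpa using this
  have hnorm : ‖e' t‖ * Real.exp (M * ∫ r in Ioi (t : ℝ), p r) = 1 := by
    have := congrArg norm hcoe
    rw [norm_mul, he, Complex.norm_real, norm_one, Real.norm_of_nonneg (Real.exp_pos _).le] at this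
    exact this
  rw [BoundedContinuousFunction.coe_mul, Pi.mul_apply, volterra_apply hκ hq, norm_mul]
  have key : ‖∫ s in Ioi (t : ℝ), κ (s - t) * (q s * (e * w) s.toNNReal)‖ ≤
      (Real.exp (M * ∫ r in Ioi (t : ℝ), p r) / M) * ‖w‖ := by
    refine (norm_integral_le_of_norm_le (hint.mul_const ‖w‖) ?_).trans ?_
    · refine (ae_restrict_iff' measurableSet_Ioi).2 (ae_of_all _ fun s hs => ?_)
      have hs' : (t : ℝ) < s := hs
      have hs0 : 0 ≤ s := t.coe_nonneg.trans hs'.le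
      have a1 := h1 (s - t) (by linarith)
      have a2 := hqp s hs0
      have a3 := w.norm_coe_le_norm s.toNNReal
      have a4 := h0 s hs0
      rw [norm_mul, norm_mul, BoundedContinuousFunction.coe_mul, Pi.mul_apply, norm_mul, he,
        Complex.norm_real, Real.norm_of_nonneg (Real.exp_pos _).le, Real.coe_toNNReal s hs0]
      calc _ ≤ 1 * (p s * (Real.exp (M * ∫ r in Ioi s, p r) * ‖w‖)) := by gcongr
        _ = _ := by ring
    · rw [integral_mul_const]
      gcongr
  calc ‖e' t‖ * _ ≤ ‖e' t‖ * ((Real.exp (M * ∫ r in Ioi (t : ℝ), p r) / M) * ‖w‖) := by gcongr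
    _ = (‖e' t‖ * Real.exp (M * ∫ r in Ioi (t : ℝ), p r)) * (1 / M * ‖w‖) := by ring
    _ = _ := by rw [hnorm, one_mul]

/-- `1 + K` is invertible for a Volterra operator `K`. -/
lemma isUnit_one_add_volterra {n : ℕ} {κ q : Fin 2 → Fin 2 → ℝ → ℂ}
    (hκ : ∀ i j, IsKernel n (κ i j)) (hq : ∀ i j, WeightedL1 n (q i j))
    (h1 : ∀ i j τ, 0 ≤ τ → ‖κ i j τ‖ ≤ 1) :
    IsUnit (1 + blockOp (volterra n (κ 0 0) (q 0 0)) (volterra n (κ 0 1) (q 0 1))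
      (volterra n (κ 1 0) (q 1 0)) (volterra n (κ 1 1) (q 1 1))) := by
  set p : ℝ → ℝ := fun s => ∑ i, ∑ j, ‖q i j s‖ with hp_def
  have hp : ContinuousOn p (Ici 0) :=
    continuousOn_finsetSum _ fun i _ => continuousOn_finsetSum _ fun j _ => (hq i j).1.norm
  have hi : IntegrableOn p (Ioi 0) :=
    integrable_finsetSum _ fun i _ => integrable_finsetSum _ fun j _ =>
      (hq i j).integrableOn.norm
  have hqp : ∀ i j t, 0 ≤ t → ‖q i j t‖ ≤ p t := fun i j t _ =>
    (Finset.single_le_sum (f := fun j => ‖q i j t‖) (fun _ _ => norm_nonneg _)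
      (Finset.mem_univ j)).trans
      (Finset.single_le_sum (f := fun i => ∑ j, ‖q i j t‖)
        (fun _ _ => Finset.sum_nonneg fun _ _ => norm_nonneg _) (Finset.mem_univ i))
  have h0 : ∀ t, 0 ≤ t → 0 ≤ p t := fun t ht => (norm_nonneg _).trans (hqp 0 0 t ht)
  set σ : ℝ → ℝ := fun t => ∫ r in Ioi t, p r with hσ
  have hσc : ContinuousOn σ (Ici 0) := fun t ht =>
    (hasDerivAt_tail hp hi ht).continuousWithinAt
  have hσ0 : ∀ t, 0 ≤ t → 0 ≤ σ t := fun t ht =>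
    setIntegral_nonneg measurableSet_Ioi fun r hr => h0 r (ht.trans (le_of_lt hr))
  have hσle : ∀ t, 0 ≤ t → σ t ≤ σ 0 := fun t ht => by
    refine setIntegral_mono_set hi ?_ (Ioi_subset_Ioi ht).eventuallyLE
    exact (ae_restrict_iff' measurableSet_Ioi).2 (ae_of_all _ fun r hr => h0 r (le_of_lt hr))
  have hb : ∀ c : ℝ, IsBdd (fun t => (Real.exp (c * σ t) : ℂ)) := fun c => by
    refine ⟨?_, Real.exp (|c| * σ 0), fun t ht => ?_⟩
    · exact Complex.continuous_ofReal.comp_continuousOn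
        (Real.continuous_exp.comp_continuousOn (continuousOn_const.mul hσc))
    · rw [Complex.norm_real, Real.norm_of_nonneg (Real.exp_pos _).le]
      refine Real.exp_le_exp.2 ?_
      have := hσ0 t ht
      have := hσle t ht
      calc c * σ t ≤ |c| * σ t := by gcongr; exact le_abs_self c
        _ ≤ _ := by gcongr
  -- With the exponent 4 each entry of the conjugated matrix has norm at most `1/4`. A row has two
  -- entries, so the conjugated operator has norm at most `1/2`, and invertibility of `1 + K` is
  -- unaffected by the conjugation.
  set e : ℝ≥0 →ᵇ ℂ := toBC (fun t => (Real.exp (4 * σ t) : ℂ)) with he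
  set e' : ℝ≥0 →ᵇ ℂ := toBC (fun t => (Real.exp (-4 * σ t) : ℂ)) with he'
  have hee : e' * e = 1 := by
    ext t
    rw [BoundedContinuousFunction.coe_mul, Pi.mul_apply, he, he', toBC_apply (hb _),
      toBC_apply (hb _), ← Complex.ofReal_mul, ← Real.exp_add]
    simp
  have hee' : e * e' = 1 := by rw [mul_comm, hee]
  set L := ContinuousLinearMap.mul ℂ ((ℝ≥0 →ᵇ ℂ) × (ℝ≥0 →ᵇ ℂ)) with hL
  have hLL : L (e, e) * L (e', e') = 1 := by
    ext w t <;> simp [hL, ← mul_assoc, hee']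
  have hLL' : L (e', e') * L (e, e) = 1 := by
    ext w t <;> simp [hL, ← mul_assoc, hee]
  set K := blockOp (volterra n (κ 0 0) (q 0 0)) (volterra n (κ 0 1) (q 0 1))
      (volterra n (κ 1 0) (q 1 0)) (volterra n (κ 1 1) (q 1 1)) with hK
  have hsmall : ‖-(L (e', e') * K * L (e, e))‖ < 1 := by
    rw [norm_neg]
    refine lt_of_le_of_lt (ContinuousLinearMap.opNorm_le_bound _ (M := 1 / 2) (by norm_num)
      fun w => ?_) (by norm_num)
    have hbd : ∀ i j (v : ℝ≥0 →ᵇ ℂ), ‖v‖ ≤ ‖w‖ →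
        ‖e' * volterra n (κ i j) (q i j) (e * v)‖ ≤ 1 / 4 * ‖w‖ := fun i j v hv => by
      refine (norm_weighted_volterra_le (hκ i j) (hq i j) (h1 i j) hp hi (hqp i j) (M := 4)
        (by norm_num) (fun t => ?_) hee v).trans (by gcongr)
      rw [he, toBC_apply (hb 4)]
    have hw1 := norm_fst_le w
    have hw2 := norm_snd_le w
    have hval : (L (e', e') * K * L (e, e)) w =
        (e' * volterra n (κ 0 0) (q 0 0) (e * w.1) + e' * volterra n (κ 0 1) (q 0 1) (e * w.2),
          e' * volterra n (κ 1 0) (q 1 0) (e * w.1) +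
            e' * volterra n (κ 1 1) (q 1 1) (e * w.2)) := by
      simp [hL, hK, blockOp_apply, mul_add]
    rw [hval, Prod.norm_def]
    refine max_le ?_ ?_
    · refine (norm_add_le _ _).trans ?_
      have := hbd 0 0 _ hw1
      have := hbd 0 1 _ hw2
      linarith
    · refine (norm_add_le _ _).trans ?_
      have := hbd 1 0 _ hw1
      have := hbd 1 1 _ hw2
      linarith
  have hunit := isUnit_one_sub_of_norm_lt_one hsmall
  have hfac : 1 + K = L (e, e) * (1 - -(L (e', e') * K * L (e, e))) * L (e', e') := by
    rw [sub_neg_eq_add, mul_add, add_mul, mul_one, hLL]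
    congr 1
    calc K = 1 * K * 1 := by rw [one_mul, mul_one]
      _ = (L (e, e) * L (e', e')) * K * (L (e, e) * L (e', e')) := by rw [hLL]
      _ = _ := by simp only [mul_assoc]
  rw [hfac]
  have hu : IsUnit (L (e, e)) := ⟨⟨_, _, hLL, hLL'⟩, rfl⟩
  have hu' : IsUnit (L (e', e')) := ⟨⟨_, _, hLL', hLL⟩, rfl⟩
  exact (hu.mul hunit).mul hu'

/-! ### Weighted Sobolev classes on the half-line -/

/-- `C^r` functions on `[0, ∞)` whose derivatives up to order `r` are in the weighted `L¹`. -/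
def Sobolev (n : ℕ) : ℕ → (ℝ → ℂ) → Prop
  | 0, f => WeightedL1 n f
  | r + 1, f => WeightedL1 n f ∧ DifferentiableOn ℝ f (Ici 0) ∧
      Sobolev n r (derivWithin f (Ici 0))

/-- Bounded `C^r` functions on `[0, ∞)` whose derivatives of order `1, …, r` are in the
weighted `L¹`. -/
def Multiplier (n : ℕ) : ℕ → (ℝ → ℂ) → Prop
  | 0, f => IsBdd f
  | r + 1, f => IsBdd f ∧ DifferentiableOn ℝ f (Ici 0) ∧ Sobolev n r (derivWithin f (Ici 0))

section Classes

variable {n r s : ℕ} {f g : ℝ → ℂ}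

lemma Sobolev.weightedL1 (h : Sobolev n r f) : WeightedL1 n f := by
  cases r with
  | zero => exact h
  | succ r => exact h.1

lemma Multiplier.isBdd (h : Multiplier n r f) : IsBdd f := by
  cases r with
  | zero => exact h
  | succ r => exact h.1

lemma Sobolev.of_succ (h : Sobolev n (r + 1) f) : Sobolev n r f := by
  induction r generalizing f with
  | zero => exact h.1
  | succ r ih => exact ⟨h.1, h.2.1, ih h.2.2⟩

lemma Sobolev.of_le (h : Sobolev n r f) (hs : s ≤ r) : Sobolev n s f := by
  induction r with
  | zero => rwa [Nat.le_zero.1 hs]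
  | succ r ih =>
    rcases hs.eq_or_lt with rfl | hlt
    · exact h
    · exact ih h.of_succ (Nat.lt_succ_iff.1 hlt)

lemma Multiplier.of_le (h : Multiplier n r f) (hs : s ≤ r) : Multiplier n s f := by
  cases s with
  | zero => exact h.isBdd
  | succ s =>
    cases r with
    | zero => omega
    | succ r => exact ⟨h.1, h.2.1, h.2.2.of_le (Nat.le_of_succ_le_succ hs)⟩

lemma Sobolev.congr (h : Sobolev n r f) (hfg : EqOn g f (Ici 0)) : Sobolev n r g := by
  induction r generalizing f g with
  | zero => exact WeightedL1.congr h hfg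
  | succ r ih =>
    exact ⟨h.1.congr hfg, h.2.1.congr hfg, ih h.2.2 fun t ht => derivWithin_congr hfg (hfg ht)⟩

lemma Sobolev.hasDerivWithinAt (h : Sobolev n (r + 1) f) {t : ℝ} (ht : 0 ≤ t) :
    HasDerivWithinAt f (derivWithin f (Ici 0) t) (Ici 0) t :=
  (h.2.1 t ht).hasDerivWithinAt

lemma sobolev_zero : Sobolev n r (fun _ => 0) := by
  induction r with
  | zero => exact weightedL1_zero n
  | succ r ih => exact ⟨weightedL1_zero n, differentiableOn_const _, ih.congr fun t _ => by simp⟩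

lemma Sobolev.add (hf : Sobolev n r f) (hg : Sobolev n r g) :
    Sobolev n r (fun t => f t + g t) := by
  induction r generalizing f g with
  | zero => exact WeightedL1.add hf hg
  | succ r ih =>
    refine ⟨hf.1.add hg.1, hf.2.1.add hg.2.1, (ih hf.2.2 hg.2.2).congr fun t ht => ?_⟩
    exact derivWithin_fun_add (hf.2.1 t ht) (hg.2.1 t ht)

lemma multiplier_const (c : ℂ) : Multiplier n r (fun _ => c) := by
  cases r with
  | zero => exact isBdd_const c
  | succ r => exact ⟨isBdd_const c, differentiableOn_const _, sobolev_zero.congr fun t _ => by simp⟩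

lemma Sobolev.isBdd (h : Sobolev n (r + 1) f) : IsBdd f := by
  have hi := h.2.2.weightedL1.integrableOn
  refine ⟨h.1.1, ‖f 0‖ + ∫ s in Ioi 0, ‖derivWithin f (Ici 0) s‖, fun t ht => ?_⟩
  have hint : IntervalIntegrable (derivWithin f (Ici 0)) volume 0 t :=
    (intervalIntegrable_iff_integrableOn_Ioc_of_le ht).2 (hi.mono_set Ioc_subset_Ioi_self)
  have h1 := intervalIntegral.integral_eq_sub_of_hasDerivAt_of_le ht
    (h.1.1.mono Icc_subset_Ici_self)
    (fun x hx => (h.hasDerivWithinAt hx.1.le).hasDerivAt (Ici_mem_nhds hx.1)) hint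
  have h2 : ‖∫ y in (0:ℝ)..t, derivWithin f (Ici 0) y‖ ≤
      ∫ s in Ioi 0, ‖derivWithin f (Ici 0) s‖ := by
    rw [intervalIntegral.integral_of_le ht]
    refine (norm_integral_le_integral_norm _).trans ?_
    exact setIntegral_mono_set hi.norm (ae_of_all _ fun _ => norm_nonneg _)
      Ioc_subset_Ioi_self.eventuallyLE
  have h3 : f t = f 0 + ∫ y in (0:ℝ)..t, derivWithin f (Ici 0) y := by rw [h1]; ring
  rw [h3]
  exact (norm_add_le _ _).trans (by gcongr)

lemma Sobolev.multiplier (h : Sobolev n r f) (hr : 1 ≤ r) (hs : s ≤ r) : Multiplier n s f := by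
  obtain ⟨r, rfl⟩ := Nat.exists_eq_add_of_le' hr
  have h1 : Multiplier n (r + 1) f := ⟨h.isBdd, h.2.1, h.2.2⟩
  exact h1.of_le hs

lemma Sobolev.tendsto_zero (h : Sobolev n (r + 1) f) : Tendsto f atTop (𝓝 0) :=
  tendsto_zero_of_hasDerivAt_of_integrableOn_Ioi (a := 0)
    (fun _ hx => (h.hasDerivWithinAt (le_of_lt hx)).hasDerivAt (Ici_mem_nhds hx))
    h.2.2.weightedL1.integrableOn h.1.integrableOn

/-- Both terms of the product rule are again a multiplier times a Sobolev function. In `f' g` the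
roles are exchanged: `g`, having an integrable derivative, is bounded and acts as the multiplier. -/
lemma Multiplier.mul (hf : Multiplier n r f) (hg : Sobolev n r g) :
    Sobolev n r (fun t => f t * g t) := by
  induction r generalizing f g with
  | zero => exact IsBdd.mul_weightedL1 hf hg
  | succ r ih =>
    have h1 : Sobolev n r (fun t => g t * derivWithin f (Ici 0) t) :=
      ih (hg.multiplier (Nat.le_add_left 1 r) (Nat.le_succ r)) hf.2.2
    have h2 : Sobolev n r (fun t => f t * derivWithin g (Ici 0) t) :=
      ih (hf.of_le (Nat.le_succ r)) hg.2.2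
    refine ⟨hf.1.mul_weightedL1 hg.1, hf.2.1.mul hg.2.1, (h1.add h2).congr fun t ht => ?_⟩
    rw [derivWithin_fun_mul (hf.2.1 t ht) (hg.2.1 t ht), mul_comm (derivWithin f _ t)]

lemma Sobolev.const_mul (c : ℂ) (hf : Sobolev n r f) : Sobolev n r (fun t => c * f t) :=
  (multiplier_const c).mul hf

lemma Sobolev.sub (hf : Sobolev n r f) (hg : Sobolev n r g) :
    Sobolev n r (fun t => f t - g t) :=
  (hf.add (hg.const_mul (-1))).congr fun t _ => by ring

lemma Sobolev.neg (hf : Sobolev n r f) : Sobolev n r (fun t => -f t) :=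
  (hf.const_mul (-1)).congr fun t _ => by ring

/-- Integration gains one derivative. The result is only a multiplier, since a tail integral is
bounded but need not be integrable with the weight; this is why the diagonal coefficients live in
the larger class. -/
lemma Sobolev.tail_multiplier (hf : Sobolev n r f) :
    Multiplier n (r + 1) (fun t => -∫ s in Ioi t, f s) := by
  have hi := hf.weightedL1.integrableOn
  have hd : ∀ t, 0 ≤ t → HasDerivWithinAt (fun t => -∫ s in Ioi t, f s) (f t) (Ici 0) t :=
    fun t ht => by simpa using (hasDerivAt_tail hf.weightedL1.1 hi ht).fun_neg
  refine ⟨⟨fun t ht => (hd t ht).continuousWithinAt, ∫ s in Ioi 0, ‖f s‖, fun t ht => ?_⟩,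
    fun t ht => (hd t ht).differentiableWithinAt,
    hf.congr fun t ht => (hd t ht).derivWithin (uniqueDiffOn_Ici 0 t ht)⟩
  rw [norm_neg]
  refine (norm_integral_le_integral_norm _).trans ?_
  exact setIntegral_mono_set hi.norm (ae_of_all _ fun _ => norm_nonneg _)
    (Ioi_subset_Ioi ht).eventuallyLE

end Classes

/-! ### The formal solution -/

lemma BoundaryData.sobolev {m n : ℕ} {g : Fin 3 → ℝ → ℝ} (hg : BoundaryData m n g) (j : Fin 3) :
    Sobolev n ((m + 5 - (j : ℕ)) / 3) (fun t => (g j t : ℂ)) := by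
  obtain ⟨h1, h2⟩ := hg j
  set p := (m + 5 - (j : ℕ)) / 3
  have hW : ∀ i ≤ p, WeightedL1 n (fun t => ((iteratedDerivWithin i (g j) (Ici 0) t : ℝ) : ℂ)) := by
    intro i hi
    refine ⟨Complex.continuous_ofReal.comp_continuousOn
      (h1.continuousOn_iteratedDerivWithin (by exact_mod_cast hi) (uniqueDiffOn_Ici 0)), ?_⟩
    refine ((h2 i hi).mono_set Ioi_subset_Ici_self).norm.congr ?_
    refine (ae_restrict_iff' measurableSet_Ioi).2 (ae_of_all _ fun s hs => ?_)
    have hs' : 0 < s := hs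
    simp only [norm_mul, norm_pow, Complex.norm_real]
    rw [Real.norm_of_nonneg (by linarith : 0 ≤ 1 + s)]
  -- Induction downwards from the top derivative: the derivative of order `p - r` still has `r`
  -- derivatives in the class.
  have key : ∀ r ≤ p, Sobolev n r
      (fun t => ((iteratedDerivWithin (p - r) (g j) (Ici 0) t : ℝ) : ℂ)) := by
    intro r hr
    induction r with
    | zero => exact hW _ (Nat.sub_le _ _)
    | succ r ih =>
      have hd : ∀ t ∈ Ici (0:ℝ), HasDerivWithinAt
          (fun t => ((iteratedDerivWithin (p - (r + 1)) (g j) (Ici 0) t : ℝ) : ℂ))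
          ((iteratedDerivWithin (p - r) (g j) (Ici 0) t : ℝ) : ℂ) (Ici 0) t := by
        intro t ht
        have hdiff := h1.differentiableOn_iteratedDerivWithin (m := p - (r + 1))
          (by exact_mod_cast (by omega : p - (r + 1) < p)) (uniqueDiffOn_Ici 0) t ht
        have h3 := hdiff.hasDerivWithinAt
        rw [← iteratedDerivWithin_succ, show p - (r + 1) + 1 = p - r by omega] at h3
        exact h3.ofReal_comp
      exact ⟨hW _ (Nat.sub_le _ _), fun t ht => (hd t ht).differentiableWithinAt,
        (ih (by omega)).congr fun t ht => (hd t ht).derivWithin (uniqueDiffOn_Ici 0 t ht)⟩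
  simpa using key p le_rfl

section Formal

variable (lam : ℝ) (g : Fin 3 → ℝ → ℝ) (m : ℕ)

/-- The off-diagonal part of order zero of `V`. -/
def pot (t : ℝ) : ℂ := g 2 t - 2 * lam * g 0 t ^ 3

/-- The coefficients `(o_{j-2}, d_{j-2})` of the second column of the truncated formal solution
`∑ k^{-l} (o_l, d_l)`. -/
def coef : ℕ → (ℝ → ℂ) × (ℝ → ℂ)
  | 0 => (fun _ => 0, fun _ => 0)
  | 1 => (fun _ => 0, fun _ => 0)
  | 2 => (fun _ => 0, fun _ => 1)
  -- At order `k^{2-j}` the `k³` term of the phase determines `o_{j+1}` algebraically. The second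
  -- equation is integrated for `d_{j+1}`, normalized to vanish at infinity. The cutoffs keep `o_l`
  -- for `l ≤ m + 3` and `d_l` for `l ≤ m`, enough to satisfy both equations down to order `k^{-m}`.
  | j + 3 =>
    let o : ℝ → ℂ := fun t => if j ≤ m + 2 then -(Complex.I / 8) *
      (-derivWithin (coef j).1 (Ici 0) t - 4 * (g 0 t * (coef (j + 2)).2 t)
        + 2 * Complex.I * (g 1 t * (coef (j + 1)).2 t)
        - 2 * Complex.I * lam * (g 0 t * (g 0 t * (coef (j + 1)).1 t))
        + pot lam g t * (coef j).2 t) else 0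
    (o, fun t => if j + 1 ≤ m then -∫ s in Ioi t,
      (Complex.I * lam / 2 * (g 0 s * (-derivWithin (coef (j + 2)).1 (Ici 0) s
        - 2 * Complex.I * lam * (g 0 s * (g 0 s * o s)) + pot lam g s * (coef (j + 2)).2 s))
      - lam / 4 * (g 1 s * (-derivWithin (coef (j + 1)).1 (Ici 0) s
        + 2 * Complex.I * (g 1 s * (coef (j + 2)).2 s)
        - 2 * Complex.I * lam * (g 0 s * (g 0 s * (coef (j + 2)).1 s))
        + pot lam g s * (coef (j + 1)).2 s))
      + lam * (pot lam g s * o s)) else 0)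

/-- Off-diagonal coefficients of the formal solution, shifted by two. -/
def oc (j : ℕ) : ℝ → ℂ := (coef lam g m j).1

/-- Diagonal coefficients of the formal solution, shifted by two. -/
def dc (j : ℕ) : ℝ → ℂ := (coef lam g m j).2

/-- The derivative of `dc (i + 2)`. -/
def diagRhs (i : ℕ) (s : ℝ) : ℂ :=
  Complex.I * lam / 2 * (g 0 s * (-derivWithin (oc lam g m (i + 1)) (Ici 0) s
    - 2 * Complex.I * lam * (g 0 s * (g 0 s * oc lam g m (i + 2) s))
    + pot lam g s * dc lam g m (i + 1) s))
  - lam / 4 * (g 1 s * (-derivWithin (oc lam g m i) (Ici 0) s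
    + 2 * Complex.I * (g 1 s * dc lam g m (i + 1) s)
    - 2 * Complex.I * lam * (g 0 s * (g 0 s * oc lam g m (i + 1) s))
    + pot lam g s * dc lam g m i s))
  + lam * (pot lam g s * oc lam g m (i + 2) s)

@[simp] lemma oc_zero : oc lam g m 0 = fun _ => 0 := by simp [oc, coef]

@[simp] lemma oc_one : oc lam g m 1 = fun _ => 0 := by simp [oc, coef]

@[simp] lemma oc_two : oc lam g m 2 = fun _ => 0 := by simp [oc, coef]

@[simp] lemma dc_zero : dc lam g m 0 = fun _ => 0 := by simp [dc, coef]

@[simp] lemma dc_one : dc lam g m 1 = fun _ => 0 := by simp [dc, coef]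

@[simp] lemma dc_two : dc lam g m 2 = fun _ => 1 := by simp [dc, coef]

variable {m} in
lemma oc_add_three {j : ℕ} (hj : j ≤ m + 2) : oc lam g m (j + 3) = fun t => -(Complex.I / 8) *
      (-derivWithin (oc lam g m j) (Ici 0) t - 4 * (g 0 t * dc lam g m (j + 2) t)
        + 2 * Complex.I * (g 1 t * dc lam g m (j + 1) t)
        - 2 * Complex.I * lam * (g 0 t * (g 0 t * oc lam g m (j + 1) t))
        + pot lam g t * dc lam g m j t) := by
  simp [oc, dc, coef, hj]

variable {m} in
lemma oc_add_three_of_lt {j : ℕ} (hj : m + 2 < j) : oc lam g m (j + 3) = fun _ => 0 := by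
  simp [oc, coef, not_le.2 hj]

variable {m} in
lemma dc_add_three {j : ℕ} (hj : j + 1 ≤ m) :
    dc lam g m (j + 3) = fun t => -∫ s in Ioi t, diagRhs lam g m (j + 1) s := by
  simp only [dc, coef, if_pos hj]
  rfl

variable {m} in
lemma dc_add_three_of_lt {j : ℕ} (hj : m < j + 1) : dc lam g m (j + 3) = fun _ => 0 := by
  simp [dc, coef, not_le.2 hj]

variable {lam g m} {n : ℕ}

lemma pot_sobolev (hg : BoundaryData m n g) : Sobolev n ((m + 3) / 3) (pot lam g) := by
  have h0 : Sobolev n ((m + 3) / 3) (fun t => (g 0 t : ℂ)) :=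
    (hg.sobolev 0).of_le (by simp; omega)
  have hM : Multiplier n ((m + 3) / 3) (fun t => (g 0 t : ℂ)) := h0.multiplier (by omega) le_rfl
  have h2 : Sobolev n ((m + 3) / 3) (fun t => (g 2 t : ℂ)) := hg.sobolev 2
  refine (h2.sub ((hM.mul (hM.mul h0)).const_mul (2 * lam))).congr fun t _ => ?_
  simp only [pot]
  ring

/-- `oc (j + 3)` contains one derivative of `oc j`, so an index step costs a third of a derivative.
The functions `g_0`, `g_1` and `g_2` first enter linearly at the indices 3, 4 and 5, which matches
the decreasing regularity `(m + 5 - j) / 3` assumed of them. -/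
lemma oc_step_sobolev (hg : BoundaryData m n g) {j : ℕ} (hj : j ≤ m + 2)
    (h0 : Sobolev n ((m + 8 - j) / 3) (oc lam g m j))
    (h1 : Sobolev n ((m + 7 - j) / 3) (oc lam g m (j + 1)))
    (d0 : Multiplier n ((m + 7 - j) / 3) (dc lam g m j))
    (d1 : Multiplier n ((m + 6 - j) / 3) (dc lam g m (j + 1)))
    (d2 : Multiplier n ((m + 5 - j) / 3) (dc lam g m (j + 2))) :
    Sobolev n ((m + 5 - j) / 3) (oc lam g m (j + 3)) := by
  set r := (m + 5 - j) / 3 with hr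
  have e0 : (m + 8 - j) / 3 = r + 1 := by omega
  rw [e0] at h0
  have hg0 : Sobolev n r (fun t => (g 0 t : ℂ)) := (hg.sobolev 0).of_le (by simp; omega)
  have hM0 : Multiplier n r (fun t => (g 0 t : ℂ)) :=
    (hg.sobolev 0).multiplier (by simp; omega) (by simp; omega)
  have a1 : Sobolev n r (fun t => g 0 t * dc lam g m (j + 2) t) :=
    (d2.mul hg0).congr fun t _ => mul_comm _ _
  have a2 : Sobolev n r (fun t => g 1 t * dc lam g m (j + 1) t) := by
    rcases Nat.eq_zero_or_pos j with rfl | hj0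
    · simpa using sobolev_zero
    · have hg1 : Sobolev n r (fun t => (g 1 t : ℂ)) := (hg.sobolev 1).of_le (by simp; omega)
      exact ((d1.of_le (by omega)).mul hg1).congr fun t _ => mul_comm _ _
  have a3 : Sobolev n r (fun t => g 0 t * (g 0 t * oc lam g m (j + 1) t)) :=
    hM0.mul (hM0.mul (h1.of_le (by omega)))
  have a4 : Sobolev n r (fun t => pot lam g t * dc lam g m j t) := by
    match j, hr, d0 with
    | 0, _, _ => simpa using sobolev_zero
    | 1, _, _ => simpa using sobolev_zero
    | j + 2, hr, d0 =>
      exact ((d0.of_le (by omega)).mul ((pot_sobolev hg).of_le (by omega))).congr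
        fun t _ => mul_comm _ _
  rw [oc_add_three lam g hj]
  exact ((((h0.2.2.neg.sub (a1.const_mul 4)).add (a2.const_mul (2 * Complex.I))).sub
    (a3.const_mul (2 * Complex.I * lam))).add a4).const_mul _

/-- The derivatives inside `diagRhs` fall on off-diagonal coefficients of lower index, which have at
least `s + 1` derivatives; the integrand therefore has `s`, and the tail integral adds one. -/
lemma dc_step_multiplier (hg : BoundaryData m n g) {j : ℕ} (hj : j + 1 ≤ m)
    (h1 : Sobolev n ((m + 7 - j) / 3) (oc lam g m (j + 1)))
    (h2 : Sobolev n ((m + 6 - j) / 3) (oc lam g m (j + 2)))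
    (h3 : Sobolev n ((m + 5 - j) / 3) (oc lam g m (j + 3)))
    (d1 : Multiplier n ((m + 6 - j) / 3) (dc lam g m (j + 1)))
    (d2 : Multiplier n ((m + 5 - j) / 3) (dc lam g m (j + 2))) :
    Multiplier n ((m + 4 - j) / 3) (dc lam g m (j + 3)) := by
  obtain ⟨s, hs⟩ : ∃ s, s = (m + 1 - j) / 3 := ⟨_, rfl⟩
  have e1 : (m + 4 - j) / 3 = s + 1 := by omega
  have h1' := (h1.of_le (s := s + 1) (by omega)).2.2
  have h2' := (h2.of_le (s := s + 1) (by omega)).2.2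
  have hM0 : Multiplier n s (fun t => (g 0 t : ℂ)) :=
    (hg.sobolev 0).multiplier (by simp; omega) (by simp; omega)
  have hg1 : Sobolev n s (fun t => (g 1 t : ℂ)) := (hg.sobolev 1).of_le (by simp; omega)
  have hM1 : Multiplier n s (fun t => (g 1 t : ℂ)) :=
    (hg.sobolev 1).multiplier (by simp; omega) (by simp; omega)
  have hp : Sobolev n s (pot lam g) := (pot_sobolev hg).of_le (by omega)
  have hMp : Multiplier n s (pot lam g) := (pot_sobolev hg).multiplier (by omega) (by omega)
  have d1' := d1.of_le (s := s) (by omega)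
  have d2' := d2.of_le (s := s) (by omega)
  have h2s := h2.of_le (s := s) (by omega)
  have h3s := h3.of_le (s := s) (by omega)
  have b1 : Sobolev n s (fun t => pot lam g t * dc lam g m (j + 2) t) :=
    (d2'.mul hp).congr fun t _ => mul_comm _ _
  have b2 : Sobolev n s (fun t => g 1 t * dc lam g m (j + 2) t) :=
    (d2'.mul hg1).congr fun t _ => mul_comm _ _
  have b3 : Sobolev n s (fun t => pot lam g t * dc lam g m (j + 1) t) :=
    (d1'.mul hp).congr fun t _ => mul_comm _ _
  rw [dc_add_three lam g hj, e1]
  refine Sobolev.tail_multiplier ?_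
  exact (((hM0.mul ((h2'.neg.sub ((hM0.mul (hM0.mul h3s)).const_mul (2 * Complex.I * lam))).add
    b1)).const_mul _).sub ((hM1.mul (((h1'.neg.add (b2.const_mul (2 * Complex.I))).sub
      ((hM0.mul (hM0.mul h2s)).const_mul (2 * Complex.I * lam))).add b3)).const_mul _)).add
      ((hMp.mul h3s).const_mul _)

lemma coef_regularity (hg : BoundaryData m n g) (j : ℕ) :
    Sobolev n ((m + 8 - j) / 3) (oc lam g m j) ∧
      Multiplier n ((m + 7 - j) / 3) (dc lam g m j) := by
  induction j using Nat.strong_induction_on with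
  | _ j ih =>
    match j, ih with
    | 0, _ => simpa using ⟨sobolev_zero, multiplier_const 0⟩
    | 1, _ => simpa using ⟨sobolev_zero, multiplier_const 0⟩
    | 2, _ => simpa using ⟨sobolev_zero, multiplier_const 1⟩
    | j + 3, ih =>
      obtain ⟨o0, d0⟩ := ih j (by omega)
      obtain ⟨o1, d1⟩ := ih (j + 1) (by omega)
      obtain ⟨o2, d2⟩ := ih (j + 2) (by omega)
      rw [show m + 8 - (j + 1) = m + 7 - j by omega] at o1
      rw [show m + 8 - (j + 2) = m + 6 - j by omega] at o2
      rw [show m + 7 - (j + 1) = m + 6 - j by omega] at d1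
      rw [show m + 7 - (j + 2) = m + 5 - j by omega] at d2
      rw [show m + 8 - (j + 3) = m + 5 - j by omega, show m + 7 - (j + 3) = m + 4 - j by omega]
      have o3 : Sobolev n ((m + 5 - j) / 3) (oc lam g m (j + 3)) := by
        by_cases hj : j ≤ m + 2
        · exact oc_step_sobolev hg hj o0 o1 d0 d1 d2
        · rw [oc_add_three_of_lt lam g (not_le.1 hj)]
          exact sobolev_zero
      refine ⟨o3, ?_⟩
      by_cases hj : j + 1 ≤ m
      · exact dc_step_multiplier hg hj o1 o2 o3 d1 d2
      · rw [dc_add_three_of_lt lam g (not_le.1 hj)]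
        exact multiplier_const 0

lemma oc_eq_zero {j : ℕ} (hj : m + 6 ≤ j) : oc lam g m j = fun _ => 0 := by
  obtain ⟨i, rfl⟩ := Nat.exists_eq_add_of_le' (show 3 ≤ j by omega)
  exact oc_add_three_of_lt lam g (by omega)

lemma dc_eq_zero {j : ℕ} (hj : m + 3 ≤ j) : dc lam g m j = fun _ => 0 := by
  obtain ⟨i, rfl⟩ := Nat.exists_eq_add_of_le' (show 3 ≤ j by omega)
  exact dc_add_three_of_lt lam g (by omega)

/-- At the last index, `(m + 8 - (m + 5)) / 3 = 1`: exactly one derivative is left, and the residual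
beyond the truncation needs it. -/
lemma oc_sobolev (hg : BoundaryData m n g) (j : ℕ) : Sobolev n 1 (oc lam g m j) := by
  by_cases hj : j ≤ m + 5
  · exact (coef_regularity hg j).1.of_le (by omega)
  · rw [oc_eq_zero (by omega)]
    exact sobolev_zero

lemma dc_multiplier (hg : BoundaryData m n g) (j : ℕ) : Multiplier n 1 (dc lam g m j) := by
  by_cases hj : j ≤ m + 4
  · exact (coef_regularity hg j).2.of_le (by omega)
  · rw [dc_eq_zero (by omega)]
    exact multiplier_const 0

/-! ### Residuals of the formal solution -/

/-- Residual of the first component of the truncated formal solution at order `k^{2 - j}`. -/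
def offRes (lam : ℝ) (g : Fin 3 → ℝ → ℝ) (m j : ℕ) (t : ℝ) : ℂ :=
  -8 * Complex.I * oc lam g m (j + 3) t - 4 * (g 0 t * dc lam g m (j + 2) t)
    + 2 * Complex.I * (g 1 t * dc lam g m (j + 1) t)
    - 2 * Complex.I * lam * (g 0 t * (g 0 t * oc lam g m (j + 1) t))
    + pot lam g t * dc lam g m j t - derivWithin (oc lam g m j) (Ici 0) t

/-- Residual of the second component of the truncated formal solution at order `k^{2 - j}`. -/
def diagRes (lam : ℝ) (g : Fin 3 → ℝ → ℝ) (m j : ℕ) (t : ℝ) : ℂ :=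
  -4 * lam * (g 0 t * oc lam g m (j + 2) t) - 2 * Complex.I * lam * (g 1 t * oc lam g m (j + 1) t)
    + 2 * Complex.I * lam * (g 0 t * (g 0 t * dc lam g m (j + 1) t))
    + lam * (pot lam g t * oc lam g m j t) - derivWithin (dc lam g m j) (Ici 0) t

lemma offRes_weightedL1 (hg : BoundaryData m n g) (j : ℕ) : WeightedL1 n (offRes lam g m j) := by
  have hg0 : WeightedL1 n (fun t => (g 0 t : ℂ)) := (hg.sobolev 0).weightedL1
  have hg1 : WeightedL1 n (fun t => (g 1 t : ℂ)) := (hg.sobolev 1).weightedL1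
  have hM0 : IsBdd (fun t => (g 0 t : ℂ)) :=
    ((hg.sobolev 0).multiplier (s := 0) (by simp; omega) (by omega)).isBdd
  have hp := (pot_sobolev (lam := lam) hg).weightedL1
  have hd : ∀ j, IsBdd (dc lam g m j) := fun j => (dc_multiplier hg j).isBdd
  have ho : ∀ j, WeightedL1 n (oc lam g m j) := fun j => (oc_sobolev hg j).weightedL1
  refine ((((((ho (j + 3)).const_mul (-8 * Complex.I)).sub
    (((hd (j + 2)).mul_weightedL1 hg0).const_mul 4)).add
    (((hd (j + 1)).mul_weightedL1 hg1).const_mul (2 * Complex.I))).sub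
    ((hM0.mul_weightedL1 (hM0.mul_weightedL1 (ho (j + 1)))).const_mul (2 * Complex.I * lam))).add
    ((hd j).mul_weightedL1 hp)).sub (oc_sobolev (lam := lam) hg j).2.2 |>.congr fun t _ => ?_
  simp only [offRes]
  ring

lemma diagRes_weightedL1 (hg : BoundaryData m n g) (j : ℕ) : WeightedL1 n (diagRes lam g m j) := by
  have hg0 : WeightedL1 n (fun t => (g 0 t : ℂ)) := (hg.sobolev 0).weightedL1
  have hM0 : IsBdd (fun t => (g 0 t : ℂ)) :=
    ((hg.sobolev 0).multiplier (s := 0) (by simp; omega) (by omega)).isBdd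
  have hM1 : IsBdd (fun t => (g 1 t : ℂ)) :=
    ((hg.sobolev 1).multiplier (s := 0) (by simp; omega) (by omega)).isBdd
  have hp := ((pot_sobolev (lam := lam) hg).multiplier (s := 0) (by omega) (by omega)).isBdd
  have hd : ∀ j, IsBdd (dc lam g m j) := fun j => (dc_multiplier hg j).isBdd
  have ho : ∀ j, WeightedL1 n (oc lam g m j) := fun j => (oc_sobolev hg j).weightedL1
  refine ((((((hM0.mul_weightedL1 (ho (j + 2))).const_mul (-4 * lam)).sub
    ((hM1.mul_weightedL1 (ho (j + 1))).const_mul (2 * Complex.I * lam))).add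
    ((hM0.mul_weightedL1 ((hd (j + 1)).mul_weightedL1 hg0)).const_mul (2 * Complex.I * lam))).add
    ((hp.mul_weightedL1 (ho j)).const_mul lam)).sub
    (dc_multiplier (lam := lam) hg j).2.2 |>.congr fun t _ => ?_)
  simp only [diagRes]
  ring

lemma offRes_eq_zero {j : ℕ} (hj : j ≤ m + 2) (t : ℝ) : offRes lam g m j t = 0 := by
  rw [offRes, oc_add_three lam g hj]
  linear_combination ((-derivWithin (oc lam g m j) (Ici 0) t - 4 * (g 0 t * dc lam g m (j + 2) t)
        + 2 * Complex.I * (g 1 t * dc lam g m (j + 1) t)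
        - 2 * Complex.I * lam * (g 0 t * (g 0 t * oc lam g m (j + 1) t))
        + pot lam g t * dc lam g m j t)) * Complex.I_mul_I

lemma diagRhs_weightedL1 (hg : BoundaryData m n g) {j : ℕ} (hj : j + 1 ≤ m) :
    WeightedL1 n (diagRhs lam g m (j + 1)) := by
  have hM0 : IsBdd (fun t => (g 0 t : ℂ)) :=
    ((hg.sobolev 0).multiplier (s := 0) (by simp; omega) (by omega)).isBdd
  have hM1 : IsBdd (fun t => (g 1 t : ℂ)) :=
    ((hg.sobolev 1).multiplier (s := 0) (by simp; omega) (by omega)).isBdd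
  have hg1 : WeightedL1 n (fun t => (g 1 t : ℂ)) := (hg.sobolev 1).weightedL1
  have hp := (pot_sobolev (lam := lam) hg).weightedL1
  have hpM := ((pot_sobolev (lam := lam) hg).multiplier (s := 0) (by omega) (by omega)).isBdd
  have hd : ∀ j, IsBdd (dc lam g m j) := fun j => (dc_multiplier hg j).isBdd
  have ho : ∀ j, WeightedL1 n (oc lam g m j) := fun j => (oc_sobolev hg j).weightedL1
  have ho' : ∀ j, WeightedL1 n (derivWithin (oc lam g m j) (Ici 0)) := fun j =>
    (oc_sobolev hg j).2.2
  refine (((hM0.mul_weightedL1 (((ho' (j + 2)).neg.sub ((hM0.mul_weightedL1 (hM0.mul_weightedL1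
    (ho (j + 3)))).const_mul (2 * Complex.I * lam))).add ((hd (j + 2)).mul_weightedL1
    hp))).const_mul (Complex.I * lam / 2)).sub ((hM1.mul_weightedL1 ((((ho' (j + 1)).neg.add
    (((hd (j + 2)).mul_weightedL1 hg1).const_mul (2 * Complex.I))).sub
    ((hM0.mul_weightedL1 (hM0.mul_weightedL1 (ho (j + 2)))).const_mul
    (2 * Complex.I * lam))).add ((hd (j + 1)).mul_weightedL1 hp))).const_mul (lam / 4))).add
    ((hpM.mul_weightedL1 (ho (j + 3))).const_mul lam) |>.congr fun t _ => ?_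
  simp only [diagRhs]
  ring

lemma derivWithin_dc (hg : BoundaryData m n g) {i : ℕ} (hi : i ≤ m) {t : ℝ} (ht : 0 ≤ t) :
    derivWithin (dc lam g m (i + 2)) (Ici 0) t = diagRhs lam g m i t := by
  match i, hi with
  | 0, _ => simp [diagRhs]
  | j + 1, hi =>
    have h := diagRhs_weightedL1 (lam := lam) hg hi
    rw [show j + 1 + 2 = j + 3 by omega, dc_add_three lam g hi]
    have h2 := (hasDerivAt_tail h.1 h.integrableOn ht).fun_neg
    rw [neg_neg] at h2
    exact h2.derivWithin (uniqueDiffOn_Ici 0 t ht)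

/-- After substitution of the recursion for the off-diagonal coefficients, the terms `g_0²` times
`dc (j + 1)` and `g_0 g_1` times `dc j` cancel, and what is left is `diagRhs`. This cancellation
makes the recursion triangular: the derivative of a diagonal coefficient involves only diagonal
coefficients of lower index. -/
lemma diagRes_eq_zero (hg : BoundaryData m n g) {j : ℕ} (hj : j ≤ m + 2) {t : ℝ} (ht : 0 ≤ t) :
    diagRes lam g m j t = 0 := by
  match j, hj with
  | 0, _ => simp [diagRes]
  | 1, _ =>
    have h := oc_add_three lam g (m := m) (j := 0) (by omega)
    simp only [zero_add] at h
    simp only [diagRes, Nat.reduceAdd, h]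
    simp
    ring
  | i + 2, hj =>
    rw [diagRes, derivWithin_dc hg (by omega) ht, diagRhs,
      show i + 2 + 2 = (i + 1) + 3 by omega, show i + 2 + 1 = i + 3 by omega,
      oc_add_three lam g (m := m) (j := i + 1) (by omega),
      oc_add_three lam g (m := m) (j := i) (by omega), show i + 1 + 2 = i + 3 by omega,
      show i + 1 + 1 = i + 2 by omega]
    have hI : Complex.I ^ 3 = -Complex.I := Complex.I_pow_three
    ring_nf
    simp only [Complex.I_sq, hI]
    ring

lemma tendsto_dc {j : ℕ} (hj : 3 ≤ j) : Tendsto (dc lam g m j) atTop (𝓝 0) := by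
  obtain ⟨i, rfl⟩ := Nat.exists_eq_add_of_le' hj
  by_cases h : i + 1 ≤ m
  · rw [dc_add_three lam g h]
    simpa using (tendsto_tail (diagRhs lam g m (i + 1))).neg
  · rw [dc_add_three_of_lt lam g (not_le.1 h)]
    exact tendsto_const_nhds

end Formal

/-! ### The two columns of the Volterra equation -/

section Columns

variable {lam : ℝ} {g : Fin 3 → ℝ → ℝ}

lemma conj_ofNat_complex (n : ℕ) [n.AtLeastTwo] :
    conj (ofNat(n) : ℂ) = ofNat(n) := map_ofNat _ n

lemma V_zero_zero (t : ℝ) (k : ℂ) :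
    V lam g t k 0 0 = -2 * Complex.I * lam * k * (g 0 t * g 0 t) := by
  simp only [V, Matrix.of_apply, Matrix.cons_val', Matrix.cons_val_zero, Matrix.cons_val_fin_one]
  ring

lemma V_one_one (t : ℝ) (k : ℂ) : V lam g t k 1 1 = -V lam g t k 0 0 := by
  simp [V]

lemma V_zero_one (t : ℝ) (k : ℂ) :
    V lam g t k 0 1 = -4 * k ^ 2 * g 0 t + 2 * Complex.I * k * g 1 t + pot lam g t := by
  simp [V, pot]; ring

/-- `λ² = 1` turns `-2 g_0³` into `λ` times the cubic term of `pot`, so that one function `pot`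
serves both off-diagonal entries. -/
lemma V_one_zero (hlam : lam ^ 2 = 1) (t : ℝ) (k : ℂ) :
    V lam g t k 1 0 = -4 * lam * k ^ 2 * g 0 t - 2 * Complex.I * lam * k * g 1 t
      + lam * pot lam g t := by
  have h : (lam : ℂ) ^ 2 = 1 := by exact_mod_cast hlam
  simp only [V, pot, Matrix.of_apply, Matrix.cons_val', Matrix.cons_val_zero, Matrix.cons_val_one,
    Matrix.cons_val_fin_one]
  linear_combination (2 * (g 0 t : ℂ) ^ 3) * h

lemma conj_V_zero_zero (t : ℝ) (k : ℂ) :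
    conj (V lam g t k 0 0) = V lam g t (conj k) 1 1 := by
  simp [V, conj_ofNat_complex]

lemma conj_V_one_one (t : ℝ) (k : ℂ) :
    conj (V lam g t k 1 1) = V lam g t (conj k) 0 0 := by
  simp [V, conj_ofNat_complex]

lemma conj_V_zero_one (hlam : lam ^ 2 = 1) (t : ℝ) (k : ℂ) :
    conj (V lam g t k 0 1) = lam * V lam g t (conj k) 1 0 := by
  have h : (lam : ℂ) ^ 2 = 1 := by exact_mod_cast hlam
  rw [V_zero_one, V_one_zero hlam]
  simp [pot, conj_ofNat_complex]
  linear_combination (4 * (conj k) ^ 2 * g 0 t + 2 * Complex.I * conj k * g 1 t - g 2 t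
    + 2 * lam * (g 0 t : ℂ) ^ 3) * h

lemma conj_V_one_zero (hlam : lam ^ 2 = 1) (t : ℝ) (k : ℂ) :
    conj (V lam g t k 1 0) = lam * V lam g t (conj k) 0 1 := by
  rw [V_zero_one, V_one_zero hlam]
  simp [pot, conj_ofNat_complex]
  ring

lemma conj_V_neg_conj (t : ℝ) (k : ℂ) (i j : Fin 2) :
    conj (V lam g t (-conj k) i j) = V lam g t k i j := by
  fin_cases i <;> fin_cases j <;> simp [V, conj_ofNat_complex, sub_eq_add_neg]

/-- The Volterra equation for the second column `(u, v)`. -/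
def IsSecondColumn (lam : ℝ) (g : Fin 3 → ℝ → ℝ) (k : ℂ) (u v : ℝ → ℂ) : Prop :=
  ContinuousOn u (Ici 0) ∧ ContinuousOn v (Ici 0) ∧ ∀ t : ℝ, 0 ≤ t →
    (IntegrableOn (fun s : ℝ => Complex.exp (8 * Complex.I * k ^ 3 * (s - t)) *
        (V lam g s k 0 0 * u s + V lam g s k 0 1 * v s)) (Ioi t) ∧
      u t = -∫ s in Ioi t, Complex.exp (8 * Complex.I * k ^ 3 * (s - t)) *
        (V lam g s k 0 0 * u s + V lam g s k 0 1 * v s)) ∧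
    (IntegrableOn (fun s : ℝ => V lam g s k 1 0 * u s + V lam g s k 1 1 * v s) (Ioi t) ∧
      v t = 1 - ∫ s in Ioi t, (V lam g s k 1 0 * u s + V lam g s k 1 1 * v s))

/-- The Volterra equation for the first column `(p, r)`. -/
def IsFirstColumn (lam : ℝ) (g : Fin 3 → ℝ → ℝ) (k : ℂ) (p r : ℝ → ℂ) : Prop :=
  ContinuousOn p (Ici 0) ∧ ContinuousOn r (Ici 0) ∧ ∀ t : ℝ, 0 ≤ t →
    (IntegrableOn (fun s : ℝ => V lam g s k 0 0 * p s + V lam g s k 0 1 * r s) (Ioi t) ∧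
      p t = 1 - ∫ s in Ioi t, (V lam g s k 0 0 * p s + V lam g s k 0 1 * r s)) ∧
    (IntegrableOn (fun s : ℝ => Complex.exp (-(8 * Complex.I * k ^ 3 * (s - t))) *
        (V lam g s k 1 0 * p s + V lam g s k 1 1 * r s)) (Ioi t) ∧
      r t = -∫ s in Ioi t, Complex.exp (-(8 * Complex.I * k ^ 3 * (s - t))) *
        (V lam g s k 1 0 * p s + V lam g s k 1 1 * r s))

/-- Conjugation by `e^{sσ₃}` cancels on the diagonal and doubles the exponent off it; hence in each
column one entry has the phase `±8ik³` and the other has none. -/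
lemma isVolterraSolution_iff {T : ℝ → ℂ → Matrix (Fin 2) (Fin 2) ℂ} :
    IsVolterraSolution lam g T ↔
      (∀ k ∈ closure Dminus, IsFirstColumn lam g k (fun t => T t k 0 0) (fun t => T t k 1 0)) ∧
      ∀ k ∈ closure Dplus, IsSecondColumn lam g k (fun t => T t k 0 1) (fun t => T t k 1 1) := by
  have e : ∀ (z : ℂ) (M : Matrix (Fin 2) (Fin 2) ℂ) (a b : Fin 2), expHatσ₃ z M a b =
      ![Complex.exp z, Complex.exp (-z)] a * M a b * ![Complex.exp (-z), Complex.exp z] b :=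
    fun z M a b => by simp only [expHatσ₃, Matrix.mul_diagonal, Matrix.diagonal_mul]
  have e00 : ∀ (s t : ℝ) (k : ℂ), expHatσ₃ (4 * Complex.I * k ^ 3 * (s - t)) (V lam g s k * T s k)
      0 0 = V lam g s k 0 0 * T s k 0 0 + V lam g s k 0 1 * T s k 1 0 := fun s t k => by
    rw [e, Matrix.mul_apply, Fin.sum_univ_two]
    simp only [Matrix.cons_val_zero]
    rw [mul_comm (Complex.exp _), mul_assoc, ← Complex.exp_add]
    simp
  have e11 : ∀ (s t : ℝ) (k : ℂ), expHatσ₃ (4 * Complex.I * k ^ 3 * (s - t)) (V lam g s k * T s k)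
      1 1 = V lam g s k 1 0 * T s k 0 1 + V lam g s k 1 1 * T s k 1 1 := fun s t k => by
    rw [e, Matrix.mul_apply, Fin.sum_univ_two]
    simp only [Matrix.cons_val_one, Matrix.cons_val_fin_one]
    rw [mul_comm (Complex.exp _), mul_assoc, ← Complex.exp_add]
    simp
  have e01 : ∀ (s t : ℝ) (k : ℂ), expHatσ₃ (4 * Complex.I * k ^ 3 * (s - t)) (V lam g s k * T s k)
      0 1 = Complex.exp (8 * Complex.I * k ^ 3 * (s - t)) *
        (V lam g s k 0 0 * T s k 0 1 + V lam g s k 0 1 * T s k 1 1) := fun s t k => by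
    rw [e, Matrix.mul_apply, Fin.sum_univ_two]
    simp only [Matrix.cons_val_zero, Matrix.cons_val_one, Matrix.cons_val_fin_one]
    rw [mul_right_comm, ← Complex.exp_add]
    congr 2
    ring
  have e10 : ∀ (s t : ℝ) (k : ℂ), expHatσ₃ (4 * Complex.I * k ^ 3 * (s - t)) (V lam g s k * T s k)
      1 0 = Complex.exp (-(8 * Complex.I * k ^ 3 * (s - t))) *
        (V lam g s k 1 0 * T s k 0 0 + V lam g s k 1 1 * T s k 1 0) := fun s t k => by
    rw [e, Matrix.mul_apply, Fin.sum_univ_two]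
    simp only [Matrix.cons_val_zero, Matrix.cons_val_one, Matrix.cons_val_fin_one]
    rw [mul_right_comm, ← Complex.exp_add]
    congr 2
    ring
  simp only [IsVolterraSolution, Fin.forall_fin_two, columnDomain, Matrix.cons_val_zero,
    Matrix.cons_val_one, Matrix.cons_val_fin_one, e00, e01, e10, e11, Matrix.one_apply_eq,
    IsFirstColumn, IsSecondColumn]
  have o01 : (1 : Matrix (Fin 2) (Fin 2) ℂ) 0 1 = 0 := by simp
  have o10 : (1 : Matrix (Fin 2) (Fin 2) ℂ) 1 0 = 0 := by simp
  simp only [o01, o10, zero_sub]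
  refine and_congr (forall₂_congr fun k _ => ?_) (forall₂_congr fun k _ => ?_)
  · exact ⟨fun ⟨⟨a, b⟩, c, d⟩ => ⟨a, c, fun t ht => ⟨b t ht, d t ht⟩⟩,
      fun ⟨a, c, h⟩ => ⟨⟨a, fun t ht => (h t ht).1⟩, c, fun t ht => (h t ht).2⟩⟩
  · exact ⟨fun ⟨⟨a, b⟩, c, d⟩ => ⟨a, c, fun t ht => ⟨b t ht, d t ht⟩⟩,
      fun ⟨a, c, h⟩ => ⟨⟨a, fun t ht => (h t ht).1⟩, c, fun t ht => (h t ht).2⟩⟩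

lemma integrableOn_conj {f : ℝ → ℂ} {s : Set ℝ} (h : IntegrableOn f s) :
    IntegrableOn (fun x => conj (f x)) s :=
  (Complex.conjCLE : ℂ →L[ℝ] ℂ).integrable_comp h

/-- A second column at `k` gives a first column at `k̄`. -/
lemma IsSecondColumn.isFirstColumn (hlam : lam ^ 2 = 1) {k : ℂ} {u v : ℝ → ℂ}
    (h : IsSecondColumn lam g k u v) :
    IsFirstColumn lam g (conj k) (fun t => conj (v t)) (fun t => lam * conj (u t)) := by
  have hl : (lam : ℂ) ^ 2 = 1 := by exact_mod_cast hlam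
  obtain ⟨hu, hv, h⟩ := h
  refine ⟨Complex.continuous_conj.comp_continuousOn hv,
    continuousOn_const.mul (Complex.continuous_conj.comp_continuousOn hu), fun t ht => ?_⟩
  obtain ⟨⟨h1, h2⟩, h3, h4⟩ := h t ht
  have e1 : ∀ s : ℝ, V lam g s (conj k) 0 0 * conj (v s) + V lam g s (conj k) 0 1 *
      (lam * conj (u s)) = conj (V lam g s k 1 0 * u s + V lam g s k 1 1 * v s) := fun s => by
    rw [map_add, map_mul, map_mul, conj_V_one_one, conj_V_one_zero hlam]
    ring
  have e2 : ∀ s : ℝ, Complex.exp (-(8 * Complex.I * (conj k) ^ 3 * (s - t))) *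
      (V lam g s (conj k) 1 0 * conj (v s) + V lam g s (conj k) 1 1 * (lam * conj (u s))) =
      lam * conj (Complex.exp (8 * Complex.I * k ^ 3 * (s - t)) *
        (V lam g s k 0 0 * u s + V lam g s k 0 1 * v s)) := fun s => by
    rw [map_mul, map_add, map_mul, map_mul, conj_V_zero_zero, conj_V_zero_one hlam,
      ← Complex.exp_conj]
    have : conj (8 * Complex.I * k ^ 3 * ((s : ℂ) - t)) =
        -(8 * Complex.I * (conj k) ^ 3 * (s - t)) := by
      simp [conj_ofNat_complex]
    rw [this]
    linear_combination (-Complex.exp (-(8 * Complex.I * (conj k) ^ 3 * (s - t))) *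
      V lam g s (conj k) 1 0 * conj (v s)) * hl
  simp only [e1, e2]
  refine ⟨⟨integrableOn_conj h3, ?_⟩, (integrableOn_conj h1).const_mul _, ?_⟩
  · rw [integral_conj, h4]
    simp
  · rw [integral_const_mul, integral_conj]
    conv_lhs => rw [h2]
    simp

/-- A first column at `k` gives a second column at `k̄`. -/
lemma IsFirstColumn.isSecondColumn (hlam : lam ^ 2 = 1) {k : ℂ} {p r : ℝ → ℂ}
    (h : IsFirstColumn lam g k p r) :
    IsSecondColumn lam g (conj k) (fun t => lam * conj (r t)) (fun t => conj (p t)) := by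
  have hl : (lam : ℂ) ^ 2 = 1 := by exact_mod_cast hlam
  obtain ⟨hp, hr, h⟩ := h
  refine ⟨continuousOn_const.mul (Complex.continuous_conj.comp_continuousOn hr),
    Complex.continuous_conj.comp_continuousOn hp, fun t ht => ?_⟩
  obtain ⟨⟨h1, h2⟩, h3, h4⟩ := h t ht
  have e1 : ∀ s : ℝ, V lam g s (conj k) 1 0 * (lam * conj (r s)) + V lam g s (conj k) 1 1 *
      conj (p s) = conj (V lam g s k 0 0 * p s + V lam g s k 0 1 * r s) := fun s => by
    rw [map_add, map_mul, map_mul, conj_V_zero_zero, conj_V_zero_one hlam]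
    ring
  have e2 : ∀ s : ℝ, Complex.exp (8 * Complex.I * (conj k) ^ 3 * (s - t)) *
      (V lam g s (conj k) 0 0 * (lam * conj (r s)) + V lam g s (conj k) 0 1 * conj (p s)) =
      lam * conj (Complex.exp (-(8 * Complex.I * k ^ 3 * (s - t))) *
        (V lam g s k 1 0 * p s + V lam g s k 1 1 * r s)) := fun s => by
    rw [map_mul, map_add, map_mul, map_mul, conj_V_one_one, conj_V_one_zero hlam,
      ← Complex.exp_conj]
    have : conj (-(8 * Complex.I * k ^ 3 * ((s : ℂ) - t))) =
        8 * Complex.I * (conj k) ^ 3 * (s - t) := by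
      simp [conj_ofNat_complex]
    rw [this]
    linear_combination (-Complex.exp (8 * Complex.I * (conj k) ^ 3 * (s - t)) *
      V lam g s (conj k) 0 1 * conj (p s)) * hl
  simp only [e1, e2]
  refine ⟨⟨(integrableOn_conj h3).const_mul _, ?_⟩, integrableOn_conj h1, ?_⟩
  · rw [integral_const_mul, integral_conj]
    conv_lhs => rw [h4]
    simp
  · rw [integral_conj, h2]
    simp

/-- The symmetry `k ↦ -k̄`. -/
lemma IsSecondColumn.neg_conj {k : ℂ} {u v : ℝ → ℂ} (h : IsSecondColumn lam g (-conj k) u v) :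
    IsSecondColumn lam g k (fun t => conj (u t)) (fun t => conj (v t)) := by
  obtain ⟨hu, hv, h⟩ := h
  refine ⟨Complex.continuous_conj.comp_continuousOn hu,
    Complex.continuous_conj.comp_continuousOn hv, fun t ht => ?_⟩
  obtain ⟨⟨h1, h2⟩, h3, h4⟩ := h t ht
  have e1 : ∀ s : ℝ, V lam g s k 1 0 * conj (u s) + V lam g s k 1 1 * conj (v s) =
      conj (V lam g s (-conj k) 1 0 * u s + V lam g s (-conj k) 1 1 * v s) := fun s => by
    simp only [map_add, map_mul, conj_V_neg_conj]
  have e2 : ∀ s : ℝ, Complex.exp (8 * Complex.I * k ^ 3 * (s - t)) *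
      (V lam g s k 0 0 * conj (u s) + V lam g s k 0 1 * conj (v s)) =
      conj (Complex.exp (8 * Complex.I * (-conj k) ^ 3 * (s - t)) *
        (V lam g s (-conj k) 0 0 * u s + V lam g s (-conj k) 0 1 * v s)) := fun s => by
    rw [map_mul, ← Complex.exp_conj]
    simp only [map_add, map_mul, conj_V_neg_conj]
    congr 2
    simp [conj_ofNat_complex]
    ring
  simp only [e1, e2]
  refine ⟨⟨integrableOn_conj h1, ?_⟩, integrableOn_conj h3, ?_⟩
  · rw [integral_conj]
    conv_lhs => rw [h2]
    simp
  · rw [integral_conj, h4]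
    simp

end Columns

/-! ### Uniqueness for the Volterra system -/

lemma integrableOn_mul_of_bdd {p φ : ℝ → ℝ} (hp : ContinuousOn p (Ici 0))
    (hi : IntegrableOn p (Ioi 0)) (hφ : ContinuousOn φ (Ici 0)) {C : ℝ}
    (hC : ∀ t, 0 ≤ t → |φ t| ≤ C) {t : ℝ} (ht : 0 ≤ t) :
    IntegrableOn (fun s => p s * φ s) (Ioi t) := by
  refine IntegrableOn.tail ?_ ht
  refine Integrable.mono' (hi.norm.mul_const C) ?_ ?_
  · exact ((hp.mul hφ).mono Ioi_subset_Ici_self).aestronglyMeasurable measurableSet_Ioi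
  · refine (ae_restrict_iff' measurableSet_Ioi).2 (ae_of_all _ fun s hs => ?_)
    rw [norm_mul]
    exact mul_le_mul_of_nonneg_left (hC s (le_of_lt hs)) (norm_nonneg _)

/-- The homogeneous Volterra system only has the trivial solution. -/
lemma volterra_system_eq_zero {z : ℂ} (hz : z ∈ upperHalf) {q : Fin 2 → Fin 2 → ℝ → ℂ}
    (hq : ∀ i j, WeightedL1 0 (q i j)) {U W : ℝ → ℂ} (hU : ContinuousOn U (Ici 0))
    (hW : ContinuousOn W (Ici 0))
    (hiU : IntegrableOn (fun s : ℝ => Complex.exp (Complex.I * z * s) *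
      (q 0 0 s * U s + q 0 1 s * W s)) (Ioi 0))
    (heU : ∀ t : ℝ, 0 ≤ t → Complex.exp (Complex.I * z * t) * U t = -∫ s : ℝ in Ioi t,
      Complex.exp (Complex.I * z * s) * (q 0 0 s * U s + q 0 1 s * W s))
    (hiW : IntegrableOn (fun s : ℝ => q 1 0 s * U s + q 1 1 s * W s) (Ioi 0))
    (heW : ∀ t, 0 ≤ t → W t = -∫ s in Ioi t, (q 1 0 s * U s + q 1 1 s * W s)) :
    ∀ t, 0 ≤ t → U t = 0 ∧ W t = 0 := by
  set p : ℝ → ℝ := fun s => ∑ i, ∑ j, ‖q i j s‖ with hp_def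
  have hp : ContinuousOn p (Ici 0) :=
    continuousOn_finsetSum _ fun i _ => continuousOn_finsetSum _ fun j _ => (hq i j).1.norm
  have hi : IntegrableOn p (Ioi 0) :=
    integrable_finsetSum _ fun i _ => integrable_finsetSum _ fun j _ =>
      (hq i j).integrableOn.norm
  have hqp : ∀ i j t, ‖q i j t‖ ≤ p t := fun i j t =>
    (Finset.single_le_sum (f := fun j => ‖q i j t‖) (fun _ _ => norm_nonneg _)
      (Finset.mem_univ j)).trans
      (Finset.single_le_sum (f := fun i => ∑ j, ‖q i j t‖)
        (fun _ _ => Finset.sum_nonneg fun _ _ => norm_nonneg _) (Finset.mem_univ i))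
  have h0 : ∀ t, 0 ≤ t → 0 ≤ p t := fun t ht => (norm_nonneg _).trans (hqp 0 0 t)
  -- `e t` is the modulus of `e^{izt}`. The integral equation directly bounds only `e t * ‖U t‖`, so
  -- `U` might a priori grow exponentially, and its boundedness has to be proved before it can be
  -- compared with zero.
  set e : ℝ → ℝ := fun t => Real.exp (-(z.im * t)) with he
  have hee : ∀ t : ℝ, ‖Complex.exp (Complex.I * z * t)‖ = e t := fun t => by
    rw [Complex.norm_exp]
    simp [he]
  have he0 : ∀ t, 0 < e t := fun t => Real.exp_pos _
  have hez : 0 ≤ z.im := hz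
  have hanti : ∀ {s t : ℝ}, s ≤ t → e t ≤ e s := fun {s t} hst =>
    Real.exp_le_exp.2 (neg_le_neg (mul_le_mul_of_nonneg_left hst hez))
  have hec : Continuous e := by fun_prop
  set Cw := ∫ s in Ioi 0, ‖q 1 0 s * U s + q 1 1 s * W s‖ with hCw
  have hCw0 : 0 ≤ Cw := integral_nonneg fun _ => norm_nonneg _
  have hWb : ∀ t, 0 ≤ t → ‖W t‖ ≤ Cw := fun t ht => by
    rw [heW t ht, norm_neg]
    exact (norm_integral_le_integral_norm _).trans
      (setIntegral_mono_set hiW.norm (ae_of_all _ fun _ => norm_nonneg _)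
        (Ioi_subset_Ioi ht).eventuallyLE)
  set φ : ℝ → ℝ := fun t => e t * ‖U t‖ with hφ
  have hφc : ContinuousOn φ (Ici 0) := hec.continuousOn.mul hU.norm
  obtain ⟨Cu, hφb⟩ : ∃ C, ∀ t, 0 ≤ t → φ t ≤ C := by
    refine ⟨∫ s : ℝ in Ioi 0, ‖Complex.exp (Complex.I * z * s) * (q 0 0 s * U s + q 0 1 s * W s)‖,
      fun t ht => ?_⟩
    simp only [hφ]
    rw [← hee, ← norm_mul, heU t ht, norm_neg]
    exact (norm_integral_le_integral_norm _).trans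
      (setIntegral_mono_set hiU.norm (ae_of_all _ fun _ => norm_nonneg _)
        (Ioi_subset_Ioi ht).eventuallyLE)
  have hφ0 : ∀ t, 0 ≤ φ t := fun t => mul_nonneg (he0 t).le (norm_nonneg _)
  set P := ∫ s in Ioi 0, p s with hP
  have hP0 : 0 ≤ P := setIntegral_nonneg measurableSet_Ioi fun s hs => h0 s (le_of_lt hs)
  have hpφ : ∀ {t : ℝ}, 0 ≤ t → IntegrableOn (fun s => p s * φ s) (Ioi t) := fun ht =>
    integrableOn_mul_of_bdd hp hi hφc (C := Cu)
      (fun t ht => by rw [abs_of_nonneg (hφ0 t)]; exact hφb t ht) ht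
  -- Grönwall on `[a, ∞)`: there `e s ≤ e a`, so the contribution of `W` is at most `e a * (Cw *
  -- P)`. Evaluated at `a`, both sides carry the factor `e a`; cancelling it bounds `U a`
  -- independently of `a`.
  have hUb : ∀ a, 0 ≤ a → ‖U a‖ ≤ 2 * (Cw * P) * Real.exp (2 * P) := fun a ha => by
    have h := gronwall_tail hp hi h0 ha (φ := φ) (H := e a * (Cw * P)) (C := Cu)
      (fun t _ => hφ0 t) (fun t ht => hφb t (ha.trans ht)) (fun t ht => ?_)
      (mul_nonneg (he0 a).le (mul_nonneg hCw0 hP0))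
    · have h2 : e a * ‖U a‖ ≤ e a * (2 * (Cw * P) * Real.exp (2 * P)) := by
        calc e a * ‖U a‖ ≤ _ := h
          _ = _ := by ring
      exact le_of_mul_le_mul_left h2 (he0 a)
    · have ht0 := ha.trans ht
      have h1 : φ t ≤ ∫ s : ℝ in Ioi t, (p s * (e a * Cw) + p s * φ s) := by
        simp only [hφ]
        rw [← hee, ← norm_mul, heU t ht0, norm_neg]
        refine norm_integral_le_of_norm_le
          (((IntegrableOn.tail hi ht0).mul_const _).add (hpφ ht0)) ?_
        refine (ae_restrict_iff' measurableSet_Ioi).2 (ae_of_all _ fun s hs => ?_)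
        have hs : t < s := hs
        rw [norm_mul, hee]
        calc e s * ‖q 0 0 s * U s + q 0 1 s * W s‖
            ≤ e s * (‖q 0 0 s‖ * ‖U s‖ + ‖q 0 1 s‖ * ‖W s‖) := by
              refine mul_le_mul_of_nonneg_left ((norm_add_le _ _).trans ?_) (he0 s).le
              rw [norm_mul, norm_mul]
          _ = ‖q 0 1 s‖ * (e s * ‖W s‖) + ‖q 0 0 s‖ * (e s * ‖U s‖) := by ring
          _ ≤ p s * (e a * Cw) + p s * (e s * ‖U s‖) := by
              have := hqp 0 1 s
              have := hqp 0 0 s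
              have := hWb s (ht0.trans hs.le)
              have := hanti (ht.trans hs.le)
              have := (he0 s).le
              have := (he0 a).le
              have := h0 s (ht0.trans hs.le)
              gcongr
      rw [integral_add ((IntegrableOn.tail hi ht0).mul_const _) (hpφ ht0), integral_mul_const] at h1
      refine h1.trans (add_le_add_left ?_ _)
      rw [show e a * (Cw * P) = P * (e a * Cw) by ring]
      refine mul_le_mul_of_nonneg_right ?_ (mul_nonneg (he0 a).le hCw0)
      exact setIntegral_mono_set hi ((ae_restrict_iff' measurableSet_Ioi).2
        (ae_of_all _ fun r hr => h0 r (le_of_lt hr))) (Ioi_subset_Ioi ht0).eventuallyLE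
  set ψ : ℝ → ℝ := fun t => ‖U t‖ + ‖W t‖ with hψ
  have hψc : ContinuousOn ψ (Ici 0) := hU.norm.add hW.norm
  have hψ0 : ∀ t, 0 ≤ ψ t := fun t => add_nonneg (norm_nonneg _) (norm_nonneg _)
  have hψb : ∀ t, 0 ≤ t → ψ t ≤ 2 * (Cw * P) * Real.exp (2 * P) + Cw := fun t ht =>
    add_le_add (hUb t ht) (hWb t ht)
  have hrow : ∀ i, ContinuousOn (fun s => ‖q i 0 s‖ + ‖q i 1 s‖) (Ici 0) ∧
      IntegrableOn (fun s => ‖q i 0 s‖ + ‖q i 1 s‖) (Ioi 0) := fun i =>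
    ⟨(hq i 0).1.norm.add (hq i 1).1.norm,
      (hq i 0).integrableOn.norm.add (hq i 1).integrableOn.norm⟩
  have hrowψ : ∀ i {t : ℝ}, 0 ≤ t →
      IntegrableOn (fun s => (‖q i 0 s‖ + ‖q i 1 s‖) * ψ s) (Ioi t) := fun i t ht =>
    integrableOn_mul_of_bdd (hrow i).1 (hrow i).2 hψc
      (fun t ht => by rw [abs_of_nonneg (hψ0 t)]; exact hψb t ht) ht
  have hrowle : ∀ i s, ‖q i 0 s * U s + q i 1 s * W s‖ ≤ (‖q i 0 s‖ + ‖q i 1 s‖) * ψ s :=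
    fun i s => by
      refine (norm_add_le _ _).trans ?_
      rw [norm_mul, norm_mul]
      simp only [hψ]
      have a1 := mul_nonneg (norm_nonneg (q i 0 s)) (norm_nonneg (W s))
      have a2 := mul_nonneg (norm_nonneg (q i 1 s)) (norm_nonneg (U s))
      linarith
  -- Now that `U` is bounded, `e s ≤ e t` for `s ≥ t` gives an inequality without inhomogeneity, and
  -- Grönwall with `H = 0` forces `ψ = 0`.
  have hψle : ∀ t, 0 ≤ t → ψ t ≤ ∫ s in Ioi t, p s * ψ s := fun t ht => by
    have h1 : ‖U t‖ ≤ ∫ s in Ioi t, (‖q 0 0 s‖ + ‖q 0 1 s‖) * ψ s := by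
      have h2 : e t * ‖U t‖ ≤ ∫ s in Ioi t, e t * ((‖q 0 0 s‖ + ‖q 0 1 s‖) * ψ s) := by
        rw [← hee, ← norm_mul, heU t ht, norm_neg]
        refine norm_integral_le_of_norm_le ((hrowψ 0 ht).const_mul _) ?_
        refine (ae_restrict_iff' measurableSet_Ioi).2 (ae_of_all _ fun s hs => ?_)
        rw [norm_mul, hee, hee]
        exact mul_le_mul (hanti (le_of_lt hs)) (hrowle 0 s) (norm_nonneg _) (he0 t).le
      rw [integral_const_mul] at h2
      exact le_of_mul_le_mul_left h2 (he0 t)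
    have h2 : ‖W t‖ ≤ ∫ s in Ioi t, (‖q 1 0 s‖ + ‖q 1 1 s‖) * ψ s := by
      rw [heW t ht, norm_neg]
      exact norm_integral_le_of_norm_le (hrowψ 1 ht) (ae_of_all _ fun s => hrowle 1 s)
    have h3 : ∫ s in Ioi t, p s * ψ s = (∫ s in Ioi t, (‖q 0 0 s‖ + ‖q 0 1 s‖) * ψ s) +
        ∫ s in Ioi t, (‖q 1 0 s‖ + ‖q 1 1 s‖) * ψ s := by
      rw [← integral_add (hrowψ 0 ht) (hrowψ 1 ht)]
      congr 1 with s
      simp only [hp_def, Fin.sum_univ_two]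
      ring
    rw [h3]
    exact add_le_add h1 h2
  intro t ht
  have h := gronwall_tail hp hi h0 ht (φ := ψ) (H := 0) (fun t _ => hψ0 t)
    (fun s hs => hψb s (ht.trans hs)) (fun s hs => by simpa using hψle s (ht.trans hs)) le_rfl
  simp only [mul_zero, zero_mul, hψ] at h
  have h1 := norm_nonneg (U t)
  have h2 := norm_nonneg (W t)
  exact ⟨norm_eq_zero.1 (by linarith), norm_eq_zero.1 (by linarith)⟩

section Solution

variable {lam : ℝ} {g : Fin 3 → ℝ → ℝ} {m n : ℕ}

lemma BoundaryData.isBdd (hg : BoundaryData m n g) (j : Fin 3) : IsBdd (fun t => (g j t : ℂ)) :=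
  ((hg.sobolev j).multiplier (s := 0) (by fin_cases j <;> simp <;> omega) (by omega)).isBdd

lemma BoundaryData.weightedL1 (hg : BoundaryData m n g) (j : Fin 3) :
    WeightedL1 n (fun t => (g j t : ℂ)) := (hg.sobolev j).weightedL1

lemma BoundaryData.weightedL1_sq (hg : BoundaryData m n g) :
    WeightedL1 n (fun t => (g 0 t : ℂ) * g 0 t) := (hg.isBdd 0).mul_weightedL1 (hg.weightedL1 0)

lemma BoundaryData.weightedL1_pot (hg : BoundaryData m n g) : WeightedL1 n (pot lam g) :=
  (pot_sobolev hg).weightedL1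

lemma weightedL1_V (hlam : lam ^ 2 = 1) (hg : BoundaryData m n g) (k : ℂ) (i j : Fin 2) :
    WeightedL1 n (fun t => V lam g t k i j) := by
  have h00 : WeightedL1 n (fun t => V lam g t k 0 0) := by
    simp only [V_zero_zero]
    exact hg.weightedL1_sq.const_mul _
  fin_cases i <;> fin_cases j
  · exact h00
  · simp only [Fin.zero_eta, Fin.mk_one, V_zero_one]
    exact (((hg.weightedL1 0).const_mul _).add ((hg.weightedL1 1).const_mul _)).add
      hg.weightedL1_pot
  · simp only [Fin.zero_eta, Fin.mk_one, V_one_zero hlam]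
    exact (((hg.weightedL1 0).const_mul _).sub ((hg.weightedL1 1).const_mul _)).add
      (hg.weightedL1_pot.const_mul _)
  · simp only [Fin.mk_one, V_one_one]
    exact h00.neg

/-- Multiplying the first equation by `e^{8ik³t}` frees the kernel from `t`, and the difference of
two solutions becomes a solution of the homogeneous system. No boundedness of the solutions is
assumed. -/
lemma IsSecondColumn.unique (hlam : lam ^ 2 = 1) (hg : BoundaryData m n g) {k : ℂ}
    (hk : k ∈ closure Dplus) {u v u' v' : ℝ → ℂ} (h : IsSecondColumn lam g k u v)
    (h' : IsSecondColumn lam g k u' v') {t : ℝ} (ht : 0 ≤ t) : u t = u' t ∧ v t = v' t := by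
  obtain ⟨hu, hv, h⟩ := h
  obtain ⟨hu', hv', h'⟩ := h'
  have hE : ∀ s t : ℝ, Complex.exp (Complex.I * (8 * k ^ 3) * t) *
      Complex.exp (8 * Complex.I * k ^ 3 * (s - t)) = Complex.exp (Complex.I * (8 * k ^ 3) * s) :=
    fun s t => by
      rw [← Complex.exp_add]
      congr 1
      ring
  have key := volterra_system_eq_zero (phase_mem_upperHalf hk)
    (q := fun i j t => V lam g t k i j)
    (fun i j => (weightedL1_V hlam hg k i j).mono (Nat.zero_le n)) (U := fun t => u t - u' t)
    (W := fun t => v t - v' t) (hu.sub hu') (hv.sub hv') ?_ (fun t ht => ?_) ?_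
    (fun t ht => ?_) t ht
  · exact ⟨sub_eq_zero.1 key.1, sub_eq_zero.1 key.2⟩
  · have h1 := ((h 0 le_rfl).1.1).sub ((h' 0 le_rfl).1.1)
    refine h1.congr (ae_of_all _ fun s => ?_)
    have := hE s 0
    simp only [Complex.ofReal_zero, mul_zero, Complex.exp_zero, one_mul] at this
    simp only [Pi.sub_apply, Complex.ofReal_zero, this]
    ring
  · obtain ⟨⟨a1, a2⟩, -⟩ := h t ht
    obtain ⟨⟨b1, b2⟩, -⟩ := h' t ht
    conv_lhs => rw [a2, b2]
    rw [neg_sub_neg, ← integral_sub b1 a1, ← integral_const_mul, ← integral_neg]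
    congr 1 with s
    rw [← mul_sub, ← mul_assoc, hE]
    ring
  · have h1 := ((h 0 le_rfl).2.1).sub ((h' 0 le_rfl).2.1)
    refine h1.congr (ae_of_all _ fun s => ?_)
    simp only [Pi.sub_apply]
    ring
  · obtain ⟨-, a1, a2⟩ := h t ht
    obtain ⟨-, b1, b2⟩ := h' t ht
    conv_lhs => rw [a2, b2]
    rw [sub_sub_sub_cancel_left, ← integral_sub b1 a1, ← integral_neg]
    congr 1 with s
    ring

lemma continuousOn_V (hlam : lam ^ 2 = 1) (hg : BoundaryData m n g) (k : ℂ) (i j : Fin 2) :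
    ContinuousOn (fun t => V lam g t k i j) (Ici 0) := (weightedL1_V hlam hg k i j).1

/-- The differential equation for the second column. -/
lemma IsSecondColumn.hasDerivWithinAt (hlam : lam ^ 2 = 1) (hg : BoundaryData m n g) {k : ℂ}
    {u v : ℝ → ℂ} (h : IsSecondColumn lam g k u v) {t : ℝ} (ht : 0 ≤ t) :
    HasDerivWithinAt u (-(8 * Complex.I * k ^ 3 * u t) +
      (V lam g t k 0 0 * u t + V lam g t k 0 1 * v t)) (Ici 0) t ∧
    HasDerivWithinAt v (V lam g t k 1 0 * u t + V lam g t k 1 1 * v t) (Ici 0) t := by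
  obtain ⟨hu, hv, h⟩ := h
  have hV := continuousOn_V hlam hg k
  have hc : ∀ i, ContinuousOn (fun s => V lam g s k i 0 * u s + V lam g s k i 1 * v s) (Ici 0) :=
    fun i => ((hV i 0).mul hu).add ((hV i 1).mul hv)
  constructor
  · have hexp : Continuous fun s : ℝ => Complex.exp (8 * Complex.I * k ^ 3 * s) := by fun_prop
    have hi : IntegrableOn (fun s : ℝ => Complex.exp (8 * Complex.I * k ^ 3 * s) *
        (V lam g s k 0 0 * u s + V lam g s k 0 1 * v s)) (Ioi 0) := by
      simpa using (h 0 le_rfl).1.1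
    have h1 := (hasDerivAt_tail (hexp.continuousOn.mul (hc 0)) hi ht).fun_neg
    have h2 : HasDerivAt (fun s : ℝ => Complex.exp (-(8 * Complex.I * k ^ 3 * s)))
        (Complex.exp (-(8 * Complex.I * k ^ 3 * t)) * (-(8 * Complex.I * k ^ 3 * 1))) t :=
      (((Complex.ofRealCLM.hasDerivAt (x := t)).const_mul (8 * Complex.I * k ^ 3)).neg).cexp
    have h3 := h2.hasDerivWithinAt (s := Ici 0).mul h1
    have hueq : ∀ s ∈ Ici (0:ℝ), u s = Complex.exp (-(8 * Complex.I * k ^ 3 * s)) *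
        -∫ r in Ioi s, Complex.exp (8 * Complex.I * k ^ 3 * r) *
          (V lam g r k 0 0 * u r + V lam g r k 0 1 * v r) := fun s hs => by
      conv_lhs => rw [(h s hs).1.2]
      rw [mul_neg, ← integral_const_mul]
      congr 2 with r
      rw [← mul_assoc, ← Complex.exp_add]
      congr 2
      ring
    refine (h3.congr hueq (hueq t ht)).congr_deriv ?_
    have hut := hueq t ht
    have hE : Complex.exp (-(8 * Complex.I * k ^ 3 * t)) * Complex.exp (8 * Complex.I * k ^ 3 * t)
        = 1 := by
      rw [← Complex.exp_add]
      simp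
    simp only [Pi.mul_apply]
    linear_combination (8 * Complex.I * k ^ 3) * hut +
      (V lam g t k 0 0 * u t + V lam g t k 0 1 * v t) * hE
  · have h1 := (hasDerivAt_tail (hc 1) (h 0 le_rfl).2.1 ht).const_sub 1
    refine (h1.congr (fun s hs => (h s hs).2.2) (h t ht).2.2).congr_deriv (by simp)

end Solution

/-! ### The solution of the Volterra equation -/

lemma volterra_add {n : ℕ} {κ q q' : ℝ → ℂ} (hκ : IsKernel n κ) (hq : WeightedL1 n q)
    (hq' : WeightedL1 n q') :
    volterra n κ (fun s => q s + q' s) = volterra n κ q + volterra n κ q' := by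
  ext w t
  simp only [add_apply, BoundedContinuousFunction.coe_add, Pi.add_apply]
  rw [volterra_apply hκ hq, volterra_apply hκ hq', volterra_apply hκ (hq.add hq'),
    ← integral_add (integrableOn_volterra_integrand hκ hq w t.coe_nonneg)
      (integrableOn_volterra_integrand hκ hq' w t.coe_nonneg)]
  congr 1 with s
  ring

lemma volterra_const_mul {n : ℕ} {κ q : ℝ → ℂ} (hκ : IsKernel n κ) (hq : WeightedL1 n q) (c : ℂ) :
    volterra n κ (fun s => c * q s) = c • volterra n κ q := by
  ext w t
  simp only [smul_apply, BoundedContinuousFunction.coe_smul, smul_eq_mul]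
  rw [volterra_apply hκ hq, volterra_apply hκ (hq.const_mul c), ← integral_const_mul]
  congr 1 with s
  ring

/-- The diagonal matrix of phases: `8 k³` in the first row and `0` in the second. -/
def phase (k : ℂ) : Fin 2 → ℂ := ![8 * k ^ 3, 0]

lemma phase_zero (k : ℂ) : phase k 0 = 8 * k ^ 3 := rfl

lemma phase_one (k : ℂ) : phase k 1 = 0 := rfl

lemma phase_mem {k : ℂ} (hk : k ∈ closure Dplus) (i : Fin 2) : phase k i ∈ upperHalf := by
  fin_cases i
  · exact phase_mem_upperHalf hk
  · exact (le_refl (0:ℝ) : 0 ≤ (0:ℂ).im)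

lemma oscOp_add {n : ℕ} {z : ℂ} (hz : z ∈ upperHalf) {q q' : ℝ → ℂ} (hq : WeightedL1 n q)
    (hq' : WeightedL1 n q') :
    oscOp n 0 (fun s => q s + q' s) z = oscOp n 0 q z + oscOp n 0 q' z :=
  volterra_add (isKernel_oscKernel (Nat.zero_le n) hz) hq hq'

lemma oscOp_const_mul {n : ℕ} {z : ℂ} (hz : z ∈ upperHalf) {q : ℝ → ℂ} (hq : WeightedL1 n q)
    (c : ℂ) : oscOp n 0 (fun s => c * q s) z = c • oscOp n 0 q z :=
  volterra_const_mul (isKernel_oscKernel (Nat.zero_le n) hz) hq c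

lemma contDiffOn_oscOp_phase {n : ℕ} {q : ℝ → ℂ} (hq : WeightedL1 n q) (i : Fin 2) :
    ContDiffOn ℂ n (fun k => oscOp n 0 q (phase k i)) (closure Dplus) := by
  refine (contDiffOn_oscOp hq).comp (f := fun k => phase k i) ?_ fun k hk => phase_mem hk i
  fin_cases i
  · change ContDiffOn ℂ n (fun k : ℂ => 8 * k ^ 3) (closure Dplus)
    fun_prop
  · exact contDiffOn_const

section Solution

variable {lam : ℝ} {g : Fin 3 → ℝ → ℝ} {m n : ℕ}

/-- The integral operator of the Volterra equation for the second column. -/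
def columnOp (lam : ℝ) (g : Fin 3 → ℝ → ℝ) (n : ℕ) (k : ℂ) :
    (ℝ≥0 →ᵇ ℂ) × (ℝ≥0 →ᵇ ℂ) →L[ℂ] (ℝ≥0 →ᵇ ℂ) × (ℝ≥0 →ᵇ ℂ) :=
  blockOp (oscOp n 0 (fun s => V lam g s k 0 0) (phase k 0))
    (oscOp n 0 (fun s => V lam g s k 0 1) (phase k 0))
    (oscOp n 0 (fun s => V lam g s k 1 0) (phase k 1))
    (oscOp n 0 (fun s => V lam g s k 1 1) (phase k 1))

/-- The density is a polynomial in `k` with coefficients in the weighted `L¹`; by linearity the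
operator is a polynomial combination of operators whose densities do not depend on `k`. -/
lemma contDiffOn_oscOp_V (hlam : lam ^ 2 = 1) (hg : BoundaryData m n g) (i j : Fin 2) :
    ContDiffOn ℂ n (fun k => oscOp n 0 (fun s => V lam g s k i j) (phase k i))
      (closure Dplus) := by
  have h0 := hg.weightedL1 0
  have h1 := hg.weightedL1 1
  have hs := hg.weightedL1_sq
  have hp := hg.weightedL1_pot (lam := lam)
  have hpoly : ∀ c : ℂ, ∀ l : ℕ, ContDiffOn ℂ n (fun k : ℂ => c * k ^ l) (closure Dplus) :=
    fun c l => by fun_prop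
  fin_cases i <;> fin_cases j
  · refine ((hpoly (-2 * Complex.I * lam) 1).smul (contDiffOn_oscOp_phase hs 0)).congr
      fun k hk => ?_
    simp only [Fin.zero_eta, V_zero_zero, pow_one]
    exact oscOp_const_mul (phase_mem hk 0) hs _
  · refine ((((hpoly (-4) 2).smul (contDiffOn_oscOp_phase h0 0)).add
      ((hpoly (2 * Complex.I) 1).smul (contDiffOn_oscOp_phase h1 0))).add
      (contDiffOn_oscOp_phase hp 0)).congr fun k hk => ?_
    simp only [Fin.zero_eta, Fin.mk_one, V_zero_one, pow_one]
    rw [oscOp_add (phase_mem hk 0) ((h0.const_mul _).add (h1.const_mul _)) hp,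
      oscOp_add (phase_mem hk 0) (h0.const_mul _) (h1.const_mul _),
      oscOp_const_mul (phase_mem hk 0) h0, oscOp_const_mul (phase_mem hk 0) h1]
    rfl
  · refine ((((hpoly (-4 * lam) 2).smul (contDiffOn_oscOp_phase h0 1)).add
      ((hpoly (-(2 * Complex.I * lam)) 1).smul (contDiffOn_oscOp_phase h1 1))).add
      ((hpoly lam 0).smul (contDiffOn_oscOp_phase hp 1))).congr fun k hk => ?_
    simp only [Fin.zero_eta, Fin.mk_one, V_one_zero hlam, pow_one, pow_zero, mul_one,
      sub_eq_add_neg, ← neg_mul]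
    rw [oscOp_add (phase_mem hk 1) ((h0.const_mul _).add (h1.const_mul _)) (hp.const_mul _),
      oscOp_add (phase_mem hk 1) (h0.const_mul _) (h1.const_mul _),
      oscOp_const_mul (phase_mem hk 1) h0, oscOp_const_mul (phase_mem hk 1) h1,
      oscOp_const_mul (phase_mem hk 1) hp]
    rfl
  · refine ((hpoly (2 * Complex.I * lam) 1).smul (contDiffOn_oscOp_phase hs 1)).congr
      fun k hk => ?_
    have : ∀ s, V lam g s k 1 1 = 2 * Complex.I * lam * k * (g 0 s * g 0 s) := fun s => by
      rw [V_one_one, V_zero_zero]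
      ring
    simp only [Fin.mk_one, this, pow_one]
    exact oscOp_const_mul (phase_mem hk 1) hs _

lemma contDiffOn_columnOp (hlam : lam ^ 2 = 1) (hg : BoundaryData m n g) :
    ContDiffOn ℂ n (columnOp lam g n) (closure Dplus) :=
  contDiffOn_blockOp (contDiffOn_oscOp_V hlam hg 0 0) (contDiffOn_oscOp_V hlam hg 0 1)
    (contDiffOn_oscOp_V hlam hg 1 0) (contDiffOn_oscOp_V hlam hg 1 1)

lemma isUnit_one_add_columnOp (hlam : lam ^ 2 = 1) (hg : BoundaryData m n g) {k : ℂ}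
    (hk : k ∈ closure Dplus) : IsUnit (1 + columnOp lam g n k) :=
  isUnit_one_add_volterra (κ := fun i _ => oscKernel 0 (phase k i))
    (q := fun i j s => V lam g s k i j)
    (fun i _ => isKernel_oscKernel (Nat.zero_le n) (phase_mem hk i)) (weightedL1_V hlam hg k)
    fun i _ τ hτ => (norm_oscKernel_le (phase_mem hk i) 0 hτ).trans (by simp)

/-- The second column of the solution. -/
def column (lam : ℝ) (g : Fin 3 → ℝ → ℝ) (n : ℕ) (k : ℂ) : (ℝ≥0 →ᵇ ℂ) × (ℝ≥0 →ᵇ ℂ) :=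
  Ring.inverse (1 + columnOp lam g n k) (0, 1)

instance instNormedRingOpPairBC : NormedRing
    ((ℝ≥0 →ᵇ ℂ) × (ℝ≥0 →ᵇ ℂ) →L[ℂ] (ℝ≥0 →ᵇ ℂ) × (ℝ≥0 →ᵇ ℂ)) :=
  ContinuousLinearMap.toNormedRing

/-- Inversion is smooth at every unit of the Banach algebra of operators, so the regularity of
`columnOp` in `k` passes to the solution, up to the boundary of `D₊`. -/
lemma contDiffOn_column (hlam : lam ^ 2 = 1) (hg : BoundaryData m n g) :
    ContDiffOn ℂ n (column lam g n) (closure Dplus) := by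
  have h1 : ContDiffOn ℂ n (fun k => 1 + columnOp lam g n k) (closure Dplus) :=
    contDiffOn_const.add (contDiffOn_columnOp hlam hg)
  have h2 : ContDiffOn ℂ n (fun k => Ring.inverse (1 + columnOp lam g n k)) (closure Dplus) := by
    intro k hk
    obtain ⟨U, hU⟩ := isUnit_one_add_columnOp hlam hg hk
    have h3 := contDiffAt_ringInverse ℂ (n := n) U
    rw [hU] at h3
    exact h3.comp_contDiffWithinAt k (h1 k hk)
  exact h2.clm_apply contDiffOn_const

lemma column_eq (hlam : lam ^ 2 = 1) (hg : BoundaryData m n g) {k : ℂ}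
    (hk : k ∈ closure Dplus) :
    column lam g n k + columnOp lam g n k (column lam g n k) = (0, 1) := by
  have h := Ring.mul_inverse_cancel _ (isUnit_one_add_columnOp hlam hg hk)
  have h2 := congrArg (fun L : (ℝ≥0 →ᵇ ℂ) × (ℝ≥0 →ᵇ ℂ) →L[ℂ] (ℝ≥0 →ᵇ ℂ) × (ℝ≥0 →ᵇ ℂ) =>
    L (0, 1)) h
  simpa only [mul_apply_eq_comp, add_apply, one_apply_eq_self, Function.comp_apply, column] using h2

lemma oscOp_apply {z : ℂ} (hz : z ∈ upperHalf) {q : ℝ → ℂ} (hq : WeightedL1 n q)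
    (w : ℝ≥0 →ᵇ ℂ) (t : ℝ≥0) : oscOp n 0 q z w t =
      ∫ s in Ioi (t : ℝ), Complex.exp (Complex.I * z * (s - t)) * (q s * w s.toNNReal) := by
  rw [oscOp, volterra_apply (isKernel_oscKernel (Nat.zero_le n) hz) hq]
  simp [oscKernel]

lemma integrableOn_oscOp {z : ℂ} (hz : z ∈ upperHalf) {q : ℝ → ℂ} (hq : WeightedL1 n q)
    (w : ℝ≥0 →ᵇ ℂ) {t : ℝ} (ht : 0 ≤ t) : IntegrableOn (fun s : ℝ =>
      Complex.exp (Complex.I * z * (s - t)) * (q s * w s.toNNReal)) (Ioi t) := by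
  simpa [oscKernel] using
    integrableOn_volterra_integrand (isKernel_oscKernel (Nat.zero_le n) hz) hq w ht

lemma continuous_extend (w : ℝ≥0 →ᵇ ℂ) : Continuous fun t : ℝ => w t.toNNReal :=
  w.continuous.comp continuous_real_toNNReal

lemma isSecondColumn_column (hlam : lam ^ 2 = 1) (hg : BoundaryData m n g) {k : ℂ}
    (hk : k ∈ closure Dplus) : IsSecondColumn lam g k (fun t => (column lam g n k).1 t.toNNReal)
      (fun t => (column lam g n k).2 t.toNNReal) := by
  have hV := weightedL1_V hlam hg k
  set x := column lam g n k with hx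
  have h := column_eq hlam hg hk
  rw [← hx, columnOp, blockOp_apply] at h
  refine ⟨(continuous_extend _).continuousOn, (continuous_extend _).continuousOn, fun t ht => ?_⟩
  have ht' : ((t.toNNReal : ℝ≥0) : ℝ) = t := Real.coe_toNNReal t ht
  have h1 := congrArg (fun y : (ℝ≥0 →ᵇ ℂ) × (ℝ≥0 →ᵇ ℂ) => y.1 t.toNNReal) h
  have h2 := congrArg (fun y : (ℝ≥0 →ᵇ ℂ) × (ℝ≥0 →ᵇ ℂ) => y.2 t.toNNReal) h
  simp only [Prod.fst_add, Prod.snd_add, BoundedContinuousFunction.coe_add, Pi.add_apply,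
    BoundedContinuousFunction.coe_zero, Pi.zero_apply, BoundedContinuousFunction.coe_one,
    Pi.one_apply, oscOp_apply (phase_mem hk _) (hV _ _), ht'] at h1 h2
  have hi : ∀ i j (w : ℝ≥0 →ᵇ ℂ), IntegrableOn (fun s : ℝ =>
      Complex.exp (Complex.I * phase k i * (s - t)) * (V lam g s k i j * w s.toNNReal)) (Ioi t) :=
    fun i j w => integrableOn_oscOp (phase_mem hk i) (hV i j) w ht
  rw [← integral_add (hi 0 0 _) (hi 0 1 _)] at h1
  rw [← integral_add (hi 1 0 _) (hi 1 1 _)] at h2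
  have e0 : ∀ s : ℝ, Complex.exp (Complex.I * phase k 0 * (s - t)) *
      (V lam g s k 0 0 * x.1 s.toNNReal) + Complex.exp (Complex.I * phase k 0 * (s - t)) *
      (V lam g s k 0 1 * x.2 s.toNNReal) = Complex.exp (8 * Complex.I * k ^ 3 * (s - t)) *
        (V lam g s k 0 0 * x.1 s.toNNReal + V lam g s k 0 1 * x.2 s.toNNReal) := fun s => by
    rw [← mul_add, phase_zero]
    congr 2
    ring
  have e1 : ∀ s : ℝ, Complex.exp (Complex.I * phase k 1 * (s - t)) *
      (V lam g s k 1 0 * x.1 s.toNNReal) + Complex.exp (Complex.I * phase k 1 * (s - t)) *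
      (V lam g s k 1 1 * x.2 s.toNNReal) =
        V lam g s k 1 0 * x.1 s.toNNReal + V lam g s k 1 1 * x.2 s.toNNReal := fun s => by
    rw [phase_one]
    simp
  have i0 := (hi 0 0 x.1).add (hi 0 1 x.2)
  have i1 := (hi 1 0 x.1).add (hi 1 1 x.2)
  simp only [e0] at h1
  simp only [e1] at h2
  refine ⟨⟨i0.congr (ae_of_all _ fun s => e0 s), eq_neg_of_add_eq_zero_left h1⟩,
    i1.congr (ae_of_all _ fun s => e1 s), eq_sub_of_add_eq h2⟩

/-! ### Existence, uniqueness and symmetries of `T` -/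

lemma mem_closure_Dplus_conj {k : ℂ} (hk : k ∈ closure Dminus) : conj k ∈ closure Dplus := by
  rw [mem_closure_Dminus] at hk
  rw [mem_closure_Dplus, ← map_pow, Complex.conj_im]
  linarith

lemma mem_closure_Dplus_neg_conj {k : ℂ} (hk : k ∈ closure Dplus) : -conj k ∈ closure Dplus := by
  rw [mem_closure_Dplus] at hk ⊢
  rw [Odd.neg_pow (by decide), ← map_pow, Complex.neg_im, Complex.conj_im]
  linarith

/-- Only the second column has to be solved for; the first is its reflection under `k ↦ k̄`, which
exchanges `D̄₋` and `D̄₊`. -/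
lemma exists_isVolterraSolution (hlam : lam ^ 2 = 1) (hg : BoundaryData m n g) :
    ∃ T', IsVolterraSolution lam g T' := by
  refine ⟨fun t k => !![conj ((column lam g n (conj k)).2 t.toNNReal),
    (column lam g n k).1 t.toNNReal; lam * conj ((column lam g n (conj k)).1 t.toNNReal),
    (column lam g n k).2 t.toNNReal], isVolterraSolution_iff.2 ⟨fun k hk => ?_, fun k hk => ?_⟩⟩
  · have h := (isSecondColumn_column hlam hg (mem_closure_Dplus_conj hk)).isFirstColumn hlam
    rw [Complex.conj_conj] at h
    simpa using h
  · simpa using isSecondColumn_column hlam hg hk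

lemma isVolterraSolution_T (hlam : lam ^ 2 = 1) (hg : BoundaryData m n g) :
    IsVolterraSolution lam g (T lam g) :=
  Classical.epsilon_spec (exists_isVolterraSolution hlam hg)

lemma isVolterraSolution_unique (hlam : lam ^ 2 = 1) (hg : BoundaryData m n g)
    {T₁ T₂ : ℝ → ℂ → Matrix (Fin 2) (Fin 2) ℂ} (h₁ : IsVolterraSolution lam g T₁)
    (h₂ : IsVolterraSolution lam g T₂) (i : Fin 2) {k : ℂ} (hk : k ∈ columnDomain i) {t : ℝ}
    (ht : 0 ≤ t) (a : Fin 2) : T₁ t k a i = T₂ t k a i := by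
  rw [isVolterraSolution_iff] at h₁ h₂
  have hl : (lam : ℂ) ≠ 0 := by
    rintro h
    have : lam = 0 := by exact_mod_cast h
    simp [this] at hlam
  fin_cases i
  · have hk : k ∈ closure Dminus := hk
    have h := ((h₁.1 k hk).isSecondColumn hlam).unique hlam hg (mem_closure_Dplus_conj hk)
      ((h₂.1 k hk).isSecondColumn hlam) ht
    have h0 := (starRingEnd ℂ).injective h.2
    have h1 := (starRingEnd ℂ).injective (mul_left_cancel₀ hl h.1)
    fin_cases a
    · exact h0
    · exact h1
  · have hk : k ∈ closure Dplus := hk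
    have h := (h₁.2 k hk).unique hlam hg hk (h₂.2 k hk) ht
    fin_cases a
    · exact h.1
    · exact h.2

lemma isSecondColumn_T (hlam : lam ^ 2 = 1) (hg : BoundaryData m n g) {k : ℂ}
    (hk : k ∈ closure Dplus) :
    IsSecondColumn lam g k (fun t => T lam g t k 0 1) (fun t => T lam g t k 1 1) :=
  (isVolterraSolution_iff.1 (isVolterraSolution_T hlam hg)).2 k hk

lemma T_eq_column (hlam : lam ^ 2 = 1) (hg : BoundaryData m n g) {k : ℂ}
    (hk : k ∈ closure Dplus) {t : ℝ} (ht : 0 ≤ t) :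
    T lam g t k 0 1 = (column lam g n k).1 t.toNNReal ∧
      T lam g t k 1 1 = (column lam g n k).2 t.toNNReal :=
  (isSecondColumn_T hlam hg hk).unique hlam hg hk (isSecondColumn_column hlam hg hk) ht

lemma B_eq_column (hlam : lam ^ 2 = 1) (hg : BoundaryData m n g) {k : ℂ}
    (hk : k ∈ closure Dplus) : B lam g k = (column lam g n k).1 0 := by
  simpa [B, S] using (T_eq_column hlam hg hk le_rfl).1

lemma A_eq_column (hlam : lam ^ 2 = 1) (hg : BoundaryData m n g) {k : ℂ}
    (hk : k ∈ closure Dplus) : A lam g k = (column lam g n k).2 0 := by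
  simpa [A, S] using (T_eq_column hlam hg hk le_rfl).2

lemma S_first_column (hlam : lam ^ 2 = 1) (hg : BoundaryData m n g) {k : ℂ}
    (hk : k ∈ closure Dminus) : S lam g k 0 0 = conj (A lam g (conj k)) ∧
      S lam g k 1 0 = lam * conj (B lam g (conj k)) := by
  have h1 := ((isVolterraSolution_iff.1 (isVolterraSolution_T hlam hg)).1 k hk).isSecondColumn hlam
  obtain ⟨h2, h3⟩ := h1.unique hlam hg (mem_closure_Dplus_conj hk)
    (isSecondColumn_T hlam hg (mem_closure_Dplus_conj hk)) (le_refl (0:ℝ))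
  have hl : (lam : ℂ) ^ 2 = 1 := by exact_mod_cast hlam
  refine ⟨?_, ?_⟩
  · rw [A, S, S, ← h3, Complex.conj_conj]
  · rw [B, S, S, ← h2, map_mul, Complex.conj_conj, Complex.conj_ofReal]
    linear_combination (-T lam g 0 k 1 0) * hl

lemma A_B_neg_conj (hlam : lam ^ 2 = 1) (hg : BoundaryData m n g) {k : ℂ}
    (hk : k ∈ closure Dplus) : A lam g k = conj (A lam g (-conj k)) ∧
      B lam g k = conj (B lam g (-conj k)) := by
  have h := (isSecondColumn_T hlam hg hk).unique hlam hg hk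
    (isSecondColumn_T hlam hg (mem_closure_Dplus_neg_conj hk)).neg_conj (le_refl (0:ℝ))
  exact ⟨h.2, h.1⟩

/-- The exponential has modulus at most 1, so each component differs from its limit by at most the
tail of an integrable function. -/
lemma tendsto_column (hlam : lam ^ 2 = 1) (hg : BoundaryData m n g) {k : ℂ}
    (hk : k ∈ closure Dplus) :
    Tendsto (fun t : ℝ => (column lam g n k).1 t.toNNReal) atTop (𝓝 0) ∧
      Tendsto (fun t : ℝ => (column lam g n k).2 t.toNNReal) atTop (𝓝 1) := by
  have hV := weightedL1_V hlam hg k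
  obtain ⟨-, -, h⟩ := isSecondColumn_column hlam hg hk
  set x := column lam g n k
  have hint : ∀ i, IntegrableOn (fun s : ℝ => V lam g s k i 0 * x.1 s.toNNReal +
      V lam g s k i 1 * x.2 s.toNNReal) (Ioi 0) := fun i => by
    have h0 : (0:ℂ) ∈ upperHalf := (le_refl (0:ℝ) : 0 ≤ (0:ℂ).im)
    refine ((integrableOn_oscOp h0 (hV i 0) x.1 (le_refl (0:ℝ))).add
      (integrableOn_oscOp h0 (hV i 1) x.2 (le_refl (0:ℝ)))).congr (ae_of_all _ fun s => ?_)
    simp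
  constructor
  · refine squeeze_zero_norm' ?_ (tendsto_tail fun s : ℝ => ‖V lam g s k 0 0 * x.1 s.toNNReal +
      V lam g s k 0 1 * x.2 s.toNNReal‖)
    filter_upwards [eventually_ge_atTop 0] with t ht
    have hu : x.1 t.toNNReal = _ := (h t ht).1.2
    rw [hu, norm_neg]
    refine norm_integral_le_of_norm_le (IntegrableOn.tail (hint 0).norm ht) ?_
    refine (ae_restrict_iff' measurableSet_Ioi).2 (ae_of_all _ fun s hs => ?_)
    have hs : t < s := hs
    rw [norm_mul]
    refine mul_le_of_le_one_left (norm_nonneg _) ?_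
    have := norm_exp_le_one (phase_mem_upperHalf hk) (τ := s - t) (by linarith)
    rw [← mul_assoc, mul_comm Complex.I] at this
    simpa using this
  · have h1 := (tendsto_tail fun s : ℝ => V lam g s k 1 0 * x.1 s.toNNReal +
      V lam g s k 1 1 * x.2 s.toNNReal).const_sub 1
    rw [sub_zero] at h1
    refine h1.congr' ?_
    filter_upwards [eventually_ge_atTop 0] with t ht
    exact ((h t ht).2.2).symm

lemma mem_closure_of_mem_Γ {k : ℂ} (hk : k ∈ Γ) : k ∈ closure Dplus ∧ conj k ∈ closure Dplus := by
  have h : (k ^ 3).im = 0 := by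
    obtain ⟨r, rfl | rfl | rfl⟩ := hk
    · rw [← Complex.ofReal_pow, Complex.ofReal_im]
    · rw [mul_pow, ← Complex.exp_nat_mul, show ((3:ℕ) : ℂ) * (Complex.I * Real.pi / 3) =
        Real.pi * Complex.I by push_cast; ring, Complex.exp_pi_mul_I, ← Complex.ofReal_pow,
        neg_one_mul, Complex.neg_im, Complex.ofReal_im, neg_zero]
    · rw [mul_pow, ← Complex.exp_nat_mul, show ((3:ℕ) : ℂ) * (2 * Complex.I * Real.pi / 3) =
        2 * Real.pi * Complex.I by push_cast; ring, Complex.exp_two_pi_mul_I,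
        ← Complex.ofReal_pow, one_mul, Complex.ofReal_im]
  rw [mem_closure_Dplus, mem_closure_Dplus, ← map_pow, Complex.conj_im, h]
  simp

/-- The determinant relation. -/
lemma det_relation (hlam : lam ^ 2 = 1) (hg : BoundaryData m n g) {k : ℂ} (hk : k ∈ Γ) :
    A lam g k * conj (A lam g (conj k)) - lam * (B lam g k * conj (B lam g (conj k))) = 1 := by
  obtain ⟨hk1, hk2⟩ := mem_closure_of_mem_Γ hk
  rw [A_eq_column hlam hg hk1, A_eq_column hlam hg hk2, B_eq_column hlam hg hk1,
    B_eq_column hlam hg hk2]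
  have hd1 := fun {t : ℝ} (ht : 0 ≤ t) =>
    (isSecondColumn_column hlam hg hk1).hasDerivWithinAt hlam hg ht
  have hd2 := fun {t : ℝ} (ht : 0 ≤ t) =>
    (isSecondColumn_column hlam hg hk2).hasDerivWithinAt hlam hg ht
  have ht1 := tendsto_column hlam hg hk1
  have ht2 := tendsto_column hlam hg hk2
  set u : ℝ → ℂ := fun t => (column lam g n k).1 t.toNNReal
  set v : ℝ → ℂ := fun t => (column lam g n k).2 t.toNNReal
  set u' : ℝ → ℂ := fun t => (column lam g n (conj k)).1 t.toNNReal
  set v' : ℝ → ℂ := fun t => (column lam g n (conj k)).2 t.toNNReal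
  -- By reflection, `(conj v', λ conj u')` is the first column at `k`, so `D t` is the determinant
  -- of `T(t, k)`. Its derivative vanishes because `V` has trace zero and the phases of the two
  -- columns cancel; its limit at infinity is 1.
  set D : ℝ → ℂ := fun t => v t * conj (v' t) - lam * (u t * conj (u' t)) with hD
  have hder : ∀ t, 0 ≤ t → HasDerivWithinAt D 0 (Ici 0) t := fun t ht => by
    obtain ⟨a1, a2⟩ := hd1 ht
    obtain ⟨b1, b2⟩ := hd2 ht
    refine ((a2.mul b2.star).sub ((a1.mul b1.star).const_mul (lam : ℂ))).congr_deriv ?_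
    change (_ * conj _ + _ * conj _) - lam * (_ * conj _ + _ * conj _) = (0 : ℂ)
    have hl : (lam : ℂ) ^ 2 = 1 := by exact_mod_cast hlam
    simp only [map_add, map_mul, map_neg, conj_V_zero_zero, conj_V_zero_one hlam,
      conj_V_one_zero hlam, Complex.conj_conj, map_pow, Complex.conj_I, conj_ofNat_complex,
      V_one_one]
    linear_combination (-(u t * V lam g t k 1 0 * conj (v' t))) * hl
  have hconst : ∀ t, 0 ≤ t → D t = D 0 := fun t ht => by
    refine (convex_Ici (0:ℝ)).is_const_of_fderivWithin_eq_zero (𝕜 := ℝ)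
      (fun s hs => (hder s hs).differentiableWithinAt) (fun s hs => ?_) ht self_mem_Ici
    have := (hder s hs).hasFDerivWithinAt.fderivWithin (uniqueDiffOn_Ici 0 s hs)
    simpa using this
  have hlim : Tendsto D atTop (𝓝 (1 * conj 1 - lam * (0 * conj 0))) :=
    (ht1.2.mul (Complex.continuous_conj.tendsto _ |>.comp ht2.2)).sub
      ((ht1.1.mul (Complex.continuous_conj.tendsto _ |>.comp ht2.1)).const_mul _)
  have hlim2 : Tendsto D atTop (𝓝 (D 0)) := by
    refine tendsto_const_nhds.congr' ?_
    filter_upwards [eventually_ge_atTop 0] with t ht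
    exact (hconst t ht).symm
  have := tendsto_nhds_unique hlim2 hlim
  simpa [hD, u, v, u', v'] using this

end Solution

/-! ### Sums of powers of `1 / k` -/

/-- `∑_{l ∈ I} k^{-l} c_l(s)`. -/
def laurent (I : Finset ℕ) (c : ℕ → ℝ → ℂ) (k : ℂ) (s : ℝ) : ℂ := ∑ l ∈ I, (k⁻¹) ^ l * c l s

section Laurent

variable {n : ℕ} {I : Finset ℕ} {c : ℕ → ℝ → ℂ}

lemma laurent_weightedL1 (hc : ∀ l, WeightedL1 n (c l)) (k : ℂ) :
    WeightedL1 n (laurent I c k) := by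
  classical
  induction I using Finset.induction_on with
  | empty => exact (weightedL1_zero n).congr fun s _ => by simp [laurent]
  | insert i s hi ih =>
    exact (((hc i).const_mul ((k⁻¹) ^ i)).add ih).congr fun t _ => by
      simp [laurent, Finset.sum_insert hi]

lemma laurent_isBdd (hc : ∀ l, IsBdd (c l)) (k : ℂ) : IsBdd (laurent I c k) :=
  isBdd_sum I fun l _ => (isBdd_const _).mul (hc l)

lemma conj_laurent (k : ℂ) (s : ℝ) :
    conj (laurent I c (conj k) s) = laurent I (fun l s => conj (c l s)) k s := by
  simp [laurent]

lemma laurent_const_mul (a k : ℂ) (s : ℝ) :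
    laurent I (fun l s => a * c l s) k s = a * laurent I c k s := by
  simp only [laurent, Finset.mul_sum]
  exact Finset.sum_congr rfl fun l _ => by ring

lemma oscOp_laurent (hc : ∀ l, WeightedL1 n (c l)) {z : ℂ} (hz : z ∈ upperHalf) (k : ℂ) :
    oscOp n 0 (laurent I c k) z = ∑ l ∈ I, (k⁻¹) ^ l • oscOp n 0 (c l) z := by
  classical
  induction I using Finset.induction_on with
  | empty =>
    have h : laurent ∅ c k = fun s => 0 * (0 : ℂ) := by ext s; simp [laurent]
    rw [h, oscOp_const_mul hz (weightedL1_zero n), Finset.sum_empty]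
    exact zero_smul ℂ (oscOp n 0 (fun _ => (0 : ℂ)) z)
  | insert i s hi ih =>
    have h : laurent (insert i s) c k = fun t => (k⁻¹) ^ i * c i t + laurent s c k t := by
      ext t; simp [laurent, Finset.sum_insert hi]
    rw [h, oscOp_add hz ((hc i).const_mul _) (laurent_weightedL1 hc k), oscOp_const_mul hz (hc i),
      Finset.sum_insert hi, ih]

lemma isSymbol_oscOp_phase {q : ℝ → ℂ} (hq : WeightedL1 n q) (i : Fin 2) :
    IsSymbol n 0 (fun k => oscOp n 0 q (phase k i)) := by
  fin_cases i
  · exact isSymbol_oscOp hq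
  · exact isSymbol_const (oscOp n 0 q 0)

/-- The powers of `1/k` come out of the operator by linearity, so the order is governed by the
lowest power present in `I`. -/
lemma isSymbol_oscOp_laurent (hc : ∀ l, WeightedL1 n (c l)) {a : ℤ} (ha : ∀ l ∈ I, a ≤ l)
    (i : Fin 2) : IsSymbol n a (fun k => oscOp n 0 (laurent I c k) (phase k i)) := by
  have h : IsSymbol n a (fun k : ℂ => ∑ l ∈ I, (k⁻¹) ^ l • oscOp n 0 (c l) (phase k i)) :=
    IsSymbol.sum fun l hl =>
      ((isSymbol_inv_pow l).smul (isSymbol_oscOp_phase (hc l) i)).mono (by simpa using ha l hl)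
  exact h.congr fun k hk => oscOp_laurent hc (phase_mem hk.1 i) k

lemma toBC_laurent (hc : ∀ l, IsBdd (c l)) (k : ℂ) :
    toBC (laurent I c k) = ∑ l ∈ I, (k⁻¹) ^ l • toBC (c l) := by
  ext t
  rw [toBC_apply (laurent_isBdd hc k), BoundedContinuousFunction.sum_apply]
  refine Finset.sum_congr rfl fun l _ => ?_
  rw [BoundedContinuousFunction.smul_apply, toBC_apply (hc l), smul_eq_mul]

lemma isSymbol_toBC_laurent (hc : ∀ l, IsBdd (c l)) {a : ℤ} (ha : ∀ l ∈ I, a ≤ l) :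
    IsSymbol n a (fun k => toBC (laurent I c k)) := by
  have h : IsSymbol n a (fun k : ℂ => ∑ l ∈ I, (k⁻¹) ^ l • toBC (c l)) :=
    IsSymbol.sum fun l hl =>
      ((isSymbol_inv_pow l).smul (isSymbol_const _)).mono (by simpa using ha l hl)
  exact h.congr fun k _ => toBC_laurent hc k

lemma hasDerivWithinAt_laurent (hc : ∀ l, DifferentiableOn ℝ (c l) (Ici 0)) (k : ℂ) {t : ℝ}
    (ht : 0 ≤ t) : HasDerivWithinAt (laurent I c k)
      (laurent I (fun l => derivWithin (c l) (Ici 0)) k t) (Ici 0) t :=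
  HasDerivWithinAt.fun_sum fun l _ => ((hc l t ht).hasDerivWithinAt).const_mul _

lemma tendsto_laurent (hc : ∀ l ∈ I, Tendsto (c l) atTop (𝓝 0)) (k : ℂ) :
    Tendsto (laurent I c k) atTop (𝓝 0) := by
  have h := tendsto_finsetSum I fun l hl => (hc l hl).const_mul ((k⁻¹) ^ l)
  simp only [mul_zero, Finset.sum_const_zero] at h
  exact h

/-- Multiplication by `k` shifts the index by one. The vanishing coefficient at the top lets the
shifted sum keep the same range, so that powers of `k` can be traded for shifts without boundary
terms at the upper end. -/
lemma mul_sum_inv_pow {k : ℂ} (hk : k ≠ 0) {a : ℕ → ℂ} {N i : ℕ} (h : a (N + i) = 0) :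
    k * ∑ l ∈ Finset.range N, (k⁻¹) ^ l * a (l + i) =
      k * a i + ∑ l ∈ Finset.range N, (k⁻¹) ^ l * a (l + (i + 1)) := by
  have h1 : ∑ l ∈ Finset.range N, (k⁻¹) ^ l * a (l + i) =
      ∑ l ∈ Finset.range (N + 1), (k⁻¹) ^ l * a (l + i) := by
    rw [Finset.sum_range_succ, h]
    simp
  rw [h1, Finset.sum_range_succ', mul_add, Finset.mul_sum, add_comm]
  congr 1
  · simp
  · refine Finset.sum_congr rfl fun l _ => ?_
    rw [pow_succ, show l + 1 + i = l + (i + 1) by ring]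
    field_simp

end Laurent

/-! ### Integration of scalar equations -/

/-- Variation of constants started at infinity: the boundary term disappears since `w` tends to zero
and the exponential has modulus at most 1 for `s ≥ t`. -/
lemma eq_neg_integral_of_hasDerivWithinAt {z : ℂ} (hz : z ∈ upperHalf) {w F : ℝ → ℂ}
    (hw : ∀ t, 0 ≤ t → HasDerivWithinAt w (-(Complex.I * z * w t) + F t) (Ici 0) t)
    (hF : ∀ t : ℝ, 0 ≤ t →
      IntegrableOn (fun s : ℝ => Complex.exp (Complex.I * z * (s - t)) * F s) (Ioi t))
    (hlim : Tendsto w atTop (𝓝 0)) {t : ℝ} (ht : 0 ≤ t) :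
    w t = -∫ s in Ioi t, Complex.exp (Complex.I * z * (s - t)) * F s := by
  have hd : ∀ s : ℝ, 0 ≤ s → HasDerivWithinAt
      (fun s : ℝ => Complex.exp (Complex.I * z * (s - t)) * w s)
      (Complex.exp (Complex.I * z * (s - t)) * F s) (Ici 0) s := fun s hs => by
    have h1 : HasDerivAt (fun s : ℝ => Complex.exp (Complex.I * z * (s - t)))
        (Complex.exp (Complex.I * z * (s - t)) * (Complex.I * z * 1)) s :=
      (((Complex.ofRealCLM.hasDerivAt (x := s)).sub_const (t : ℂ)).const_mul
        (Complex.I * z)).cexp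
    refine (h1.hasDerivWithinAt.fun_mul (hw s hs)).congr_deriv ?_
    ring
  have h := integral_Ioi_of_hasDerivAt_of_tendsto (a := t) (m := (0 : ℂ))
    (((hd t ht).continuousWithinAt).mono (Ici_subset_Ici.2 ht))
    (fun s hs => (hd s (ht.trans (le_of_lt hs))).hasDerivAt
      (Ici_mem_nhds (ht.trans_lt hs))) (hF t ht) ?_
  · rw [h]
    simp
  · refine squeeze_zero_norm' ?_ (tendsto_zero_iff_norm_tendsto_zero.1 hlim)
    filter_upwards [eventually_ge_atTop t] with s hs
    rw [norm_mul]
    refine mul_le_of_le_one_left (norm_nonneg _) ?_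
    have := norm_exp_le_one hz (τ := s - t) (by linarith)
    simpa using this

lemma sum_oscOp_apply {n : ℕ} {ι : Type*} [Fintype ι] {z : ℂ} (hz : z ∈ upperHalf)
    {q : ι → ℝ → ℂ} (hq : ∀ i, WeightedL1 n (q i)) (w : ι → ℝ≥0 →ᵇ ℂ) {t : ℝ} (ht : 0 ≤ t) :
    IntegrableOn (fun s : ℝ => Complex.exp (Complex.I * z * (s - t)) *
      ∑ i, q i s * w i s.toNNReal) (Ioi t) ∧
    (∑ i, oscOp n 0 (q i) z (w i)) t.toNNReal = ∫ s in Ioi t,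
      Complex.exp (Complex.I * z * (s - t)) * ∑ i, q i s * w i s.toNNReal := by
  have hi : ∀ i, IntegrableOn (fun s : ℝ => Complex.exp (Complex.I * z * (s - t)) *
      (q i s * w i s.toNNReal)) (Ioi t) := fun i => integrableOn_oscOp hz (hq i) (w i) ht
  simp only [Finset.mul_sum]
  refine ⟨integrable_finsetSum _ fun i _ => hi i, ?_⟩
  rw [integral_finsetSum _ fun i _ => hi i, BoundedContinuousFunction.sum_apply]
  refine Finset.sum_congr rfl fun i _ => ?_
  rw [oscOp_apply hz (hq i), Real.coe_toNNReal t ht]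

/-! ### The truncated formal solution -/

section Formal

variable {lam : ℝ} {g : Fin 3 → ℝ → ℝ} {m n : ℕ}

/-- The first component of the truncated formal solution. -/
def formalOff (lam : ℝ) (g : Fin 3 → ℝ → ℝ) (m : ℕ) : ℂ → ℝ → ℂ :=
  laurent (Finset.Ico 1 (m + 4)) fun l => oc lam g m (l + 2)

/-- The second component of the truncated formal solution, without the leading term `1`. -/
def formalDiag (lam : ℝ) (g : Fin 3 → ℝ → ℝ) (m : ℕ) : ℂ → ℝ → ℂ :=
  laurent (Finset.Ico 1 (m + 4)) fun l => dc lam g m (l + 2)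

/-- The error of the truncated formal solution in the first equation. -/
def errOff (lam : ℝ) (g : Fin 3 → ℝ → ℝ) (m : ℕ) : ℂ → ℝ → ℂ :=
  laurent (Finset.Ico (m + 1) (m + 4)) fun l => offRes lam g m (l + 2)

/-- The error of the truncated formal solution in the second equation. -/
def errDiag (lam : ℝ) (g : Fin 3 → ℝ → ℝ) (m : ℕ) : ℂ → ℝ → ℂ :=
  laurent (Finset.Ico (m + 1) (m + 4)) fun l => diagRes lam g m (l + 2)

lemma laurent_range (c : ℕ → ℝ → ℂ) (N : ℕ) (k : ℂ) (s : ℝ) :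
    laurent (Finset.range (N + 1)) c k s = laurent (Finset.Ico 1 (N + 1)) c k s + c 0 s := by
  simp only [laurent]
  rw [Finset.range_eq_Ico, Finset.sum_eq_sum_Ico_succ_bot (Nat.succ_pos N)]
  simp [add_comm]

lemma laurent_eq_of_subset {I J : Finset ℕ} (h : I ⊆ J) {c : ℕ → ℝ → ℂ} {s : ℝ}
    (hc : ∀ l ∈ J, l ∉ I → c l s = 0) (k : ℂ) : laurent I c k s = laurent J c k s :=
  Finset.sum_subset h fun l hl hl' => by rw [hc l hl hl', mul_zero]

lemma formalOff_eq (k : ℂ) (t : ℝ) : formalOff lam g m k t =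
    ∑ l ∈ Finset.range (m + 4), (k⁻¹) ^ l * oc lam g m (l + 2) t := by
  have h := laurent_range (fun l => oc lam g m (l + 2)) (m + 3) k t
  rw [formalOff, ← laurent, h]
  simp

lemma formalDiag_eq (k : ℂ) (t : ℝ) : 1 + formalDiag lam g m k t =
    ∑ l ∈ Finset.range (m + 4), (k⁻¹) ^ l * dc lam g m (l + 2) t := by
  have h := laurent_range (fun l => dc lam g m (l + 2)) (m + 3) k t
  rw [formalDiag, ← laurent, h, add_comm]
  simp

lemma errOff_eq (k : ℂ) (t : ℝ) : errOff lam g m k t =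
    ∑ l ∈ Finset.range (m + 4), (k⁻¹) ^ l * offRes lam g m (l + 2) t := by
  refine laurent_eq_of_subset (fun l hl => ?_) (fun l hl hl' => offRes_eq_zero ?_ t) k
  · simp only [Finset.mem_Ico, Finset.mem_range] at *; omega
  · simp only [Finset.mem_Ico, Finset.mem_range, not_and, not_lt] at *; omega

lemma errDiag_eq (hg : BoundaryData m n g) (k : ℂ) {t : ℝ} (ht : 0 ≤ t) : errDiag lam g m k t =
    ∑ l ∈ Finset.range (m + 4), (k⁻¹) ^ l * diagRes lam g m (l + 2) t := by
  refine laurent_eq_of_subset (fun l hl => ?_) (fun l hl hl' => diagRes_eq_zero hg ?_ ht) k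
  · simp only [Finset.mem_Ico, Finset.mem_range] at *; omega
  · simp only [Finset.mem_Ico, Finset.mem_range, not_and, not_lt] at *; omega

/-- The differential equation for the truncated formal solution. -/
lemma hasDerivWithinAt_formal (hlam : lam ^ 2 = 1) (hg : BoundaryData m n g) {k : ℂ} (hk : k ≠ 0)
    {t : ℝ} (ht : 0 ≤ t) :
    HasDerivWithinAt (formalOff lam g m k) (-(8 * Complex.I * k ^ 3 * formalOff lam g m k t) +
      (V lam g t k 0 0 * formalOff lam g m k t + V lam g t k 0 1 * (1 + formalDiag lam g m k t)) -
      errOff lam g m k t) (Ici 0) t ∧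
    HasDerivWithinAt (formalDiag lam g m k) (V lam g t k 1 0 * formalOff lam g m k t +
      V lam g t k 1 1 * (1 + formalDiag lam g m k t) - errDiag lam g m k t) (Ici 0) t := by
  set c := fun j => oc lam g m j t with hc
  set d := fun j => dc lam g m j t with hd
  have hc0 : ∀ j, m + 6 ≤ j → c j = 0 := fun j hj => by simp [hc, oc_eq_zero hj]
  have hd0 : ∀ j, m + 3 ≤ j → d j = 0 := fun j hj => by simp [hd, dc_eq_zero hj]
  set N := m + 4 with hN
  have sc : ∀ i, 2 ≤ i → _ := fun i hi =>
    mul_sum_inv_pow hk (a := c) (N := N) (i := i) (hc0 _ (by omega))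
  have sd : ∀ i, 2 ≤ i → _ := fun i hi =>
    mul_sum_inv_pow hk (a := d) (N := N) (i := i) (hd0 _ (by omega))
  have c2 := sc 2 le_rfl
  have c3 := sc 3 (by norm_num)
  have c4 := sc 4 (by norm_num)
  have d2 := sd 2 le_rfl
  have d3 := sd 3 (by norm_num)
  have hc2 : c 2 = 0 := by simp [hc]
  have hd2 : d 2 = 1 := by simp [hd]
  -- The error sums start at order `k^0`. The orders `k²` and `k` of the first equation and `k` of
  -- the second are not part of them and have to vanish separately; order `k²` of the second
  -- involves only `c 2 = 0`.
  have r0 := offRes_eq_zero (lam := lam) (g := g) (m := m) (j := 0) (by omega) t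
  have r1 := offRes_eq_zero (lam := lam) (g := g) (m := m) (j := 1) (by omega) t
  have r2 := diagRes_eq_zero (lam := lam) hg (j := 1) (by omega) ht
  have hdo : ∀ j, DifferentiableOn ℝ (oc lam g m j) (Ici 0) := fun j => (oc_sobolev hg j).2.1
  have hdd : ∀ j, DifferentiableOn ℝ (dc lam g m j) (Ici 0) := fun j => (dc_multiplier hg j).2.1
  have hLo : laurent (Finset.Ico 1 N) (fun l => derivWithin (oc lam g m (l + 2)) (Ici 0)) k t =
      ∑ l ∈ Finset.range N, (k⁻¹) ^ l * derivWithin (oc lam g m (l + 2)) (Ici 0) t := by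
    have h := laurent_range (fun l => derivWithin (oc lam g m (l + 2)) (Ici 0)) (m + 3) k t
    rw [← laurent, hN, h]
    simp
  have hLd : laurent (Finset.Ico 1 N) (fun l => derivWithin (dc lam g m (l + 2)) (Ici 0)) k t =
      ∑ l ∈ Finset.range N, (k⁻¹) ^ l * derivWithin (dc lam g m (l + 2)) (Ici 0) t := by
    have h := laurent_range (fun l => derivWithin (dc lam g m (l + 2)) (Ici 0)) (m + 3) k t
    rw [← laurent, hN, h]
    simp
  have e1 : errOff lam g m k t =
      -8 * Complex.I * (∑ l ∈ Finset.range N, (k⁻¹) ^ l * c (l + 5)) -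
      4 * g 0 t * (∑ l ∈ Finset.range N, (k⁻¹) ^ l * d (l + 4)) +
      2 * Complex.I * g 1 t * (∑ l ∈ Finset.range N, (k⁻¹) ^ l * d (l + 3)) -
      2 * Complex.I * lam * g 0 t * g 0 t * (∑ l ∈ Finset.range N, (k⁻¹) ^ l * c (l + 3)) +
      pot lam g t * (∑ l ∈ Finset.range N, (k⁻¹) ^ l * d (l + 2)) -
      ∑ l ∈ Finset.range N, (k⁻¹) ^ l * derivWithin (oc lam g m (l + 2)) (Ici 0) t := by
    rw [errOff_eq]
    simp only [Finset.mul_sum, ← Finset.sum_add_distrib, ← Finset.sum_sub_distrib]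
    refine Finset.sum_congr rfl fun l _ => ?_
    simp only [offRes, hc, hd]
    ring
  have e2 : errDiag lam g m k t =
      -4 * lam * g 0 t * (∑ l ∈ Finset.range N, (k⁻¹) ^ l * c (l + 4)) -
      2 * Complex.I * lam * g 1 t * (∑ l ∈ Finset.range N, (k⁻¹) ^ l * c (l + 3)) +
      2 * Complex.I * lam * g 0 t * g 0 t * (∑ l ∈ Finset.range N, (k⁻¹) ^ l * d (l + 3)) +
      lam * pot lam g t * (∑ l ∈ Finset.range N, (k⁻¹) ^ l * c (l + 2)) -
      ∑ l ∈ Finset.range N, (k⁻¹) ^ l * derivWithin (dc lam g m (l + 2)) (Ici 0) t := by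
    rw [errDiag_eq hg k ht]
    simp only [Finset.mul_sum, ← Finset.sum_add_distrib, ← Finset.sum_sub_distrib]
    refine Finset.sum_congr rfl fun l _ => ?_
    simp only [diagRes, hc, hd]
    ring
  have f1 : formalOff lam g m k t = ∑ l ∈ Finset.range N, (k⁻¹) ^ l * c (l + 2) :=
    formalOff_eq k t
  have f2 : 1 + formalDiag lam g m k t = ∑ l ∈ Finset.range N, (k⁻¹) ^ l * d (l + 2) :=
    formalDiag_eq k t
  simp only [offRes, zero_add, oc_zero, oc_one, dc_zero, dc_one, Nat.reduceAdd] at r0 r1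
  simp only [diagRes, oc_one, dc_one, Nat.reduceAdd] at r2
  simp only [derivWithin_fun_const, Pi.zero_apply] at r0 r1 r2
  change -8 * Complex.I * c 3 - 4 * (g 0 t * d 2) + _ - _ + _ - _ = _ at r0
  change -8 * Complex.I * c 4 - 4 * (g 0 t * d 3) + 2 * Complex.I * (g 1 t * d 2)
    - 2 * Complex.I * lam * (g 0 t * (g 0 t * c 2)) + _ - _ = _ at r1
  change -4 * lam * (g 0 t * c 3) - 2 * Complex.I * lam * (g 1 t * c 2)
    + 2 * Complex.I * lam * (g 0 t * (g 0 t * d 2)) + _ - _ = _ at r2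
  simp only [Nat.reduceAdd] at c2 c3 c4 d2 d3
  constructor
  · refine (hasDerivWithinAt_laurent (fun l => hdo (l + 2)) k ht).congr_deriv ?_
    rw [← hN, hLo, e1, f1, f2, V_zero_zero, V_zero_one]
    -- The relations `c2`, `c3`, `c4`, `d2`, `d3` trade the powers of `k` in the phase and in `V`
    -- for index shifts; `r0` and `r1` remove the positive powers left over.
    linear_combination (8 * Complex.I * k ^ 2 + 2 * Complex.I * lam * g 0 t * g 0 t) * c2 +
      8 * Complex.I * k * c3 + 8 * Complex.I * c4 +
      (4 * g 0 t * k - 2 * Complex.I * g 1 t) * d2 + 4 * g 0 t * d3 - k ^ 2 * r0 - k * r1 +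
      8 * Complex.I * k ^ 3 * hc2
  · refine (hasDerivWithinAt_laurent (fun l => hdd (l + 2)) k ht).congr_deriv ?_
    rw [← hN, hLd, e2, f1, f2, V_one_one, V_zero_zero, V_one_zero hlam]
    linear_combination (4 * lam * g 0 t * k + 2 * Complex.I * lam * g 1 t) * c2 +
      4 * lam * g 0 t * c3 - 2 * Complex.I * lam * g 0 t * g 0 t * d2 - k * r2 +
      4 * lam * g 0 t * k ^ 2 * hc2

end Formal

/-! ### The remainder of the formal solution -/

section Remainder

variable {lam : ℝ} {g : Fin 3 → ℝ → ℝ} {m n : ℕ}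

/-- The second component of the first column of the formal solution. -/
def formalOffConj (lam : ℝ) (g : Fin 3 → ℝ → ℝ) (m : ℕ) : ℂ → ℝ → ℂ :=
  laurent (Finset.Ico 1 (m + 4)) fun l s => lam * conj (oc lam g m (l + 2) s)

/-- The first component of the first column of the formal solution, without the leading `1`. -/
def formalDiagConj (lam : ℝ) (g : Fin 3 → ℝ → ℝ) (m : ℕ) : ℂ → ℝ → ℂ :=
  laurent (Finset.Ico 1 (m + 4)) fun l s => conj (dc lam g m (l + 2) s)

/-- The error in the second component of the first column. -/
def errOffConj (lam : ℝ) (g : Fin 3 → ℝ → ℝ) (m : ℕ) : ℂ → ℝ → ℂ :=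
  laurent (Finset.Ico (m + 1) (m + 4)) fun l s => lam * conj (offRes lam g m (l + 2) s)

/-- The error in the first component of the first column. -/
def errDiagConj (lam : ℝ) (g : Fin 3 → ℝ → ℝ) (m : ℕ) : ℂ → ℝ → ℂ :=
  laurent (Finset.Ico (m + 1) (m + 4)) fun l s => conj (diagRes lam g m (l + 2) s)

lemma formalOffConj_eq (k : ℂ) (t : ℝ) :
    formalOffConj lam g m k t = lam * conj (formalOff lam g m (conj k) t) := by
  rw [formalOff, conj_laurent, ← laurent_const_mul, formalOffConj]

lemma formalDiagConj_eq (k : ℂ) (t : ℝ) :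
    formalDiagConj lam g m k t = conj (formalDiag lam g m (conj k) t) := by
  rw [formalDiag, conj_laurent, formalDiagConj]

lemma errOffConj_eq (k : ℂ) (t : ℝ) :
    errOffConj lam g m k t = lam * conj (errOff lam g m (conj k) t) := by
  rw [errOff, conj_laurent, ← laurent_const_mul, errOffConj]

lemma errDiagConj_eq (k : ℂ) (t : ℝ) :
    errDiagConj lam g m k t = conj (errDiag lam g m (conj k) t) := by
  rw [errDiag, conj_laurent, errDiagConj]

/-- The differential equation for the first column of the formal solution. -/
lemma hasDerivWithinAt_formalConj (hlam : lam ^ 2 = 1) (hg : BoundaryData m n g) {k : ℂ}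
    (hk : k ≠ 0) {t : ℝ} (ht : 0 ≤ t) :
    HasDerivWithinAt (formalOffConj lam g m k) (8 * Complex.I * k ^ 3 * formalOffConj lam g m k t +
      (V lam g t k 1 0 * (1 + formalDiagConj lam g m k t) +
        V lam g t k 1 1 * formalOffConj lam g m k t) - errOffConj lam g m k t) (Ici 0) t ∧
    HasDerivWithinAt (formalDiagConj lam g m k)
      (V lam g t k 0 0 * (1 + formalDiagConj lam g m k t) +
      V lam g t k 0 1 * formalOffConj lam g m k t - errDiagConj lam g m k t) (Ici 0) t := by
  have hl : (lam : ℂ) ^ 2 = 1 := by exact_mod_cast hlam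
  have hk' : conj k ≠ 0 := by simpa using hk
  obtain ⟨h1, h2⟩ := hasDerivWithinAt_formal hlam hg hk' ht
  constructor
  · rw [show formalOffConj lam g m k = _ from funext (formalOffConj_eq k)]
    refine (h1.star.const_mul (lam : ℂ)).congr_deriv ?_
    change (lam : ℂ) * conj _ = _
    beta_reduce
    rw [formalDiagConj_eq, errOffConj_eq]
    simp only [map_add, map_sub, map_mul, map_neg, map_one, conj_V_zero_zero, conj_V_zero_one hlam,
      Complex.conj_conj, map_pow, Complex.conj_I, conj_ofNat_complex]
    linear_combination (V lam g t k 1 0 * (1 + conj (formalDiag lam g m (conj k) t))) * hl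
  · rw [show formalDiagConj lam g m k = _ from funext (formalDiagConj_eq k)]
    refine h2.star.congr_deriv ?_
    change conj _ = _
    rw [formalOffConj_eq, errDiagConj_eq]
    simp only [map_add, map_sub, map_mul, map_one, conj_V_one_one, conj_V_one_zero hlam,
      Complex.conj_conj]
    ring

lemma isBdd_oc (lam : ℝ) (hg : BoundaryData m n g) (j : ℕ) : IsBdd (oc lam g m j) :=
  (oc_sobolev hg j).isBdd

lemma isBdd_dc (lam : ℝ) (hg : BoundaryData m n g) (j : ℕ) : IsBdd (dc lam g m j) :=
  (dc_multiplier hg j).isBdd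

lemma isBdd_formalOff (lam : ℝ) (hg : BoundaryData m n g) (k : ℂ) :
    IsBdd (formalOff lam g m k) := laurent_isBdd (fun _ => isBdd_oc lam hg _) k

lemma isBdd_formalDiag (lam : ℝ) (hg : BoundaryData m n g) (k : ℂ) :
    IsBdd (formalDiag lam g m k) :=
  laurent_isBdd (fun _ => isBdd_dc lam hg _) k

lemma isBdd_formalOffConj (lam : ℝ) (hg : BoundaryData m n g) (k : ℂ) :
    IsBdd (formalOffConj lam g m k) :=
  laurent_isBdd (fun _ => (isBdd_const _).mul (isBdd_oc lam hg _).conj) k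

lemma isBdd_formalDiagConj (lam : ℝ) (hg : BoundaryData m n g) (k : ℂ) :
    IsBdd (formalDiagConj lam g m k) :=
  laurent_isBdd (fun _ => (isBdd_dc lam hg _).conj) k

lemma weightedL1_errOff (lam : ℝ) (hg : BoundaryData m n g) (k : ℂ) :
    WeightedL1 n (errOff lam g m k) :=
  laurent_weightedL1 (fun _ => offRes_weightedL1 hg _) k

lemma weightedL1_errDiag (lam : ℝ) (hg : BoundaryData m n g) (k : ℂ) :
    WeightedL1 n (errDiag lam g m k) :=
  laurent_weightedL1 (fun _ => diagRes_weightedL1 hg _) k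

lemma weightedL1_errOffConj (lam : ℝ) (hg : BoundaryData m n g) (k : ℂ) :
    WeightedL1 n (errOffConj lam g m k) :=
  laurent_weightedL1 (fun _ => (offRes_weightedL1 hg _).conj.const_mul _) k

lemma weightedL1_errDiagConj (lam : ℝ) (hg : BoundaryData m n g) (k : ℂ) :
    WeightedL1 n (errDiagConj lam g m k) :=
  laurent_weightedL1 (fun _ => (diagRes_weightedL1 hg _).conj) k

lemma tendsto_formalOff (lam : ℝ) (hg : BoundaryData m n g) (k : ℂ) :
    Tendsto (formalOff lam g m k) atTop (𝓝 0) :=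
  tendsto_laurent (fun _ _ => (oc_sobolev hg _).tendsto_zero) k

lemma tendsto_formalDiag (k : ℂ) : Tendsto (formalDiag lam g m k) atTop (𝓝 0) :=
  tendsto_laurent (fun l hl => tendsto_dc (by have := (Finset.mem_Ico.1 hl).1; omega)) k

end Remainder

section Remainder

variable {lam : ℝ} {g : Fin 3 → ℝ → ℝ} {m n : ℕ}

/-- The difference of the second column and its truncated formal expansion. -/
def remainder (lam : ℝ) (g : Fin 3 → ℝ → ℝ) (m n : ℕ) (k : ℂ) : (ℝ≥0 →ᵇ ℂ) × (ℝ≥0 →ᵇ ℂ) :=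
  column lam g n k - (toBC (formalOff lam g m k), 1 + toBC (formalDiag lam g m k))

/-- Multiplication by a bounded function. -/
def mulOp : (ℝ≥0 →ᵇ ℂ) →L[ℂ] (ℝ≥0 →ᵇ ℂ) →L[ℂ] (ℝ≥0 →ᵇ ℂ) := ContinuousLinearMap.mul ℂ (ℝ≥0 →ᵇ ℂ)

lemma mulOp_apply (f w : ℝ≥0 →ᵇ ℂ) : mulOp f w = f * w := rfl

/-- The operator of the integral equation for the remainder. -/
def remainderOp (lam : ℝ) (g : Fin 3 → ℝ → ℝ) (m n : ℕ) (k : ℂ) :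
    (ℝ≥0 →ᵇ ℂ) × (ℝ≥0 →ᵇ ℂ) →L[ℂ] (ℝ≥0 →ᵇ ℂ) × (ℝ≥0 →ᵇ ℂ) :=
  blockOp
    (oscOp n 0 (errDiag lam g m k) (phase k 0) - mulOp (toBC (formalDiag lam g m k)))
    (mulOp (toBC (formalOff lam g m k)) - oscOp n 0 (errOff lam g m k) (phase k 0))
    (mulOp (toBC (formalOffConj lam g m k)) - oscOp n 0 (errOffConj lam g m k) (phase k 1))
    (oscOp n 0 (errDiagConj lam g m k) (phase k 1) - mulOp (toBC (formalDiagConj lam g m k)))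

/-- The inhomogeneity of the integral equation for the remainder. -/
def remainderRhs (lam : ℝ) (g : Fin 3 → ℝ → ℝ) (m n : ℕ) (k : ℂ) : (ℝ≥0 →ᵇ ℂ) × (ℝ≥0 →ᵇ ℂ) :=
  (oscOp n 0 (errDiag lam g m k) (phase k 0) (toBC (formalOff lam g m k)) -
      oscOp n 0 (errOff lam g m k) (phase k 0) (1 + toBC (formalDiag lam g m k)),
    oscOp n 0 (errOff lam g m k) (phase k 1) (toBC (formalOffConj lam g m k)) -
      oscOp n 0 (errDiag lam g m k) (phase k 1) (1 + toBC (formalDiagConj lam g m k)))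

lemma mem_Ico_one_le {N l : ℕ} (hl : l ∈ Finset.Ico 1 N) : (1 : ℤ) ≤ l := by
  exact_mod_cast (Finset.mem_Ico.1 hl).1

lemma mem_Ico_succ_le {N l : ℕ} (hl : l ∈ Finset.Ico (m + 1) N) : ((m : ℤ) + 1) ≤ l := by
  exact_mod_cast (Finset.mem_Ico.1 hl).1

lemma isSymbol_formalOff (hg : BoundaryData m n g) :
    IsSymbol n 1 (fun k => toBC (formalOff lam g m k)) :=
  isSymbol_toBC_laurent (fun _ => isBdd_oc lam hg _) fun _ => mem_Ico_one_le

lemma isSymbol_formalDiag (hg : BoundaryData m n g) :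
    IsSymbol n 1 (fun k => toBC (formalDiag lam g m k)) :=
  isSymbol_toBC_laurent (fun _ => isBdd_dc lam hg _) fun _ => mem_Ico_one_le

lemma isSymbol_formalOffConj (hg : BoundaryData m n g) :
    IsSymbol n 1 (fun k => toBC (formalOffConj lam g m k)) :=
  isSymbol_toBC_laurent (fun _ => (isBdd_const _).mul (isBdd_oc lam hg _).conj)
    fun _ => mem_Ico_one_le

lemma isSymbol_formalDiagConj (hg : BoundaryData m n g) :
    IsSymbol n 1 (fun k => toBC (formalDiagConj lam g m k)) :=
  isSymbol_toBC_laurent (fun _ => (isBdd_dc lam hg _).conj) fun _ => mem_Ico_one_le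

lemma isSymbol_errOff (hg : BoundaryData m n g) (i : Fin 2) :
    IsSymbol n (m + 1) (fun k => oscOp n 0 (errOff lam g m k) (phase k i)) :=
  isSymbol_oscOp_laurent (fun _ => offRes_weightedL1 hg _) (fun _ => mem_Ico_succ_le) i

lemma isSymbol_errDiag (hg : BoundaryData m n g) (i : Fin 2) :
    IsSymbol n (m + 1) (fun k => oscOp n 0 (errDiag lam g m k) (phase k i)) :=
  isSymbol_oscOp_laurent (fun _ => diagRes_weightedL1 hg _) (fun _ => mem_Ico_succ_le) i

lemma isSymbol_errOffConj (hg : BoundaryData m n g) (i : Fin 2) :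
    IsSymbol n (m + 1) (fun k => oscOp n 0 (errOffConj lam g m k) (phase k i)) :=
  isSymbol_oscOp_laurent (fun _ => (offRes_weightedL1 hg _).conj.const_mul _)
    (fun _ => mem_Ico_succ_le) i

lemma isSymbol_errDiagConj (hg : BoundaryData m n g) (i : Fin 2) :
    IsSymbol n (m + 1) (fun k => oscOp n 0 (errDiagConj lam g m k) (phase k i)) :=
  isSymbol_oscOp_laurent (fun _ => (diagRes_weightedL1 hg _).conj) (fun _ => mem_Ico_succ_le) i

lemma isSymbol_remainderOp (hg : BoundaryData m n g) :
    IsSymbol n 1 (remainderOp lam g m n) := by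
  have h1 : (1 : ℤ) ≤ m + 1 := by omega
  exact isSymbol_blockOp
    (((isSymbol_errDiag hg 0).mono h1).sub ((isSymbol_formalDiag hg).clm mulOp))
    (((isSymbol_formalOff hg).clm mulOp).sub ((isSymbol_errOff hg 0).mono h1))
    (((isSymbol_formalOffConj hg).clm mulOp).sub ((isSymbol_errOffConj hg 1).mono h1))
    (((isSymbol_errDiagConj hg 1).mono h1).sub ((isSymbol_formalDiagConj hg).clm mulOp))

lemma IsSymbol.clm_apply {E F : Type*} [NormedAddCommGroup E] [NormedSpace ℂ E]
    [NormedAddCommGroup F] [NormedSpace ℂ F] {a b : ℤ} {L : ℂ → E →L[ℂ] F} {f : ℂ → E}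
    (hL : IsSymbol n a L) (hf : IsSymbol n b f) : IsSymbol n (a + b) (fun k => L k (f k)) :=
  IsSymbol.bilinear (ContinuousLinearMap.id ℂ (E →L[ℂ] F)) hL hf

lemma IsSymbol.prodMk {E F : Type*} [NormedAddCommGroup E] [NormedSpace ℂ E]
    [NormedAddCommGroup F] [NormedSpace ℂ F] {a : ℤ} {f : ℂ → E} {h : ℂ → F}
    (hf : IsSymbol n a f) (hh : IsSymbol n a h) : IsSymbol n a (fun k => (f k, h k)) := by
  simpa using (hf.clm (ContinuousLinearMap.inl ℂ E F)).add (hh.clm (ContinuousLinearMap.inr ℂ E F))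

lemma isSymbol_remainderRhs (hg : BoundaryData m n g) :
    IsSymbol n (m + 1) (remainderRhs lam g m n) := by
  have h0 : ∀ {f : ℂ → ℝ≥0 →ᵇ ℂ}, IsSymbol n 1 f → IsSymbol n 0 f := fun hf => hf.mono (by simp)
  have h1 : ∀ {f : ℂ → ℝ≥0 →ᵇ ℂ}, IsSymbol n 1 f → IsSymbol n 0 fun k => 1 + f k := fun hf =>
    (isSymbol_const _).add (h0 hf)
  have key : ∀ {L : ℂ → (ℝ≥0 →ᵇ ℂ) →L[ℂ] (ℝ≥0 →ᵇ ℂ)} {f : ℂ → ℝ≥0 →ᵇ ℂ}, IsSymbol n (m + 1) L →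
      IsSymbol n 0 f → IsSymbol n (m + 1) fun k => L k (f k) := fun hL hf =>
    (hL.clm_apply hf).mono (by simp)
  exact ((key (isSymbol_errDiag hg 0) (h0 (isSymbol_formalOff hg))).sub
    (key (isSymbol_errOff hg 0) (h1 (isSymbol_formalDiag hg)))).prodMk
    ((key (isSymbol_errOff hg 1) (h0 (isSymbol_formalOffConj hg))).sub
    (key (isSymbol_errDiag hg 1) (h1 (isSymbol_formalDiagConj hg))))

/-- The integral equation for the remainder. -/
lemma remainder_eq (hlam : lam ^ 2 = 1) (hg : BoundaryData m n g) {k : ℂ} (hk : k ∈ farSector) :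
    remainder lam g m n k =
      remainderRhs lam g m n k + remainderOp lam g m n k (remainder lam g m n k) := by
  have hk0 := ne_zero_of_mem_farSector hk
  set y := remainder lam g m n k with hy
  set q := formalOff lam g m k with hq
  set r := formalDiag lam g m k with hr
  set s := formalOffConj lam g m k with hs
  set p := formalDiagConj lam g m k with hp
  have bq : IsBdd q := isBdd_formalOff lam hg k
  have br : IsBdd r := isBdd_formalDiag lam hg k
  have bs : IsBdd s := isBdd_formalOffConj lam hg k
  have bp : IsBdd p := isBdd_formalDiagConj lam hg k
  have wo : WeightedL1 n (errOff lam g m k) := weightedL1_errOff lam hg k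
  have wd : WeightedL1 n (errDiag lam g m k) := weightedL1_errDiag lam hg k
  have wo' : WeightedL1 n (errOffConj lam g m k) := weightedL1_errOffConj lam hg k
  have wd' : WeightedL1 n (errDiagConj lam g m k) := weightedL1_errDiagConj lam hg k
  set u : ℝ → ℂ := fun t => (column lam g n k).1 t.toNNReal with hu
  set v : ℝ → ℂ := fun t => (column lam g n k).2 t.toNNReal with hv
  obtain ⟨lu, lv⟩ := tendsto_column hlam hg hk.1
  have lq : Tendsto q atTop (𝓝 0) := tendsto_formalOff lam hg k
  have lr : Tendsto r atTop (𝓝 0) := tendsto_formalDiag k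
  have y1 : ∀ t : ℝ, 0 ≤ t → y.1 t.toNNReal = u t - q t := fun t ht => by
    simp [hy, remainder, toBC_apply bq, ← hq, ht, hu]
  have y2 : ∀ t : ℝ, 0 ≤ t → y.2 t.toNNReal = v t - (1 + r t) := fun t ht => by
    simp [hy, remainder, toBC_apply br, ← hr, ht, hv]
  -- the rotated remainders
  set w₁ : ℝ → ℂ := fun t => (1 + r t) * (u t - q t) - q t * (v t - (1 + r t)) with hw₁
  set w₂ : ℝ → ℂ := fun t => -s t * (u t - q t) + (1 + p t) * (v t - (1 + r t)) with hw₂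
  have lw₁ : Tendsto w₁ atTop (𝓝 0) := by
    have h := ((lr.const_add 1).mul (lu.sub lq)).sub (lq.mul (lv.sub (lr.const_add 1)))
    simpa [hw₂] using h
  have lw₂ : Tendsto w₂ atTop (𝓝 0) := by
    have ls : Tendsto s atTop (𝓝 0) := by
      have h := ((Complex.continuous_conj.tendsto 0).comp
        (tendsto_formalOff lam hg (conj k))).const_mul (lam : ℂ)
      simp only [map_zero, mul_zero] at h
      exact h.congr fun t => (formalOffConj_eq k t).symm
    have lp : Tendsto p atTop (𝓝 0) := by
      have h := (Complex.continuous_conj.tendsto 0).comp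
        (tendsto_formalDiag (lam := lam) (g := g) (m := m) (conj k))
      rw [map_zero] at h
      exact h.congr fun t => (formalDiagConj_eq k t).symm
    have h := (ls.neg.mul (lu.sub lq)).add ((lp.const_add 1).mul (lv.sub (lr.const_add 1)))
    simpa [hw₂] using h
  -- `w₁` is the determinant of `y` with the second formal column, and `w₂` that of the first formal
  -- column with `y`. In their derivatives `V` contributes only its trace, which is zero; the lists
  -- contain the four source terms that remain, each with a residual as a factor.
  have key₁ := fun {t : ℝ} (ht : 0 ≤ t) => sum_oscOp_apply (n := n) (phase_mem hk.1 0)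
    (q := ![errDiag lam g m k, errOff lam g m k, errOff lam g m k, errDiag lam g m k])
    (fun i => by fin_cases i <;> assumption) ![-y.1, y.2, 1 + toBC r, -toBC q] ht
  have key₂ := fun {t : ℝ} (ht : 0 ≤ t) => sum_oscOp_apply (n := n) (phase_mem hk.1 1)
    (q := ![errOffConj lam g m k, errDiagConj lam g m k, errOff lam g m k, errDiag lam g m k])
    (fun i => by fin_cases i <;> assumption) ![y.1, -y.2, -toBC s, 1 + toBC p] ht
  have eq₁ : ∀ t : ℝ, 0 ≤ t → w₁ t = -(∑ i, oscOp n 0 (![errDiag lam g m k, errOff lam g m k,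
      errOff lam g m k, errDiag lam g m k] i) (phase k 0)
      (![-y.1, y.2, 1 + toBC r, -toBC q] i)) t.toNNReal := fun t ht => by
    rw [(key₁ ht).2]
    refine eq_neg_integral_of_hasDerivWithinAt (phase_mem hk.1 0) (fun t ht => ?_)
      (fun t ht => (key₁ ht).1) lw₁ ht
    obtain ⟨du, dv⟩ := (isSecondColumn_column hlam hg hk.1).hasDerivWithinAt hlam hg ht
    obtain ⟨dq, dr⟩ := hasDerivWithinAt_formal hlam hg hk0 ht
    refine (((dr.const_add 1).fun_mul (du.fun_sub dq)).fun_sub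
      (dq.fun_mul (dv.fun_sub (dr.const_add 1)))).congr_deriv ?_
    simp only [Fin.sum_univ_four, Matrix.cons_val, BoundedContinuousFunction.coe_neg, Pi.neg_apply,
      BoundedContinuousFunction.coe_add, Pi.add_apply, BoundedContinuousFunction.coe_one,
      Pi.one_apply, y1 t ht, y2 t ht, toBC_apply bq, toBC_apply br, Real.coe_toNNReal t ht,
      phase_zero, V_one_one, hw₁]
    ring
  have eq₂ : ∀ t : ℝ, 0 ≤ t → w₂ t = -(∑ i, oscOp n 0 (![errOffConj lam g m k,
      errDiagConj lam g m k, errOff lam g m k, errDiag lam g m k] i) (phase k 1)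
      (![y.1, -y.2, -toBC s, 1 + toBC p] i)) t.toNNReal := fun t ht => by
    rw [(key₂ ht).2]
    refine eq_neg_integral_of_hasDerivWithinAt (phase_mem hk.1 1) (fun t ht => ?_)
      (fun t ht => (key₂ ht).1) lw₂ ht
    obtain ⟨du, dv⟩ := (isSecondColumn_column hlam hg hk.1).hasDerivWithinAt hlam hg ht
    obtain ⟨dq, dr⟩ := hasDerivWithinAt_formal hlam hg hk0 ht
    obtain ⟨ds, dp⟩ := hasDerivWithinAt_formalConj hlam hg hk0 ht
    refine ((ds.fun_neg.fun_mul (du.fun_sub dq)).fun_add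
      ((dp.const_add 1).fun_mul (dv.fun_sub (dr.const_add 1)))).congr_deriv ?_
    simp only [Fin.sum_univ_four, Matrix.cons_val, BoundedContinuousFunction.coe_neg, Pi.neg_apply,
      BoundedContinuousFunction.coe_add, Pi.add_apply, BoundedContinuousFunction.coe_one,
      Pi.one_apply, y1 t ht, y2 t ht, toBC_apply bs, toBC_apply bp, Real.coe_toNNReal t ht,
      phase_one, V_one_one, hw₂]
    ring
  refine Prod.ext ?_ ?_
  · ext t
    have h := eq₁ t t.coe_nonneg
    have hy1 := y1 t t.coe_nonneg
    have hy2 := y2 t t.coe_nonneg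
    rw [Real.toNNReal_coe] at h hy1 hy2
    simp only [Fin.sum_univ_four, Matrix.cons_val, map_neg, BoundedContinuousFunction.coe_neg,
      Pi.neg_apply, BoundedContinuousFunction.coe_add, Pi.add_apply] at h
    simp only [remainderRhs, remainderOp, blockOp_apply, Prod.fst_add, ← hq, ← hr,
      BoundedContinuousFunction.coe_add, BoundedContinuousFunction.coe_sub, Pi.add_apply,
      Pi.sub_apply, sub_apply, mulOp_apply, BoundedContinuousFunction.coe_mul, Pi.mul_apply,
      toBC_apply bq, toBC_apply br]
    simp only [hw₁, ← hy1, ← hy2] at h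
    -- The equation for `w₁ = y₁ + r y₁ - q y₂` is solved for its leading term `y₁`. The products
    -- with the small functions `r` and `q` move into `remainderOp`, so the formal matrix never has
    -- to be inverted.
    linear_combination h
  · ext t
    have h := eq₂ t t.coe_nonneg
    have hy1 := y1 t t.coe_nonneg
    have hy2 := y2 t t.coe_nonneg
    rw [Real.toNNReal_coe] at h hy1 hy2
    simp only [Fin.sum_univ_four, Matrix.cons_val, map_neg, BoundedContinuousFunction.coe_neg,
      Pi.neg_apply, BoundedContinuousFunction.coe_add, Pi.add_apply] at h
    simp only [remainderRhs, remainderOp, blockOp_apply, Prod.snd_add, ← hs, ← hp,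
      BoundedContinuousFunction.coe_add, BoundedContinuousFunction.coe_sub, Pi.add_apply,
      Pi.sub_apply, sub_apply, mulOp_apply, BoundedContinuousFunction.coe_mul, Pi.mul_apply,
      toBC_apply bs, toBC_apply bp]
    simp only [hw₂, ← hy1, ← hy2] at h
    linear_combination h

end Remainder

/-! ### The spectral functions -/

section Spectral

variable {lam : ℝ} {g : Fin 3 → ℝ → ℝ} {m n : ℕ}

/-- Differentiability in `k` is already known for the column and for the formal sums; the
fixed-point equation is used only for the growth of the derivatives at infinity. -/
lemma isSymbol_remainder (hlam : lam ^ 2 = 1) (hg : BoundaryData m n g) :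
    IsSymbol n (m + 1) (remainder lam g m n) := by
  refine (isSymbol_remainderRhs hg).of_fixedPoint (isSymbol_remainderOp hg) ?_
    fun k hk => remainder_eq hlam hg hk
  exact ((contDiffOn_column hlam hg).mono inter_subset_left).sub
    ((isSymbol_formalOff hg).1.prodMk (contDiffOn_const.add (isSymbol_formalDiag hg).1))

lemma contDiffOn_A_B (hlam : lam ^ 2 = 1) (hg : BoundaryData m n g) :
    ContDiffOn ℂ n (A lam g) (closure Dplus) ∧ ContDiffOn ℂ n (B lam g) (closure Dplus) := by
  have h := contDiffOn_column hlam hg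
  exact ⟨(h.continuousLinearMap_comp ((BoundedContinuousFunction.evalCLM ℂ (0 : ℝ≥0)).comp
      (ContinuousLinearMap.snd ℂ (ℝ≥0 →ᵇ ℂ) (ℝ≥0 →ᵇ ℂ)))).congr fun k hk => A_eq_column hlam hg hk,
    (h.continuousLinearMap_comp ((BoundedContinuousFunction.evalCLM ℂ (0 : ℝ≥0)).comp
      (ContinuousLinearMap.fst ℂ (ℝ≥0 →ᵇ ℂ) (ℝ≥0 →ᵇ ℂ)))).congr fun k hk => B_eq_column hlam hg hk⟩

lemma expansion_eq (c₀ : ℂ) (c : ℕ → ℂ) (m : ℕ) (k : ℂ) :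
    expansion c₀ c m k = c₀ + ∑ l ∈ Finset.Ico 1 (m + 1), (k⁻¹) ^ l * c l := by
  rw [expansion]
  congr 1
  refine Finset.sum_congr (by ext; simp only [Finset.mem_Icc, Finset.mem_Ico]; omega) fun l _ => ?_
  rw [inv_pow, div_eq_inv_mul]

/-- `dc (l + 2)` vanishes for `l > m`, so the formal diagonal sum at `t = 0` is exactly the
expansion and the difference is the remainder alone. -/
lemma isSymbol_A_sub (hlam : lam ^ 2 = 1) (hg : BoundaryData m n g) :
    IsSymbol n (m + 1) (fun k => A lam g k - expansion 1 (fun l => dc lam g m (l + 2) 0) m k) := by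
  refine ((isSymbol_remainder hlam hg).clm ((BoundedContinuousFunction.evalCLM ℂ (0 : ℝ≥0)).comp
    (ContinuousLinearMap.snd ℂ (ℝ≥0 →ᵇ ℂ) (ℝ≥0 →ᵇ ℂ)))).congr fun k hk => ?_
  have h : formalDiag lam g m k 0 =
      ∑ l ∈ Finset.Ico 1 (m + 1), (k⁻¹) ^ l * dc lam g m (l + 2) 0 := by
    refine (Finset.sum_subset (Finset.Ico_subset_Ico_right (show m + 1 ≤ m + 4 by omega))
      fun l hl hl' => ?_).symm
    simp only [Finset.mem_Ico, not_and, not_lt] at hl hl'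
    have hl2 := hl' hl.1
    have h0 : dc lam g m (l + 2) = fun _ => 0 := dc_eq_zero (by omega)
    simp only [h0, mul_zero]
  have hr := toBC_apply (isBdd_formalDiag lam hg k) 0
  rw [A_eq_column hlam hg hk.1, expansion_eq, ← h]
  simp [remainder, hr]

/-- The formal off-diagonal sum goes three orders beyond `k^{-m}`; those extra terms have order at
least `m + 1` and join the error. -/
lemma isSymbol_B_sub (hlam : lam ^ 2 = 1) (hg : BoundaryData m n g) :
    IsSymbol n (m + 1) (fun k => B lam g k - expansion 0 (fun l => oc lam g m (l + 2) 0) m k) := by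
  have htail : IsSymbol n (m + 1) (fun k : ℂ =>
      ∑ l ∈ Finset.Ico (m + 1) (m + 4), (k⁻¹) ^ l • oc lam g m (l + 2) 0) :=
    IsSymbol.sum fun l hl =>
      ((isSymbol_inv_pow l).smul (isSymbol_const _)).mono (by simpa using mem_Ico_succ_le hl)
  refine (((isSymbol_remainder hlam hg).clm ((BoundedContinuousFunction.evalCLM ℂ (0 : ℝ≥0)).comp
    (ContinuousLinearMap.fst ℂ (ℝ≥0 →ᵇ ℂ) (ℝ≥0 →ᵇ ℂ)))).add htail).congr fun k hk => ?_
  have h : formalOff lam g m k 0 =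
      ∑ l ∈ Finset.Ico 1 (m + 1), (k⁻¹) ^ l * oc lam g m (l + 2) 0 +
        ∑ l ∈ Finset.Ico (m + 1) (m + 4), (k⁻¹) ^ l • oc lam g m (l + 2) 0 :=
    (Finset.sum_Ico_consecutive _ (by omega) (by omega)).symm
  have hr := toBC_apply (isBdd_formalOff lam hg k) 0
  rw [NNReal.coe_zero] at hr
  simp only [B_eq_column hlam hg hk.1, expansion_eq, remainder, ContinuousLinearMap.comp_apply,
    ContinuousLinearMap.coe_fst', Prod.fst_sub, BoundedContinuousFunction.evalCLM_apply,
    BoundedContinuousFunction.sub_apply, hr, h]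
  ring

end Spectral

lemma closure_Dplus_mem_nhds {k : ℂ} (hk : k ∈ Dplus) : closure Dplus ∈ 𝓝 k :=
  mem_of_superset (isOpen_Dplus.mem_nhds hk) subset_closure

lemma analyticOnNhd_of_contDiffOn {n : ℕ} (hn : 1 ≤ n) {f : ℂ → ℂ}
    (hf : ContDiffOn ℂ n f (closure Dplus)) : AnalyticOnNhd ℂ f Dplus :=
  ((hf.differentiableOn (by exact_mod_cast (by omega))).mono subset_closure).analyticOnNhd
    isOpen_Dplus

lemma isBigO_of_isSymbol {n m : ℕ} {f : ℂ → ℂ} (h : IsSymbol n (m + 1) f) :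
    f =O[atInfty] fun k => 1 / k ^ (m + 1) := by
  have h0 := (h.2 0 (Nat.zero_le n)).norm_left.congr_left fun k => norm_iteratedFDerivWithin_zero
  refine h0.of_norm_left.trans (IsBigO.of_bound 1 (Eventually.of_forall fun k => ?_))
  rw [one_mul, Nat.cast_zero, mul_zero, zero_sub, zpow_neg, one_div]
  norm_cast

lemma contDiffAt_expansion (c₀ : ℂ) (c : ℕ → ℂ) (m : ℕ) {k : ℂ} (hk : k ≠ 0) (N : WithTop ℕ∞) :
    ContDiffAt ℂ N (expansion c₀ c m) k :=
  contDiffAt_const.add (ContDiffAt.sum fun _ _ =>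
    contDiffAt_const.div (contDiffAt_id.pow _) (pow_ne_zero _ hk))

/-- The extension is the derivative within `D̄₊`. It agrees with the ordinary derivative on the open
set `D₊` and, at points with `‖k‖ > 1`, with the derivative within `farSector`, where the symbol
estimate lives because the expansion is singular at the origin. -/
lemma derivExpansion_of_isSymbol {n m j : ℕ} (hj : j ≤ n) {f : ℂ → ℂ} {c₀ : ℂ} {c : ℕ → ℂ}
    (hf : ContDiffOn ℂ n f (closure Dplus))
    (h : IsSymbol n (m + 1) (fun k => f k - expansion c₀ c m k)) :
    DerivExpansion f (expansion c₀ c m) m j := by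
  have hjn : (j : WithTop ℕ∞) ≤ n := by exact_mod_cast hj
  refine ⟨iteratedDerivWithin j f (closure Dplus),
    hf.continuousOn_iteratedDerivWithin hjn uniqueDiffOn_closure_Dplus, fun k hk => ?_, ?_⟩
  · exact iteratedDerivWithin_eq_iteratedDeriv uniqueDiffOn_closure_Dplus
      ((hf.of_le hjn).contDiffAt (closure_Dplus_mem_nhds hk)) (subset_closure hk)
  · have hO := (h.2 j hj).norm_left
    have hexp : (2 * (j : ℤ) - (m + 1)) = -((m : ℤ) + 1 - 2 * j) := by ring
    rw [hexp] at hO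
    refine (hO.congr' ?_ EventuallyEq.rfl).of_norm_left
    filter_upwards [eventually_mem_farSector] with k hk
    have hk0 := ne_zero_of_mem_farSector hk
    have hP := contDiffAt_expansion c₀ c m hk0 j
    rw [norm_iteratedFDerivWithin_eq_norm_iteratedDerivWithin,
      ← iteratedDerivWithin_eq_iteratedDeriv uniqueDiffOn_farSector hP hk]
    have h1 : iteratedDerivWithin j f (closure Dplus) k = iteratedDerivWithin j f farSector k := by
      simp only [iteratedDerivWithin]
      rw [farSector, iteratedFDerivWithin_inter_open isOpen_one_lt_norm hk.2]
    rw [h1]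
    congr 1
    exact iteratedDerivWithin_sub hk uniqueDiffOn_farSector
      (((hf.of_le hjn).mono inter_subset_left) k hk) hP.contDiffWithinAt

end MKdV

end

theorem theorem4p3 (lam : ℝ) (hlam : lam = 1 ∨ lam = -1) (m n : ℕ) (hm : 1 ≤ m) (hn : 1 ≤ n)
    (g : Fin 3 → ℝ → ℝ) (hg : MKdV.BoundaryData m n g) :
    -- the Volterra equation determines `T(t,k)` for `t ≥ 0`, `k ∈ (D̄₋, D̄₊)`
    (MKdV.IsVolterraSolution lam g (MKdV.T lam g) ∧
      ∀ T', MKdV.IsVolterraSolution lam g T' →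
        ∀ i, ∀ k ∈ MKdV.columnDomain i, ∀ t : ℝ, 0 ≤ t → ∀ a,
          T' t k a i = MKdV.T lam g t k a i) ∧
    -- the first column of `S(k)` is given by `A` and `B` as well
    (∀ k ∈ closure MKdV.Dminus,
      MKdV.S lam g k 0 0 = conj (MKdV.A lam g (conj k)) ∧
      MKdV.S lam g k 1 0 = lam * conj (MKdV.B lam g (conj k))) ∧
    -- (a)
    (ContinuousOn (MKdV.A lam g) (closure MKdV.Dplus) ∧
      ContinuousOn (MKdV.B lam g) (closure MKdV.Dplus) ∧
      AnalyticOnNhd ℂ (MKdV.A lam g) MKdV.Dplus ∧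
      AnalyticOnNhd ℂ (MKdV.B lam g) MKdV.Dplus) ∧
    -- (b) and (c), with the same constants
    (∃ α β : ℕ → ℂ,
      ((fun k => MKdV.A lam g k - MKdV.expansion 1 α m k) =O[MKdV.atInfty]
          fun k => 1 / k ^ (m + 1)) ∧
      ((fun k => MKdV.B lam g k - MKdV.expansion 0 β m k) =O[MKdV.atInfty]
          fun k => 1 / k ^ (m + 1)) ∧
      ∀ j : ℕ, 1 ≤ j → j ≤ n →
        MKdV.DerivExpansion (MKdV.A lam g) (MKdV.expansion 1 α m) m j ∧
        MKdV.DerivExpansion (MKdV.B lam g) (MKdV.expansion 0 β m) m j) ∧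
    -- (d)
    (∀ k ∈ closure MKdV.Dplus,
      MKdV.A lam g k = conj (MKdV.A lam g (-conj k)) ∧
      MKdV.B lam g k = conj (MKdV.B lam g (-conj k))) ∧
    -- (e)
    (∀ k ∈ MKdV.Γ,
      MKdV.A lam g k * conj (MKdV.A lam g (conj k)) -
        lam * (MKdV.B lam g k * conj (MKdV.B lam g (conj k))) = 1) := by
  have hl : lam ^ 2 = 1 := by rcases hlam with rfl | rfl <;> norm_num
  obtain ⟨hA, hB⟩ := MKdV.contDiffOn_A_B hl hg
  exact ⟨⟨MKdV.isVolterraSolution_T hl hg, fun T' hT' i k hk t ht a =>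
      MKdV.isVolterraSolution_unique hl hg hT' (MKdV.isVolterraSolution_T hl hg) i hk ht a⟩,
    fun k hk => MKdV.S_first_column hl hg hk,
    ⟨hA.continuousOn, hB.continuousOn, MKdV.analyticOnNhd_of_contDiffOn hn hA,
      MKdV.analyticOnNhd_of_contDiffOn hn hB⟩,
    -- The constants are fixed by the symbol estimates: they are the values at `t = 0` of the formal
    -- diagonal and off-diagonal coefficients, and hence the same in (b) and (c).
    ⟨_, _, MKdV.isBigO_of_isSymbol (MKdV.isSymbol_A_sub hl hg),
      MKdV.isBigO_of_isSymbol (MKdV.isSymbol_B_sub hl hg), fun j _ hj =>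
        ⟨MKdV.derivExpansion_of_isSymbol hj hA (MKdV.isSymbol_A_sub hl hg),
          MKdV.derivExpansion_of_isSymbol hj hB (MKdV.isSymbol_B_sub hl hg)⟩⟩,
    fun k hk => MKdV.A_B_neg_conj hl hg hk, fun k hk => MKdV.det_relation hl hg hk⟩
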